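/- Let $\mathbb G$ be a Carnot group of step $s\ge 1$, that is, a connected and simply connected Lie group whose Lie algebra $\mathcal G$ is finite dimensional and stratified: $\mathcal G=V_1\oplus\cdots\oplus V_s$ with $[V_1,V_i]=V_{i+1}$ for $1\le i<s$, $V_s\ne\{0\}$ and $[V_1,V_s]=\{0\}$. As usual, $\mathbb G$ is identified with $\mathcal G$ through exponential coordinates, the group law being given by the Baker--Campbell--Hausdorff formula. Fix an inner product on $\mathcal G$ for which the layers $V_i$ are mutually orthogonal. Let $dx$ be Lebesgue measure on $\mathcal G$ (a Haar measure of $\mathbb G$), write $|E|=\int_E dx$, let $M=\sum_{i=1}^s i\dim V_i$ be the homogeneous dimension, and let $B_R(x)$ be the open ball of radius $R$ centred at $x$ for the Carnot--Carath\'eodory distance (the infimum of the lengths of the horizontal curves joining two points). For a nonnegative Borel measure $\mu$ on $\mathbb G$, $\alpha>0$, $p>1$ and $0<r<\infty$, put $$\mathbf W^{r}_{\alpha,p}\mu(x)=\int_0^r\Big[\frac{\mu(B_t(x))}{t^{M-\alpha p}}\Big]^{\frac1{p-1}}\frac{dt}{t},\qquad x\in\mathbb G .$$ Let $\lambda=8$.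 For every $m\in\mathbb Z$ let $\mathcal D_m=\{E^k_j\}_{k\ge m,\ j\ge 1}$ be a family of Borel sets (approximate dyadic cubes), with points $x^k_j\in\mathbb G$, such that (i) $B_{\lambda^k}(x^k_j)\subset E^k_j\subset B_{\lambda^{k+1}}(x^k_j)$; (ii) for each $k\ge m$ the sets $E^k_j$, $j\ge1$, are pairwise disjoint and $\mathbb G=\bigcup_{j\ge1}E^k_j$; (iii) if $m\le k<l$, then either $E^k_j\cap E^l_i=\emptyset$ or $E^k_j\subset E^l_i$. The side length of $Q=E^k_j$ is $\ell(Q)=\lambda^k$. (No relation between the families for different $m$ is required.) \textbf{Theorem.} Let $\alpha>0$, $p>1$ and $q>p-1$. There are constants $c,C\in(0,\infty)$, depending only on $\mathbb G$ (with its inner product), $\alpha$, $p$ and $q$, such that for all such families $(\mathcal D_m)_{m\in\mathbb Z}$, all $0<r<\infty$ and all nonnegative Borel measures $\mu$ on $\mathbb G$, $$c\,\sup_{m\in\mathbb Z}\sum_{\substack{Q\in\mathcal D_m\\ \ell(Q)\le r}}\Big[\frac{\mu(Q)}{|Q|^{1-\frac{\alpha p}{M}}}\Big]^{\frac q{p-1}}|Q|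 \ \le\ \int_{\mathbb G}\big[\mathbf W^{r}_{\alpha,p}\mu(x)\big]^q\,dx\ \le\ C\,\sup_{m\in\mathbb Z}\sum_{\substack{Q\in\mathcal D_m\\ \ell(Q)\le r}}\Big[\frac{\mu(Q)}{|Q|^{1-\frac{\alpha p}{M}}}\Big]^{\frac q{p-1}}|Q| ,$$ where the quantities may be infinite and each sum runs over the indices $(k,j)$ with $k\ge m$ and $\lambda^k\le r$. -/

import Mathlib

open MeasureTheory Set
open scoped ENNReal

noncomputable section

/-- A Lie ring whose additive group is normed (one common addition). -/
class NormedLieRing (𝔤 : Type*) extends NormedAddCommGroup 𝔤, LieRing 𝔤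

/-- A real Lie algebra with an inner product, on one common vector space structure.  No
compatibility between the bracket and the inner product is required here. -/
class InnerLieAlgebra (𝔤 : Type*) [NormedLieRing 𝔤] extends
  InnerProductSpace ℝ 𝔤, LieAlgebra ℝ 𝔤

/-- A stratification `𝔤 = V₁ ⊕ ⋯ ⊕ V_s`, `[V₁, V_i] = V_{i+1}` for `1 ≤ i < s`, `V_s ≠ 0`,
`[V₁, V_s] = 0`, with `s ≥ 1`, and with the layers mutually orthogonal.  The layers are indexed
by `ℕ`, with `V_i = 0` for `i = 0` and for `i > s`; the last three conditions on brackets are then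
the single condition `[V₁, V_i] = V_{i+1}` for all `i ≥ 1`. -/
structure Stratification (𝔤 : Type*) [NormedLieRing 𝔤] [InnerLieAlgebra 𝔤] where
  step : ℕ
  one_le_step : 1 ≤ step
  layer : ℕ → Submodule ℝ 𝔤
  layer_zero : layer 0 = ⊥
  layer_gt : ∀ i, step < i → layer i = ⊥
  layer_step : layer step ≠ ⊥
  isInternal : DirectSum.IsInternal layer
  bracket : ∀ i, 1 ≤ i →
    Submodule.span ℝ {z : 𝔤 | ∃ x ∈ layer 1, ∃ y ∈ layer i, ⁅x, y⁆ = z} = layer (i + 1)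
  orthogonal : ∀ i j, i ≠ j → ∀ x ∈ layer i, ∀ y ∈ layer j, inner ℝ x y = 0

namespace Stratification

variable {𝔤 : Type*} [NormedLieRing 𝔤] [InnerLieAlgebra 𝔤] (S : Stratification 𝔤)

/-- The homogeneous dimension `M = ∑ i · dim V_i`. -/
def homDim : ℕ := ∑ i ∈ Finset.Icc 1 S.step, i * Module.finrank ℝ (S.layer i)

/-- `e^{ad x}`.  The exponential series is a finite sum since `(ad x)^s = 0`. -/
def expAd (x : 𝔤) : Module.End ℝ 𝔤 :=
  ∑ i ∈ Finset.range S.step, ((i.factorial : ℝ)⁻¹) • (LieAlgebra.ad ℝ 𝔤 x) ^ i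

/-- `g(A)` for `g(z) = log z / (1 - 1/z) = 1 + ∑_{n ≥ 1} (-1)^{n+1} / (n (n+1)) (z - 1)^n`,
used for those `A` for which `A - 1` raises the layers, so that `(A - 1)^s = 0`. -/
def bchSeries (A : Module.End ℝ 𝔤) : Module.End ℝ 𝔤 :=
  1 + ∑ n ∈ Finset.Ico 1 S.step, ((-1 : ℝ) ^ (n + 1) / ((n : ℝ) * ((n : ℝ) + 1))) • (A - 1) ^ n

/-- The group law of the Carnot group in exponential coordinates, `exp x · exp y = exp (x * y)`,
given by the Baker-Campbell-Hausdorff formula in its integral form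
`x * y = x + ∫₀¹ g(e^{ad x} e^{t ad y}) y dt = x + y + [x, y] / 2 + ⋯`.
The Carnot group with Lie algebra `𝔤` is `𝔤` with this multiplication; its identity element is `0`
and its exponential map is the identity of `𝔤`. -/
def mul (x y : 𝔤) : 𝔤 :=
  x + ∫ t in (0 : ℝ)..1, S.bchSeries (S.expAd x * S.expAd (t • y)) y

/-- The value at the point `x` of the left-invariant vector field given by `X ∈ 𝔤`:
the velocity at `t = 0` of the curve `t ↦ x · exp (t X)`. -/
def leftInvariantField (X x : 𝔤) : 𝔤 :=
  deriv (fun t : ℝ => S.mul x (t • X)) 0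

/-- `γ : [a, b] → 𝔾` is a continuously differentiable horizontal curve; `u t ∈ V₁` is its velocity
`γ'(t)`, expressed in the left-invariant frame. -/
structure IsHorizontalCurve (a b : ℝ) (γ u : ℝ → 𝔤) : Prop where
  le : a ≤ b
  continuousOn : ContinuousOn u (Icc a b)
  mem : ∀ t ∈ Icc a b, u t ∈ S.layer 1
  hasDeriv : ∀ t ∈ Icc a b,
    HasDerivWithinAt γ (S.leftInvariantField (u t) (γ t)) (Icc a b) t

/-- The Carnot-Carathéodory distance: the infimum of the lengths of the horizontal curves
from `x` to `y`, the inner product being transported by left translation. -/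
def ccDist (x y : 𝔤) : ℝ≥0∞ :=
  ⨅ (a : ℝ) (b : ℝ) (γ : ℝ → 𝔤) (u : ℝ → 𝔤)
    (_ : S.IsHorizontalCurve a b γ u ∧ γ a = x ∧ γ b = y),
    ENNReal.ofReal (∫ t in a..b, ‖u t‖)

/-- The open Carnot-Carathéodory ball `B_R(x)`. -/
def ccBall (x : 𝔤) (R : ℝ) : Set 𝔤 := {y | S.ccDist x y < ENNReal.ofReal R}

/-- The truncated Wolff potential
`W^r_{α,p} μ (x) = ∫₀^r [μ(B_t(x)) / t^{M - α p}]^{1/(p-1)} dt / t`. -/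
def wolffPotential [MeasurableSpace 𝔤] (α p r : ℝ) (μ : Measure 𝔤) (x : 𝔤) : ℝ≥0∞ :=
  ∫⁻ t in Ioo (0 : ℝ) r,
    (μ (S.ccBall x t) / ENNReal.ofReal (t ^ ((S.homDim : ℝ) - α * p))) ^ (1 / (p - 1))
      * ENNReal.ofReal t⁻¹

/-- The family `𝒟_m` of approximate dyadic cubes `E^k_j`, `k ≥ m`, with `λ = 8`. Only the values
of `center k j = x^k_j` and `cube k j = E^k_j` for `k ≥ m` matter. -/
structure DyadicFamily [MeasurableSpace 𝔤] (m : ℤ) where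
  center : ℤ → ℕ → 𝔤
  cube : ℤ → ℕ → Set 𝔤
  measurableSet : ∀ k, m ≤ k → ∀ j, MeasurableSet (cube k j)
  ball_subset : ∀ k, m ≤ k → ∀ j, S.ccBall (center k j) ((8 : ℝ) ^ k) ⊆ cube k j
  subset_ball : ∀ k, m ≤ k → ∀ j, cube k j ⊆ S.ccBall (center k j) ((8 : ℝ) ^ (k + 1))
  disjoint : ∀ k, m ≤ k → ∀ i j, i ≠ j → Disjoint (cube k i) (cube k j)
  iUnion_eq : ∀ k, m ≤ k → (⋃ j, cube k j) = univ
  nested : ∀ k l, m ≤ k → k < l → ∀ i j, Disjoint (cube k j) (cube l i) ∨ cube k j ⊆ cube l i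

/-- `∑_{Q ∈ 𝒟_m, ℓ(Q) ≤ r} [μ(Q) / |Q|^{1 - α p / M}]^{q/(p-1)} |Q|`, where `ℓ(E^k_j) = 8^k` and
`|Q|` is Lebesgue measure, i.e. the Haar measure of the Carnot group. -/
def dyadicSum [FiniteDimensional ℝ 𝔤] [MeasurableSpace 𝔤] [BorelSpace 𝔤]
    {m : ℤ} (D : S.DyadicFamily m) (α p q r : ℝ) (μ : Measure 𝔤) : ℝ≥0∞ :=
  ∑' (k : {k : ℤ // m ≤ k ∧ (8 : ℝ) ^ k ≤ r}) (j : ℕ),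
    (μ (D.cube k j) / (volume (D.cube k j)) ^ (1 - α * p / (S.homDim : ℝ))) ^ (q / (p - 1))
      * volume (D.cube k j)

end Stratification

end

/-! The theorem splits into a geometric half and a dyadic half. The geometric half shows that
Carnot-Carathéodory balls are symmetric, satisfy the triangle inequality, and have volume `v * R ^
M` with `0 < v < ∞` (`exists_volume_ccBall`). The dyadic half uses nothing else about the group.

Geometry. Left translations are not handled through the Baker-Campbell-Hausdorff product. Let `D` be
the derivation acting as `i` on `V_i`. Conjugation by `e^{ad x}` changes `D` by the inner derivation
of an element `orbitMap x`. Since `D` is invertible, `orbitMap` is a global change of coordinates.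
In it, left translations are affine maps with unipotent linear part `e^{ad z}`, and the
left-invariant field of `X` reads `e^{ad x} D X` (`orbitDeriv_frame`). Hence translations preserve
horizontal curves, lengths and, since `orbitMap` has constant Jacobian, Lebesgue measure. Dilations
give the power `R ^ M`. Positivity of `v` comes from connectivity by horizontal curves
(`mem_reachable`), finiteness from a barrier argument.

Dyadic estimate. Put `a = M - αp` and `β = q / (p - 1) > 1`. The density of generation `k` at `x` is
the mass of a neighbourhood of the cube containing `x`, divided by `8 ^ (k a)`. The integral of its
`β`-th power is comparable to the contribution of generation `k` to the dyadic sum. Over a cube of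
generation `l ≥ k`, the average of the density of generation `k` is at most `C * 8 ^ (-(l - k) αp)`
times the density of generation `l`: mass is preserved up to bounded overlap, and `αp > 0`. So, from
coarse to fine, the densities form an adapted sequence with geometrically decaying conditional
averages.

Lower bound: for such sequences the sum of the `L^β` norms (to the power `β`) is controlled by the
norm of the supremum (`sum_lintegral_rpow_le`), and each density, to the power `1 / (p - 1)`, is
pointwise below the potential once its scale is well below `r`. The remaining top generations are
compared with a lower one. Upper bound: the potential truncated at `8 ^ m` is pointwise below the
sum of the densities, whose norm is controlled by the sum of the norms (`lintegral_sum_pow_le`);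
Fatou's lemma removes the truncation. -/

noncomputable section

namespace Stratification

variable {𝔤 : Type*} [NormedLieRing 𝔤] [InnerLieAlgebra 𝔤] (S : Stratification 𝔤)

/-! ### The filtration and the diagonal endomorphisms of a stratified Lie algebra -/

/-- The ideal `V_i ⊕ V_{i+1} ⊕ ⋯`. -/
def fil (i : ℕ) : Submodule ℝ 𝔤 := ⨆ (j : ℕ) (_ : i ≤ j), S.layer j

variable {S}

lemma layer_le_fil {i j : ℕ} (h : i ≤ j) : S.layer j ≤ S.fil i :=
  le_iSup₂_of_le j h le_rfl

lemma fil_le_iff {i : ℕ} {p : Submodule ℝ 𝔤} :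
    S.fil i ≤ p ↔ ∀ j, i ≤ j → S.layer j ≤ p := by
  simp [fil]

lemma fil_anti {i j : ℕ} (h : i ≤ j) : S.fil j ≤ S.fil i :=
  fil_le_iff.2 fun _ hk => layer_le_fil (h.trans hk)

lemma iSup_layer : ⨆ i, S.layer i = ⊤ := S.isInternal.submodule_iSup_eq_top

lemma fil_one : S.fil 1 = ⊤ := by
  rw [eq_top_iff, ← iSup_layer (S := S), iSup_le_iff]
  intro i
  rcases Nat.eq_zero_or_pos i with rfl | hi
  · simp [S.layer_zero]
  · exact layer_le_fil hi

lemma mem_fil_one (x : 𝔤) : x ∈ S.fil 1 := by simp [fil_one]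

lemma fil_eq_bot {i : ℕ} (h : S.step < i) : S.fil i = ⊥ := by
  rw [eq_bot_iff, fil_le_iff]
  intro j hj
  rw [S.layer_gt j (h.trans_le hj)]

lemma fil_eq_sup (i : ℕ) : S.fil i = S.layer i ⊔ S.fil (i + 1) := by
  apply le_antisymm
  · rw [fil_le_iff]
    intro j hj
    rcases hj.eq_or_lt with rfl | hj
    · exact le_sup_left
    · exact (layer_le_fil (Nat.succ_le_of_lt hj)).trans le_sup_right
  · exact sup_le (layer_le_fil le_rfl) (fil_anti i.le_succ)

/-- Two linear maps that agree on every layer are equal. -/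
lemma linearMap_ext {W : Type*} [AddCommMonoid W] [Module ℝ W] {f g : 𝔤 →ₗ[ℝ] W}
    (h : ∀ i, ∀ v ∈ S.layer i, f v = g v) : f = g := by
  have : (⊤ : Submodule ℝ 𝔤) ≤ LinearMap.eqLocus f g := by
    rw [← iSup_layer (S := S), iSup_le_iff]
    exact fun i v hv => h i v hv
  ext v
  exact this (Submodule.mem_top (x := v))

/-- Induction on `i`: `V_{i+1}` is spanned by brackets `[a, b]` with `a` in `V₁` and `b` in `V_i`,
and the Jacobi identity reduces `[[a, b], y]` to brackets with `a`, which raise the layer by one,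
and with `b`. -/
lemma layer_bracket_mem {i j : ℕ} (hi : 1 ≤ i) {x y : 𝔤} (hx : x ∈ S.layer i)
    (hj : 1 ≤ j) (hy : y ∈ S.layer j) : ⁅x, y⁆ ∈ S.layer (i + j) := by
  induction i, hi using Nat.le_induction generalizing x j y with
  | base =>
    rw [add_comm, ← S.bracket j hj]
    exact Submodule.subset_span ⟨x, hx, y, hy, rfl⟩
  | succ i hi ih =>
    rw [← S.bracket i hi] at hx
    induction hx using Submodule.span_induction with
    | mem z hz =>
      obtain ⟨a, ha, b, hb, rfl⟩ := hz
      rw [lie_lie]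
      refine Submodule.sub_mem _ ?_ ?_
      · have h1 := ih hb hj hy
        have : ⁅a, ⁅b, y⁆⁆ ∈ S.layer (i + j + 1) := by
          rw [← S.bracket (i + j) (by omega)]
          exact Submodule.subset_span ⟨a, ha, _, h1, rfl⟩
        rwa [show i + 1 + j = i + j + 1 by ring]
      · have h1 : ⁅a, y⁆ ∈ S.layer (j + 1) := by
          rw [← S.bracket j hj]
          exact Submodule.subset_span ⟨a, ha, y, hy, rfl⟩
        have := ih hb (by omega : 1 ≤ j + 1) h1
        rwa [show i + 1 + j = i + (j + 1) by ring]
    | zero => simp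
    | add a b _ _ ha hb => rw [add_lie]; exact Submodule.add_mem _ ha hb
    | smul c a _ ha => rw [smul_lie]; exact Submodule.smul_mem _ _ ha

lemma fil_bracket_mem {i j : ℕ} {x y : 𝔤} (hx : x ∈ S.fil i) (hy : y ∈ S.fil j) :
    ⁅x, y⁆ ∈ S.fil (i + j) := by
  have key : ∀ k, i ≤ k → ∀ v ∈ S.layer k, ∀ l, j ≤ l → ∀ w ∈ S.layer l,
      ⁅v, w⁆ ∈ S.fil (i + j) := by
    intro k hk v hv l hl w hw
    rcases Nat.eq_zero_or_pos k with rfl | hk0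
    · rw [S.layer_zero, Submodule.mem_bot] at hv
      simp [hv]
    rcases Nat.eq_zero_or_pos l with rfl | hl0
    · rw [S.layer_zero, Submodule.mem_bot] at hw
      simp [hw]
    exact layer_le_fil (add_le_add hk hl) (layer_bracket_mem hk0 hv hl0 hw)
  have h1 : ∀ k, i ≤ k → ∀ v ∈ S.layer k, ⁅v, y⁆ ∈ S.fil (i + j) := by
    intro k hk v hv
    have : S.fil j ≤ (S.fil (i + j)).comap (LieAlgebra.ad ℝ 𝔤 v) :=
      fil_le_iff.2 fun l hl w hw => by simpa using key k hk v hv l hl w hw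
    simpa using this hy
  have : S.fil i ≤ (S.fil (i + j)).comap (LieAlgebra.ad ℝ 𝔤 y) :=
    fil_le_iff.2 fun l hl w hw => by
      rw [Submodule.mem_comap, LieAlgebra.ad_apply, ← lie_skew, neg_mem_iff]
      exact h1 l hl w hw
  rw [← lie_skew, neg_mem_iff]
  exact this hx

variable (S) in
/-- The endomorphism that multiplies each layer `V_i` by `a i`. -/
def diag (a : ℕ → ℝ) : 𝔤 →ₗ[ℝ] 𝔤 :=
  (DirectSum.toModule ℝ ℕ 𝔤 fun i => a i • (S.layer i).subtype) ∘ₗ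
    (LinearEquiv.ofBijective (DirectSum.coeLinearMap S.layer) S.isInternal).symm.toLinearMap

lemma diag_apply (a : ℕ → ℝ) {i : ℕ} {v : 𝔤} (hv : v ∈ S.layer i) : S.diag a v = a i • v := by
  have : (LinearEquiv.ofBijective (DirectSum.coeLinearMap S.layer) S.isInternal).symm v
      = DirectSum.lof ℝ ℕ (fun i => S.layer i) i ⟨v, hv⟩ :=
    (LinearEquiv.symm_apply_eq _).2 (DirectSum.coeLinearMap_lof S.layer i ⟨v, hv⟩).symm
  simp [diag, this]

lemma diag_comp (a b : ℕ → ℝ) : S.diag a ∘ₗ S.diag b = S.diag fun i => a i * b i := by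
  refine linearMap_ext (S := S) fun i v hv => ?_
  simp [diag_apply _ hv, mul_smul, smul_comm (b i) (a i)]

lemma diag_diag (a b : ℕ → ℝ) (x : 𝔤) : S.diag a (S.diag b x) = S.diag (fun i => a i * b i) x :=
  LinearMap.congr_fun (diag_comp a b) x

lemma diag_eq_id {a : ℕ → ℝ} (h : ∀ i, 1 ≤ i → a i = 1) (x : 𝔤) : S.diag a x = x := by
  have : S.diag a = LinearMap.id := by
    refine linearMap_ext (S := S) fun i v hv => ?_
    rcases Nat.eq_zero_or_pos i with rfl | hi
    · rw [S.layer_zero, Submodule.mem_bot] at hv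
      simp [hv]
    · simp [diag_apply _ hv, h i hi]
  simp [this]

lemma diag_mem_fil (a : ℕ → ℝ) {i : ℕ} {x : 𝔤} (hx : x ∈ S.fil i) : S.diag a x ∈ S.fil i := by
  have : S.fil i ≤ (S.fil i).comap (S.diag a) := fil_le_iff.2 fun j hj v hv => by
    rw [Submodule.mem_comap, diag_apply _ hv]
    exact Submodule.smul_mem _ _ (layer_le_fil hj hv)
  exact this hx

lemma diag_sub_smul_mem_fil (a : ℕ → ℝ) {i : ℕ} {x : 𝔤} (hx : x ∈ S.fil i) :
    S.diag a x - a i • x ∈ S.fil (i + 1) := by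
  rw [fil_eq_sup] at hx
  obtain ⟨v, hv, z, hz, rfl⟩ := Submodule.mem_sup.1 hx
  rw [map_add, diag_apply _ hv, smul_add, add_sub_add_left_eq_sub]
  exact Submodule.sub_mem _ (diag_mem_fil _ hz) (Submodule.smul_mem _ _ hz)

lemma bilin_ext {W : Type*} [AddCommGroup W] [Module ℝ W] {f g : 𝔤 →ₗ[ℝ] 𝔤 →ₗ[ℝ] W}
    (h : ∀ i, 1 ≤ i → ∀ v ∈ S.layer i, ∀ j, 1 ≤ j → ∀ w ∈ S.layer j, f v w = g v w) : f = g := by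
  refine linearMap_ext (S := S) fun i v hv => linearMap_ext (S := S) fun j w hw => ?_
  rcases Nat.eq_zero_or_pos i with rfl | hi
  · rw [S.layer_zero, Submodule.mem_bot] at hv
    simp [hv]
  rcases Nat.eq_zero_or_pos j with rfl | hj
  · rw [S.layer_zero, Submodule.mem_bot] at hw
    simp [hw]
  exact h i hi v hv j hj w hw

/-- The dilation `δ_l`, which is an automorphism of the Lie algebra. -/
abbrev dil (S : Stratification 𝔤) (l : ℝ) : 𝔤 →ₗ[ℝ] 𝔤 := S.diag fun i => l ^ i

lemma dil_lie (l : ℝ) (x y : 𝔤) : S.dil l ⁅x, y⁆ = ⁅S.dil l x, S.dil l y⁆ := by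
  have := bilin_ext (S := S)
    (f := (LieAlgebra.ad ℝ 𝔤 : 𝔤 →ₗ[ℝ] Module.End ℝ 𝔤).compr₂ (S.dil l))
    (g := (LieAlgebra.ad ℝ 𝔤 : 𝔤 →ₗ[ℝ] Module.End ℝ 𝔤).compl₁₂ (S.dil l) (S.dil l)) (by
      intro i hi v hv j hj w hw
      simp [dil, diag_apply _ hv, diag_apply _ hw, diag_apply _ (layer_bracket_mem hi hv hj hw),
        pow_add, mul_smul, smul_comm (l ^ i) (l ^ j)])
  simpa using LinearMap.congr_fun (LinearMap.congr_fun this x) y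

/-- The derivation `D` of the grading. -/
abbrev grade (S : Stratification 𝔤) : 𝔤 →ₗ[ℝ] 𝔤 := S.diag fun i => (i : ℝ)

lemma grade_lie (x y : 𝔤) : S.grade ⁅x, y⁆ = ⁅S.grade x, y⁆ + ⁅x, S.grade y⁆ := by
  have := bilin_ext (S := S)
    (f := (LieAlgebra.ad ℝ 𝔤 : 𝔤 →ₗ[ℝ] Module.End ℝ 𝔤).compr₂ S.grade)
    (g := (LieAlgebra.ad ℝ 𝔤 : 𝔤 →ₗ[ℝ] Module.End ℝ 𝔤).compl₁₂ S.grade LinearMap.id +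
      (LieAlgebra.ad ℝ 𝔤 : 𝔤 →ₗ[ℝ] Module.End ℝ 𝔤).compl₁₂ LinearMap.id S.grade) (by
      intro i hi v hv j hj w hw
      simp [grade, diag_apply _ hv, diag_apply _ hw, diag_apply _ (layer_bracket_mem hi hv hj hw),
        add_smul])
  simpa using LinearMap.congr_fun (LinearMap.congr_fun this x) y

lemma grade_layer_one {v : 𝔤} (hv : v ∈ S.layer 1) : S.grade v = v := by
  simp [grade, diag_apply _ hv]

/-- The inverse of `grade`. -/
abbrev gradeInv (S : Stratification 𝔤) : 𝔤 →ₗ[ℝ] 𝔤 := S.diag fun i => (i : ℝ)⁻¹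

lemma grade_gradeInv (x : 𝔤) : S.grade (S.gradeInv x) = x := by
  rw [diag_diag]
  exact diag_eq_id (fun i hi => mul_inv_cancel₀ (by positivity)) x

lemma gradeInv_grade (x : 𝔤) : S.gradeInv (S.grade x) = x := by
  rw [diag_diag]
  exact diag_eq_id (fun i hi => inv_mul_cancel₀ (by positivity)) x

lemma dil_dil {l l' : ℝ} (h : l * l' = 1) (x : 𝔤) : S.dil l (S.dil l' x) = x := by
  rw [diag_diag]
  exact diag_eq_id (fun i _ => by rw [← mul_pow, h, one_pow]) x

/-- A vector on which the grading derivation acts as `i`, and which lies in `V_{i+1} ⊕ ⋯`,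
vanishes. -/
lemma eq_zero_of_grade_eq {i : ℕ} {w : 𝔤} (hw : w ∈ S.fil (i + 1)) (h : S.grade w = (i : ℝ) • w) :
    w = 0 := by
  -- On the quotient of `fil n` by `fil (n + 1)` the derivation is multiplication by `n`. For `n >
  -- i` this is incompatible with the eigenvalue `i` unless `w` lies one step deeper.
  have key : ∀ n, w ∈ S.fil (i + 1 + n) := by
    intro n
    induction n with
    | zero => exact hw
    | succ n ih =>
      have h1 := diag_sub_smul_mem_fil (fun i => (i : ℝ)) ih
      have h2 : S.grade w - ((i + 1 + n : ℕ) : ℝ) • w = (-(1 + n : ℝ)) • w := by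
        rw [h, ← sub_smul]
        congr 1
        push_cast
        ring
      rw [h2] at h1
      exact (Submodule.smul_mem_iff _ (neg_ne_zero.2 (by positivity))).1 h1
  have := key S.step
  rwa [fil_eq_bot (by omega), Submodule.mem_bot] at this

/-- A unipotent endomorphism that commutes with the grading derivation is the identity. -/
lemma eq_self_of_commute_grade {U : 𝔤 →ₗ[ℝ] 𝔤} (h : ∀ x, U (S.grade x) = S.grade (U x))
    (hU : ∀ i, ∀ x ∈ S.fil i, U x - x ∈ S.fil (i + 1)) (x : 𝔤) : U x = x := by
  have : U = LinearMap.id := by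
    refine linearMap_ext (S := S) fun i v hv => ?_
    -- `U v - v` is again an eigenvector for `i`, but it lies strictly deeper than `V_i`.
    rw [LinearMap.id_apply, ← sub_eq_zero]
    refine eq_zero_of_grade_eq (hU i v (layer_le_fil le_rfl hv)) ?_
    rw [map_sub, ← h]
    simp [grade, diag_apply _ hv, smul_sub]
  simp [this]

/-! ### Determinants of unipotent and of diagonal maps -/

section Det

variable [FiniteDimensional ℝ 𝔤]

/-- `1 - U` is nilpotent, so its characteristic polynomial is a power of `X`; the value of that
polynomial at `1` is `det U`. -/
lemma det_eq_one_of_raises {U : 𝔤 →ₗ[ℝ] 𝔤}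
    (hU : ∀ i, ∀ x ∈ S.fil i, U x - x ∈ S.fil (i + 1)) : LinearMap.det U = 1 := by
  set N : Module.End ℝ 𝔤 := 1 - U with hN
  have hN1 : ∀ n, ∀ x, (N ^ n) x ∈ S.fil (n + 1) := by
    intro n
    induction n with
    | zero => intro x; exact mem_fil_one _
    | succ n ih =>
      intro x
      rw [pow_succ', Module.End.mul_apply]
      have := hU _ _ (ih x)
      rw [← neg_mem_iff, neg_sub] at this
      simpa [hN] using this
  have hnil : IsNilpotent N := by
    refine ⟨S.step, ?_⟩
    ext x
    have := hN1 S.step x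
    rwa [fil_eq_bot (by omega), Submodule.mem_bot] at this
  have h1 := (LinearMap.charpoly_eq_X_pow_iff N).2 fun m => by
    obtain ⟨n, hn⟩ := hnil
    exact ⟨n, by simp [hn]⟩
  have h2 := LinearMap.det_eq_sign_charpoly_coeff U
  have h3 : Polynomial.eval 1 N.charpoly = LinearMap.det (algebraMap ℝ (Module.End ℝ 𝔤) 1 - N) := by
    rw [LinearMap.eval_charpoly]
  rw [h1] at h3
  simpa [hN] using h3.symm

lemma det_diag (a : ℕ → ℝ) :
    LinearMap.det (S.diag a) = ∏ i ∈ Finset.Icc 1 S.step, a i ^ Module.finrank ℝ (S.layer i) := by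
  classical
  let s := Finset.Icc 1 S.step
  have hint : DirectSum.IsInternal fun i : s => S.layer i := by
    rw [DirectSum.isInternal_submodule_iff_iSupIndep_and_iSup_eq_top]
    refine ⟨S.isInternal.submodule_iSupIndep.comp Subtype.val_injective, ?_⟩
    rw [eq_top_iff, ← iSup_layer (S := S), iSup_le_iff]
    intro i
    by_cases hi : i ∈ s
    · exact le_iSup (fun i : s => S.layer i) ⟨i, hi⟩
    · have : S.layer i = ⊥ := by
        simp only [s, Finset.mem_Icc, not_and, not_le] at hi
        rcases Nat.eq_zero_or_pos i with rfl | h0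
        · exact S.layer_zero
        · exact S.layer_gt i (hi h0)
      simp [this]
  let b := hint.collectedBasis fun i : s => Module.finBasis ℝ (S.layer i)
  rw [← LinearMap.det_toMatrix b]
  have : LinearMap.toMatrix b b (S.diag a) = Matrix.diagonal fun k => a k.1 := by
    ext k l
    have hl : b l ∈ S.layer l.1 := hint.collectedBasis_mem _ l
    rw [LinearMap.toMatrix_apply, diag_apply _ hl, map_smul, Module.Basis.repr_self,
      Matrix.diagonal_apply]
    by_cases h : k = l
    · subst h; simp
    · simp [h]
  rw [this, Matrix.det_diagonal, Fintype.prod_sigma]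
  simp only [Finset.prod_const, Finset.card_univ, Fintype.card_fin]
  exact Finset.prod_coe_sort s fun i => a i ^ Module.finrank ℝ (S.layer i)

lemma det_dil (l : ℝ) : LinearMap.det (S.dil l) = l ^ S.homDim := by
  rw [det_diag, homDim, ← Finset.prod_pow_eq_pow_sum]
  exact Finset.prod_congr rfl fun i _ => (pow_mul _ _ _).symm

lemma det_grade_pos : 0 < LinearMap.det S.grade := by
  rw [det_diag]
  refine Finset.prod_pos fun i hi => pow_pos ?_ _
  have := (Finset.mem_Icc.1 hi).1
  positivity

end Det

end Stratification

end

noncomputable section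

/-! ### Exponentials of nilpotent elements -/

section NilpotentExp

variable {𝔸 : Type*} [NormedRing 𝔸] [NormedAlgebra ℝ 𝔸]

lemma eq_of_hasDerivAt_zero {E : Type*} [NormedAddCommGroup E] [NormedSpace ℝ E] {f : ℝ → E}
    (h : ∀ t, HasDerivAt f 0 t) (s t : ℝ) : f s = f t :=
  is_const_of_deriv_eq_zero (fun t => (h t).differentiableAt) (fun t => (h t).deriv) s t

/-- `∫₀ᵗ e^{-τ A} dτ` for `A ^ s = 0`. -/
def intExpNeg (s : ℕ) (A : 𝔸) (t : ℝ) : 𝔸 :=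
  ∑ n ∈ Finset.range s, ((-1) ^ n * t ^ (n + 1) / ((n + 1).factorial : ℝ)) • A ^ n

/-- The truncation of the series of `log z / (1 - 1/z)` at `z = 1`. -/
def logSeries (s : ℕ) (T : 𝔸) : 𝔸 :=
  1 + ∑ n ∈ Finset.Ico 1 s, ((-1 : ℝ) ^ (n + 1) / ((n : ℝ) * ((n : ℝ) + 1))) • (T - 1) ^ n

lemma hasDerivAt_pow_div_factorial (n : ℕ) (t : ℝ) :
    HasDerivAt (fun t : ℝ => t ^ (n + 1) / ((n + 1).factorial : ℝ)) (t ^ n / (n.factorial : ℝ)) t := by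
  have := (hasDerivAt_pow (n + 1) t).div_const ((n + 1).factorial : ℝ)
  refine this.congr_deriv ?_
  rw [Nat.factorial_succ]
  have : (n.factorial : ℝ) ≠ 0 := by positivity
  push_cast
  field_simp

variable {s : ℕ} {A : 𝔸}

lemma exp_eq_sum_of_pow_eq_zero (hA : A ^ s = 0) :
    NormedSpace.exp A = ∑ n ∈ Finset.range s, ((n.factorial : ℝ)⁻¹) • A ^ n := by
  rw [NormedSpace.exp_eq_tsum ℝ]
  refine tsum_eq_sum fun n hn => ?_
  rw [pow_eq_zero_of_le (by simpa using hn) hA, smul_zero]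

lemma exp_smul_eq_sum_of_pow_eq_zero (hA : A ^ s = 0) (t : ℝ) :
    NormedSpace.exp (t • A) = ∑ n ∈ Finset.range s, (t ^ n / (n.factorial : ℝ)) • A ^ n := by
  rw [exp_eq_sum_of_pow_eq_zero (s := s) (by rw [smul_pow, hA, smul_zero])]
  refine Finset.sum_congr rfl fun n _ => ?_
  rw [smul_pow, smul_smul, div_eq_inv_mul]

lemma commute_intExpNeg (t : ℝ) : Commute A (intExpNeg s A t) :=
  Commute.sum_right _ _ _ fun _ _ => ((Commute.refl A).pow_right _).smul_right _

lemma commute_exp_smul (t : ℝ) : Commute A (NormedSpace.exp (t • A)) := by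
  exact ((Commute.refl A).smul_right t).exp_right

lemma hasDerivAt_intExpNeg (hA : A ^ s = 0) (t : ℝ) :
    HasDerivAt (intExpNeg s A) (NormedSpace.exp (-(t • A))) t := by
  rw [← neg_smul, exp_smul_eq_sum_of_pow_eq_zero hA]
  refine HasDerivAt.fun_sum fun n _ => ?_
  have := ((hasDerivAt_pow_div_factorial n t).const_mul ((-1 : ℝ) ^ n)).smul_const (A ^ n)
  refine (this.congr_deriv ?_).congr_of_eventuallyEq (.of_forall fun u => ?_)
  · rw [neg_pow t, mul_div_assoc]
  · simp only [mul_div_assoc]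

variable [CompleteSpace 𝔸]

lemma exp_neg_smul_mul_exp_smul (t : ℝ) :
    NormedSpace.exp (-(t • A)) * NormedSpace.exp (t • A) = 1 := by
  let := NormedAlgebra.restrictScalars ℚ ℝ 𝔸
  rw [← NormedSpace.exp_add_of_commute ((Commute.refl (t • A)).neg_left), neg_add_cancel,
    NormedSpace.exp_zero]

lemma hasDerivAt_exp_neg_smul (t : ℝ) :
    HasDerivAt (fun t : ℝ => NormedSpace.exp (-(t • A))) (-A * NormedSpace.exp (-(t • A))) t := by
  have := hasDerivAt_exp_smul_const' (𝕂 := ℝ) (-A) t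
  simpa only [smul_neg] using this

lemma mul_intExpNeg (hA : A ^ s = 0) (t : ℝ) :
    A * intExpNeg s A t = 1 - NormedSpace.exp (-(t • A)) := by
  have h : ∀ t, HasDerivAt (fun t => A * intExpNeg s A t + NormedSpace.exp (-(t • A))) 0 t := by
    intro t
    have := ((hasDerivAt_intExpNeg hA t).const_mul A).add (hasDerivAt_exp_neg_smul (A := A) t)
    exact this.congr_deriv (by simp)
  have := eq_of_hasDerivAt_zero h t 0
  have h0 : intExpNeg s A 0 = 0 := by simp [intExpNeg]
  rw [h0] at this
  rw [eq_sub_iff_add_eq, this]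
  simp

/-- `B(t) g(e^{tA}) = t` where `B(t) = ∫₀ᵗ e^{-τ A} dτ` and `g(z) = log z / (1 - 1/z)`. -/
lemma intExpNeg_mul_logSeries (hs : 1 ≤ s) (hA : A ^ s = 0) (t : ℝ) :
    intExpNeg s A t * logSeries s (NormedSpace.exp (t • A)) = t • 1 := by
  set c : ℕ → ℝ := fun n => (-1 : ℝ) ^ (n + 1) / ((n : ℝ) * ((n : ℝ) + 1)) with hc
  set N : ℝ → 𝔸 := fun t => NormedSpace.exp (t • A) - 1 with hN
  have hAN : ∀ t, Commute A (N t) := fun t => (commute_exp_smul t).sub_right (Commute.one_right A)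
  have hN1 : ∀ t, 1 + N t = NormedSpace.exp (t • A) := fun t => by simp [hN]
  have hNd : ∀ t, HasDerivAt N (A * (1 + N t)) t := fun t => by
    rw [hN1]
    exact (hasDerivAt_exp_smul_const' (𝕂 := ℝ) A t).sub_const 1
  have hNpow : ∀ n : ℕ, ∀ t, HasDerivAt (fun t => N t ^ (n + 1))
      ((n + 1 : ℝ) • (N t ^ n * (A * (1 + N t)))) t := by
    intro n
    induction n with
    | zero => intro t; simpa using hNd t
    | succ n ih =>
      intro t
      have := (ih t).mul (hNd t)
      simp only [pow_succ _ (n + 1)]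
      refine this.congr_deriv ?_
      have h1 : Commute (A * (1 + N t)) (N t) :=
        (hAN t).mul_left ((Commute.one_left _).add_left (Commute.refl _))
      push_cast
      rw [smul_mul_assoc, mul_assoc, h1.eq, ← mul_assoc, ← pow_succ]
      module
  have hRd : ∀ t, HasDerivAt (fun t => logSeries s (NormedSpace.exp (t • A)))
      (∑ n ∈ Finset.Ico 1 s, c n • ((n : ℝ) • (N t ^ (n - 1) * (A * (1 + N t))))) t := by
    intro t
    refine (HasDerivAt.fun_sum fun n hn => ?_).const_add 1
    obtain ⟨m, rfl⟩ : ∃ m, n = m + 1 := ⟨n - 1, by have := (Finset.mem_Ico.1 hn).1; omega⟩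
    have := (hNpow m t).const_smul (c (m + 1))
    exact this.congr_deriv (by push_cast; simp)
  have hBA : ∀ t, intExpNeg s A t * (A * (1 + N t)) = N t := by
    intro t
    rw [← mul_assoc, ← (commute_intExpNeg t).eq, mul_intExpNeg hA, hN1, sub_mul,
      exp_neg_smul_mul_exp_smul, one_mul]
  -- `N t` is `A` times an element commuting with `A`, so it inherits the nilpotency of `A`.
  have hNs : ∀ t, N t ^ s = 0 := by
    intro t
    have : N t = A * (intExpNeg s A t * (1 + N t)) := by
      conv_lhs => rw [← hBA t]
      rw [← mul_assoc, ← (commute_intExpNeg t).eq, mul_assoc]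
    rw [this, Commute.mul_pow, hA, zero_mul]
    exact (commute_intExpNeg t).mul_right ((Commute.one_right _).add_right (hAN t))
  -- Up to the invertible factor `1 + N t = e^{tA}`, this says that the product `B(t) g(e^{tA})` has
  -- derivative `1`.
  have key : ∀ t, (1 + N t) * (NormedSpace.exp (-(t • A)) * logSeries s (NormedSpace.exp (t • A)) +
      intExpNeg s A t *
        ∑ n ∈ Finset.Ico 1 s, c n • ((n : ℝ) • (N t ^ (n - 1) * (A * (1 + N t))))) = 1 + N t := by
    intro t
    have h1 : intExpNeg s A t *
        ∑ n ∈ Finset.Ico 1 s, c n • ((n : ℝ) • (N t ^ (n - 1) * (A * (1 + N t))))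
        = ∑ n ∈ Finset.Ico 1 s, (c n * n) • N t ^ n := by
      rw [Finset.mul_sum]
      refine Finset.sum_congr rfl fun n hn => ?_
      have h2 : Commute (intExpNeg s A t) (N t) := by
        refine (Commute.sum_left _ _ _ fun n _ => ?_)
        exact (((hAN t).pow_left n).smul_left _)
      rw [mul_smul_comm, mul_smul_comm, ← mul_assoc, (h2.pow_right _).eq, mul_assoc, hBA,
        ← pow_succ, smul_smul, Nat.sub_add_cancel (Finset.mem_Ico.1 hn).1]
    have h3 : (1 + N t) * NormedSpace.exp (-(t • A)) = 1 := by
      have := exp_neg_smul_mul_exp_smul (A := -A) t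
      rwa [smul_neg, neg_neg, ← hN1] at this
    rw [h1, mul_add, ← mul_assoc, h3, one_mul, logSeries, add_assoc, add_right_inj, Finset.mul_sum,
      ← Finset.sum_add_distrib]
    -- The coefficient `c n` is `1/n - 1/(n+1)` up to sign, so the sum telescopes to `N t` plus one
    -- remainder of degree `m`; for `m = s` the remainder vanishes.
    have h4 : ∀ m, 1 ≤ m → ∑ n ∈ Finset.Ico 1 m, ((c n) • (NormedSpace.exp (t • A) - 1) ^ n +
        (1 + N t) * (c n * n) • N t ^ n) = N t - ((-1 : ℝ) ^ (m + 1) / m) • N t ^ m := by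
      intro m hm
      induction m, hm using Nat.le_induction with
      | base => simp
      | succ m hm ih =>
        rw [Finset.sum_Ico_succ_top hm, ih]
        have hm0 : (m : ℝ) ≠ 0 := by positivity
        have hm1 : (m : ℝ) + 1 ≠ 0 := by positivity
        change _ + (c m • N t ^ m + _) = _
        rw [mul_smul_comm, add_mul, one_mul, ← pow_succ', smul_add, sub_add, sub_right_inj]
        have e1 : c m = (-1 : ℝ) ^ (m + 1) / m - c m * m := by
          simp only [hc]; field_simp
          ring
        have e2 : ((-1 : ℝ) ^ (m + 1 + 1) / ((m + 1 : ℕ) : ℝ)) = - (c m * m) := by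
          simp only [hc]; push_cast; field_simp; ring
        rw [e2]
        have e3 : c m • N t ^ m = ((-1 : ℝ) ^ (m + 1) / m) • N t ^ m - (c m * m) • N t ^ m := by
          rw [← sub_smul, ← e1]
        rw [e3]
        module
    rw [h4 s hs, hNs, smul_zero, sub_zero]
  have hd : ∀ t, HasDerivAt
      (fun t => intExpNeg s A t * logSeries s (NormedSpace.exp (t • A)) - t • 1) 0 t := by
    intro t
    have := ((hasDerivAt_intExpNeg hA t).mul (hRd t)).sub ((hasDerivAt_id t).smul_const (1 : 𝔸))
    refine this.congr_deriv ?_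
    have h5 := congrArg (NormedSpace.exp (-(t • A)) * ·) (key t)
    simp only [← mul_assoc, hN1, exp_neg_smul_mul_exp_smul, one_mul] at h5
    rw [one_smul, sub_eq_zero]
    simpa only [hN1, mul_assoc] using h5
  have := eq_of_hasDerivAt_zero hd t 0
  have h0 : intExpNeg s A 0 = 0 := by simp [intExpNeg]
  rw [h0] at this
  simpa [sub_eq_zero] using this

end NilpotentExp

end

noncomputable section

namespace Stratification

variable {𝔤 : Type*} [NormedLieRing 𝔤] [InnerLieAlgebra 𝔤] [FiniteDimensional ℝ 𝔤]

/-! ### The exponential of the adjoint representation -/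

/-- The adjoint representation, by continuous linear maps. -/
def adL : 𝔤 →L[ℝ] 𝔤 →L[ℝ] 𝔤 :=
  LinearMap.toContinuousLinearMap
    ((LinearMap.toContinuousLinearMap : (𝔤 →ₗ[ℝ] 𝔤) ≃ₗ[ℝ] 𝔤 →L[ℝ] 𝔤).toLinearMap ∘ₗ
      (LieAlgebra.ad ℝ 𝔤 : 𝔤 →ₗ[ℝ] Module.End ℝ 𝔤))

@[simp] lemma adL_apply (x y : 𝔤) : adL x y = ⁅x, y⁆ := rfl

/-- `e^{ad x}`. -/
def expL (x : 𝔤) : 𝔤 →L[ℝ] 𝔤 := NormedSpace.exp (adL x)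

lemma hasDerivAt_expL (x : 𝔤) (t : ℝ) :
    HasDerivAt (fun t : ℝ => expL (t • x)) (adL x * expL (t • x)) t := by
  have := hasDerivAt_exp_smul_const' (𝕂 := ℝ) (adL x) t
  simpa only [expL, map_smul] using this

lemma hasDerivAt_expL_neg (x : 𝔤) (t : ℝ) :
    HasDerivAt (fun t : ℝ => expL (-(t • x))) (-(adL x * expL (-(t • x)))) t := by
  have := hasDerivAt_exp_neg_smul (A := adL x) t
  simpa only [expL, map_smul, map_neg, neg_mul] using this

lemma expL_zero : expL (0 : 𝔤) = 1 := by simp [expL]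

lemma expL_neg_mul (x : 𝔤) : expL (-x) * expL x = 1 := by
  have := exp_neg_smul_mul_exp_smul (A := adL x) 1
  simpa [expL] using this

lemma expL_mul_neg (x : 𝔤) : expL x * expL (-x) = 1 := by
  simpa using expL_neg_mul (-x)

@[simp] lemma expL_neg_apply (x y : 𝔤) : expL (-x) (expL x y) = y :=
  DFunLike.congr_fun (expL_neg_mul x) y

@[simp] lemma expL_apply_neg (x y : 𝔤) : expL x (expL (-x) y) = y :=
  DFunLike.congr_fun (expL_mul_neg x) y

lemma lie_expL_smul (x y : 𝔤) (t : ℝ) : ⁅x, expL (t • x) y⁆ = expL (t • x) ⁅x, y⁆ := by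
  have := (commute_exp_smul (A := adL x) t).eq
  have := DFunLike.congr_fun this y
  simpa [expL, map_smul] using this

lemma HasDerivAt.lie {f g : ℝ → 𝔤} {f' g' : 𝔤} {t : ℝ} (hf : HasDerivAt f f' t)
    (hg : HasDerivAt g g' t) : HasDerivAt (fun t => ⁅f t, g t⁆) (⁅f', g t⁆ + ⁅f t, g'⁆) t := by
  have h1 : HasDerivAt (fun t => adL (f t)) (adL f') t :=
    (adL (𝔤 := 𝔤)).hasFDerivAt.comp_hasDerivAt t hf
  exact h1.clm_apply hg

/-- Since `ad x` is a derivation, `e^{-t ad x} [e^{t ad x} y, e^{t ad x} z]` does not depend on `t`.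
-/
lemma expL_lie (x y z : 𝔤) : expL x ⁅y, z⁆ = ⁅expL x y, expL x z⁆ := by
  have hd : ∀ t : ℝ, HasDerivAt (fun t : ℝ => expL (-(t • x)) ⁅expL (t • x) y, expL (t • x) z⁆) 0 t := by
    intro t
    have hy := (hasDerivAt_expL x t).clm_apply (hasDerivAt_const t y)
    have hz := (hasDerivAt_expL x t).clm_apply (hasDerivAt_const t z)
    have := (hasDerivAt_expL_neg x t).clm_apply (HasDerivAt.lie hy hz)
    refine this.congr_deriv ?_
    have h1 := lie_expL_smul x ⁅expL (t • x) y, expL (t • x) z⁆ (-t)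
    simp only [neg_smul] at h1
    simp [h1]
  have := eq_of_hasDerivAt_zero hd 1 0
  simp only [one_smul, zero_smul, neg_zero, expL_zero, one_apply_eq_self] at this
  rw [← this, expL_apply_neg]

variable {S : Stratification 𝔤}

lemma adL_pow_mem_fil {x : 𝔤} {i j : ℕ} (hx : x ∈ S.fil j) {y : 𝔤} (hy : y ∈ S.fil i) (n : ℕ) :
    (adL x ^ n) y ∈ S.fil (i + n * j) := by
  induction n with
  | zero => simpa using hy
  | succ n ih =>
    rw [pow_succ', mul_apply_eq_comp, adL_apply]
    have := fil_bracket_mem hx ih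
    rwa [show i + (n + 1) * j = j + (i + n * j) by ring]

variable (S) in
lemma adL_pow_eq_zero (x : 𝔤) {n : ℕ} (hn : S.step ≤ n) : adL x ^ n = 0 := by
  ext y
  have := adL_pow_mem_fil (mem_fil_one (S := S) x) (mem_fil_one y) n
  rw [fil_eq_bot (by omega), Submodule.mem_bot] at this
  simpa using this

variable (S) in
lemma expL_eq_sum (x : 𝔤) {n : ℕ} (hn : S.step ≤ n) :
    expL x = ∑ i ∈ Finset.range n, ((i.factorial : ℝ)⁻¹) • adL x ^ i :=
  exp_eq_sum_of_pow_eq_zero (S.adL_pow_eq_zero x hn)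

lemma adL_pow_apply (x y : 𝔤) (n : ℕ) : (adL x ^ n) y = (LieAlgebra.ad ℝ 𝔤 x ^ n) y := by
  induction n with
  | zero => rfl
  | succ n ih => rw [pow_succ', pow_succ', mul_apply_eq_comp, ih]; rfl

lemma expAd_apply (x y : 𝔤) : S.expAd x y = expL x y := by
  rw [S.expL_eq_sum x le_rfl]
  simp only [expAd, LinearMap.sum_apply, sum_apply, LinearMap.smul_apply, smul_apply,
    adL_pow_apply]

lemma expL_sub_self_mem_fil {x : 𝔤} {i j : ℕ} (hx : x ∈ S.fil j) {y : 𝔤} (hy : y ∈ S.fil i) :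
    expL x y - y ∈ S.fil (i + j) := by
  rw [S.expL_eq_sum x (Nat.le_succ _), Finset.sum_range_succ']
  simp only [add_apply, sum_apply,
    smul_apply]
  simp only [Nat.factorial_zero, Nat.cast_one, inv_one, pow_zero, one_smul,
    one_apply_eq_self, add_sub_cancel_right]
  refine Submodule.sum_mem _ fun n _ => Submodule.smul_mem _ _ ?_
  exact fil_anti (by nlinarith) (adL_pow_mem_fil hx hy (n + 1))

lemma expL_sub_lie_mem_fil {x : 𝔤} {i j : ℕ} (hx : x ∈ S.fil j) {y : 𝔤} (hy : y ∈ S.fil i) :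
    expL x y - y - ⁅x, y⁆ ∈ S.fil (i + 2 * j) := by
  rw [S.expL_eq_sum x (show S.step ≤ S.step + 2 by omega), Finset.sum_range_succ',
    Finset.sum_range_succ']
  simp only [add_apply, sum_apply,
    smul_apply]
  simp only [Nat.factorial_zero, Nat.cast_one, inv_one, pow_zero, one_smul, zero_add,
    Nat.factorial_one, pow_one, adL_apply,
    one_apply_eq_self, add_sub_cancel_right]
  refine Submodule.sum_mem _ fun n _ => Submodule.smul_mem _ _ ?_
  exact fil_anti (by nlinarith) (adL_pow_mem_fil hx hy (n + 1 + 1))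

lemma expL_mem_fil {x : 𝔤} {i : ℕ} {y : 𝔤} (hy : y ∈ S.fil i) : expL x y ∈ S.fil i := by
  have := expL_sub_self_mem_fil (mem_fil_one (S := S) x) hy
  simpa using Submodule.add_mem _ (fil_anti (Nat.le_succ i) this) hy

/-! ### The orbit map of the affine action of the group on its Lie algebra -/

variable (S) in
/-- `((e^{ad x} - 1) / ad x) (D x)`: the group acts on `𝔤` by the affine maps
`y ↦ e^{ad x} y + orbitMap x`. -/
def orbitMap (x : 𝔤) : 𝔤 :=
  ∑ n ∈ Finset.range S.step, ((1 : ℝ) / ((n + 1).factorial : ℝ)) • (adL x ^ n) (S.grade x)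

lemma orbitMap_zero : S.orbitMap 0 = 0 := by
  rw [orbitMap]
  exact Finset.sum_eq_zero fun n _ => by
    rw [map_zero S.grade, map_zero (adL (0 : 𝔤) ^ n), smul_zero]

lemma orbitMap_smul (x : 𝔤) (t : ℝ) : S.orbitMap (t • x) =
    ∑ n ∈ Finset.range S.step, (t ^ (n + 1) / ((n + 1).factorial : ℝ)) • (adL x ^ n) (S.grade x) := by
  refine Finset.sum_congr rfl fun n _ => ?_
  rw [map_smul, map_smul, map_smul, smul_pow, smul_apply, smul_smul, smul_smul]
  congr 1
  ring

lemma hasDerivAt_orbitMap_smul (x : 𝔤) (t : ℝ) :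
    HasDerivAt (fun t : ℝ => S.orbitMap (t • x)) (expL (t • x) (S.grade x)) t := by
  have h : expL (t • x) (S.grade x) = ∑ n ∈ Finset.range S.step,
      (t ^ n / (n.factorial : ℝ)) • (adL x ^ n) (S.grade x) := by
    rw [expL, map_smul, exp_smul_eq_sum_of_pow_eq_zero (S.adL_pow_eq_zero x le_rfl)]
    simp
  simp only [h, orbitMap_smul]
  exact HasDerivAt.fun_sum fun n _ => (hasDerivAt_pow_div_factorial n t).smul_const _

/-- This is what `orbitMap` is made for: conjugating the grading derivation by `e^{ad x}` changes it
by an inner derivation, that of `-orbitMap x`. The two sides are compared through their derivatives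
in `t`. -/
lemma expL_grade_expL_neg_smul (x y : 𝔤) (t : ℝ) :
    expL (t • x) (S.grade (expL (-(t • x)) y)) = S.grade y - ⁅S.orbitMap (t • x), y⁆ := by
  have hd : ∀ t : ℝ, HasDerivAt (fun t : ℝ => expL (t • x) (S.grade (expL (-(t • x)) y)) +
      ⁅S.orbitMap (t • x), y⁆) 0 t := by
    intro t
    have h1 := (hasDerivAt_expL_neg x t).clm_apply (hasDerivAt_const t y)
    have h2 := (LinearMap.toContinuousLinearMap S.grade).hasFDerivAt.comp_hasDerivAt t h1
    have h3 := (hasDerivAt_expL x t).clm_apply h2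
    have h4 := HasDerivAt.lie (hasDerivAt_orbitMap_smul (S := S) x t) (hasDerivAt_const t y)
    refine (h3.add h4).congr_deriv ?_
    simp only [mul_apply_eq_comp, adL_apply, LinearMap.coe_toContinuousLinearMap',
      Function.comp, lie_expL_smul, map_zero, add_zero, lie_zero, neg_apply,
      map_neg, grade_lie, map_add, expL_lie, expL_apply_neg]
    abel
  have := eq_of_hasDerivAt_zero hd t 0
  simp only [zero_smul, expL_zero, neg_zero, one_apply_eq_self, orbitMap_zero,
    zero_lie, add_zero] at this
  rw [← this]
  abel

lemma expL_grade_expL_neg (x y : 𝔤) :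
    expL x (S.grade (expL (-x) y)) = S.grade y - ⁅S.orbitMap x, y⁆ := by
  simpa using expL_grade_expL_neg_smul (S := S) x y 1

lemma expL_grade (x y : 𝔤) :
    expL x (S.grade y) = S.grade (expL x y) - ⁅S.orbitMap x, expL x y⁆ := by
  rw [← expL_grade_expL_neg, expL_neg_apply]

/-- The adjoint representation of a product, the product being expressed through `orbitMap`. -/
lemma expL_mul_eq {z x w : 𝔤} (h : S.orbitMap w = S.orbitMap z + expL z (S.orbitMap x)) (y : 𝔤) :
    expL w y = expL z (expL x y) := by
  have h1 : ∀ y, expL z (expL x (S.grade y)) =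
      S.grade (expL z (expL x y)) - ⁅S.orbitMap w, expL z (expL x y)⁆ := by
    intro y
    rw [expL_grade x, map_sub, expL_grade z, expL_lie, h, add_lie]
    abel
  -- `U` measures the discrepancy between the two sides. It is unipotent, and by the hypothesis on
  -- `orbitMap w` both sides conjugate the grading derivation in the same way, so `U` commutes with
  -- it.
  let U : 𝔤 →ₗ[ℝ] 𝔤 := (expL (-w) * (expL z * expL x) : 𝔤 →L[ℝ] 𝔤)
  have hU : ∀ v, U v = expL (-w) (expL z (expL x v)) := fun v => rfl
  have key := eq_self_of_commute_grade (S := S) (U := U) (by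
      intro v
      rw [hU, hU, h1, ← expL_grade_expL_neg, expL_neg_apply]) (by
      intro i v hv
      rw [hU]
      have e1 := expL_sub_self_mem_fil (mem_fil_one (S := S) x) hv
      have e2 := expL_sub_self_mem_fil (mem_fil_one (S := S) z) (expL_mem_fil (x := x) hv)
      have e3 := expL_sub_self_mem_fil (mem_fil_one (S := S) (-w))
        (expL_mem_fil (x := z) (expL_mem_fil (x := x) hv))
      simpa using Submodule.add_mem _ (Submodule.add_mem _ e3 e2) e1) y
  rw [hU] at key
  rw [← key, expL_apply_neg, key]

lemma orbitMap_layer_one {v : 𝔤} (hv : v ∈ S.layer 1) : S.orbitMap v = v := by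
  obtain ⟨n, hn⟩ : ∃ n, S.step = n + 1 := ⟨S.step - 1, by have := S.one_le_step; omega⟩
  rw [orbitMap, grade_layer_one hv, hn, Finset.sum_range_succ']
  simp [pow_succ]

/-! ### Inversion of `orbitMap` -/

lemma lie_pow_sub_mem_fil {x x' : 𝔤} {i : ℕ} (h : x - x' ∈ S.fil i) (n : ℕ) :
    (adL x ^ n) (S.grade x) - (adL x' ^ n) (S.grade x') ∈ S.fil (i + n) := by
  induction n with
  | zero => simpa [map_sub] using diag_mem_fil (fun i => (i : ℝ)) h
  | succ n ih =>
    simp only [pow_succ', mul_apply_eq_comp, adL_apply]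
    have h1 := fil_bracket_mem h
      (adL_pow_mem_fil (mem_fil_one (S := S) x) (mem_fil_one (S.grade x)) n)
    have h2 := fil_bracket_mem (mem_fil_one (S := S) x') ih
    rw [sub_lie] at h1
    rw [lie_sub] at h2
    rw [show i + (1 + n * 1) = i + (n + 1) by ring] at h1
    rw [show 1 + (i + n) = i + (n + 1) by ring] at h2
    simpa using Submodule.add_mem _ h1 h2

/-- The nonlinear part of `orbitMap` raises the filtration. -/
lemma orbitMap_sub_grade_mem_fil {x x' : 𝔤} {i : ℕ} (h : x - x' ∈ S.fil i) :
    (S.orbitMap x - S.grade x) - (S.orbitMap x' - S.grade x') ∈ S.fil (i + 1) := by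
  obtain ⟨n, hn⟩ : ∃ n, S.step = n + 1 := ⟨S.step - 1, by have := S.one_le_step; omega⟩
  simp only [orbitMap]
  rw [hn, Finset.sum_range_succ', Finset.sum_range_succ']
  simp only [zero_add, Nat.factorial_one, Nat.cast_one, div_one, pow_zero, one_smul,
    one_apply_eq_self, add_sub_cancel_right, ← Finset.sum_sub_distrib, ← smul_sub]
  refine Submodule.sum_mem _ fun m _ => Submodule.smul_mem _ _ ?_
  exact fil_anti (by omega) (lie_pow_sub_mem_fil h (m + 1))

variable (S) in
/-- The map whose unique fixed point is the preimage of `y` under `orbitMap`. -/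
def orbitStep (y x : 𝔤) : 𝔤 := S.gradeInv (y - (S.orbitMap x - S.grade x))

variable (S) in
/-- The inverse of `orbitMap`. -/
def orbitInv (y : 𝔤) : 𝔤 := (S.orbitStep y)^[S.step] 0

lemma orbitStep_sub_mem_fil (y : 𝔤) {x x' : 𝔤} {i : ℕ} (h : x - x' ∈ S.fil i) :
    S.orbitStep y x - S.orbitStep y x' ∈ S.fil (i + 1) := by
  rw [orbitStep, orbitStep, ← map_sub, sub_sub_sub_cancel_left, ← neg_mem_iff, ← map_neg, neg_sub]
  exact diag_mem_fil _ (orbitMap_sub_grade_mem_fil h)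

/-- Every iteration pushes the difference one step down the filtration, so after `S.step` iterations
the starting point is forgotten. This is a contraction argument that ends in finitely many steps. -/
lemma iterate_orbitStep_eq (y x x' : 𝔤) :
    (S.orbitStep y)^[S.step] x = (S.orbitStep y)^[S.step] x' := by
  have : ∀ n, (S.orbitStep y)^[n] x - (S.orbitStep y)^[n] x' ∈ S.fil (n + 1) := by
    intro n
    induction n with
    | zero => exact mem_fil_one _
    | succ n ih =>
      rw [Function.iterate_succ_apply', Function.iterate_succ_apply']
      exact orbitStep_sub_mem_fil y ih
  have := this S.step
  rwa [fil_eq_bot (by omega), Submodule.mem_bot, sub_eq_zero] at this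

lemma orbitInv_orbitMap (x : 𝔤) : S.orbitInv (S.orbitMap x) = x := by
  have h : Function.IsFixedPt (S.orbitStep (S.orbitMap x)) x := by
    simp [Function.IsFixedPt, orbitStep, gradeInv_grade]
  rw [orbitInv, iterate_orbitStep_eq _ 0 x]
  exact h.iterate S.step

lemma orbitMap_orbitInv (y : 𝔤) : S.orbitMap (S.orbitInv y) = y := by
  have h : S.orbitStep y (S.orbitInv y) = S.orbitInv y := by
    rw [orbitInv, ← Function.iterate_succ_apply' (S.orbitStep y), Function.iterate_succ_apply]
    exact iterate_orbitStep_eq _ _ _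
  rw [orbitStep] at h
  have := congrArg S.grade h
  rw [grade_gradeInv] at this
  have h2 : y - S.orbitMap (S.orbitInv y) = 0 := by
    rw [sub_sub_eq_add_sub, sub_eq_iff_eq_add] at this
    rw [sub_eq_zero]
    simpa [add_comm] using this
  exact (sub_eq_zero.1 h2).symm

lemma continuous_orbitMap : Continuous S.orbitMap := by
  unfold orbitMap
  refine continuous_finsetSum _ fun n _ => Continuous.const_smul ?_ _
  exact ((adL (𝔤 := 𝔤)).continuous.pow n).clm_apply (LinearMap.continuous_of_finiteDimensional _)

lemma continuous_orbitInv : Continuous S.orbitInv := by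
  have h : ∀ n, Continuous fun y => (S.orbitStep y)^[n] 0 := by
    intro n
    induction n with
    | zero => exact continuous_const
    | succ n ih =>
      simp only [Function.iterate_succ_apply']
      unfold orbitStep
      refine (LinearMap.continuous_of_finiteDimensional S.gradeInv).comp ?_
      exact continuous_id.sub ((continuous_orbitMap.comp ih).sub
        ((LinearMap.continuous_of_finiteDimensional S.grade).comp ih))
  exact h S.step

variable (S) in
/-- `orbitMap` as a homeomorphism. -/
def orbitHomeo : 𝔤 ≃ₜ 𝔤 where
  toFun := S.orbitMap
  invFun := S.orbitInv
  left_inv := orbitInv_orbitMap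
  right_inv := orbitMap_orbitInv
  continuous_toFun := continuous_orbitMap
  continuous_invFun := continuous_orbitInv

end Stratification

end

noncomputable section

namespace Stratification

variable {𝔤 : Type*} [NormedLieRing 𝔤] [InnerLieAlgebra 𝔤] {S : Stratification 𝔤}

/-! ### The differential of the orbit map and the left-invariant vector fields -/

lemma bchSeries_apply (T : 𝔤 →L[ℝ] 𝔤) (y : 𝔤) :
    S.bchSeries (T : 𝔤 →ₗ[ℝ] 𝔤) y = logSeries S.step T y := by
  have h : ∀ n : ℕ, (((T : 𝔤 →ₗ[ℝ] 𝔤) - 1 : Module.End ℝ 𝔤) ^ n) y = ((T - 1) ^ n) y := by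
    intro n
    induction n with
    | zero => rfl
    | succ n ih => rw [pow_succ', pow_succ', Module.End.mul_apply, ih]; rfl
  simp only [bchSeries, logSeries, LinearMap.add_apply, add_apply, LinearMap.sum_apply, sum_apply,
    LinearMap.smul_apply, smul_apply, h]
  rfl

variable [FiniteDimensional ℝ 𝔤]

variable (S) in
/-- The derivative of `x ↦ (ad x)^n (D x)`. -/
def powDeriv : ℕ → 𝔤 → 𝔤 →L[ℝ] 𝔤
  | 0, _ => LinearMap.toContinuousLinearMap S.grade
  | n + 1, x => (adL x).comp (powDeriv n x) + adL.flip ((adL x ^ n) (S.grade x))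

lemma hasFDerivAt_pow_grade (n : ℕ) (x : 𝔤) :
    HasFDerivAt (fun x => (adL x ^ n) (S.grade x)) (S.powDeriv n x) x := by
  induction n with
  | zero => exact (LinearMap.toContinuousLinearMap S.grade).hasFDerivAt
  | succ n ih =>
    have h1 : HasFDerivAt (fun x : 𝔤 => adL x) (adL (𝔤 := 𝔤)) x := (adL (𝔤 := 𝔤)).hasFDerivAt
    have := h1.clm_apply ih
    simp only [pow_succ', mul_apply_eq_comp]
    exact this

lemma powDeriv_eq_zero {n : ℕ} (hn : S.step ≤ n) (x : 𝔤) : S.powDeriv n x = 0 := by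
  have h := hasFDerivAt_pow_grade (S := S) n x
  have h0 : (fun x => (adL x ^ n) (S.grade x)) = fun _ => (0 : 𝔤) := by
    ext y
    simp [S.adL_pow_eq_zero y hn]
  rw [h0] at h
  exact h.unique (hasFDerivAt_const 0 x)

variable (S) in
/-- The derivative of `orbitMap`. -/
def orbitDeriv (x : 𝔤) : 𝔤 →L[ℝ] 𝔤 :=
  ∑ n ∈ Finset.range S.step, ((1 : ℝ) / ((n + 1).factorial : ℝ)) • S.powDeriv n x

lemma hasFDerivAt_orbitMap (x : 𝔤) : HasFDerivAt S.orbitMap (S.orbitDeriv x) x :=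
  HasFDerivAt.fun_sum fun n _ => (hasFDerivAt_pow_grade n x).const_smul _

/-- Variation of constants: `e^{-t ad x} k(t)` has derivative `D (e^{-t ad x} v)`, which integrates
to `D` of `intExpNeg`. -/
lemma orbitDeriv_apply (x v : 𝔤) :
    S.orbitDeriv x v = expL x (S.grade (intExpNeg S.step (adL x) 1 v)) := by
  -- `k t` is the derivative at `x`, in the direction `v`, of `y ↦ orbitMap (t • y)`.
  set k : ℝ → 𝔤 := fun t => ∑ n ∈ Finset.range S.step,
    (t ^ (n + 1) / ((n + 1).factorial : ℝ)) • S.powDeriv n x v with hk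
  have hkd : ∀ t, HasDerivAt k (S.grade v + ⁅v, S.orbitMap (t • x)⁆ + ⁅x, k t⁆) t := by
    intro t
    have h1 : HasDerivAt k (∑ n ∈ Finset.range S.step,
        (t ^ n / (n.factorial : ℝ)) • S.powDeriv n x v) t :=
      HasDerivAt.fun_sum fun n _ => (hasDerivAt_pow_div_factorial n t).smul_const _
    refine h1.congr_deriv ?_
    have h2 : ∑ n ∈ Finset.range S.step, (t ^ n / (n.factorial : ℝ)) • S.powDeriv n x v =
        ∑ n ∈ Finset.range (S.step + 1), (t ^ n / (n.factorial : ℝ)) • S.powDeriv n x v := by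
      rw [Finset.sum_range_succ, powDeriv_eq_zero le_rfl]
      simp
    rw [h2, Finset.sum_range_succ', orbitMap_smul, lie_sum, lie_sum, add_assoc,
      ← Finset.sum_add_distrib, add_comm]
    congr 1
    · simp [powDeriv]
    · refine Finset.sum_congr rfl fun n _ => ?_
      rw [lie_smul, lie_smul, ← smul_add]
      simp [powDeriv, add_comm]
  have hd : ∀ t, HasDerivAt (fun t : ℝ => expL (-(t • x)) (k t) -
      S.grade (intExpNeg S.step (adL x) t v)) 0 t := by
    intro t
    have h1 := (hasDerivAt_expL_neg x t).clm_apply (hkd t)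
    have h2 := (hasDerivAt_intExpNeg (S.adL_pow_eq_zero x le_rfl) t).clm_apply
      (hasDerivAt_const t v)
    have h3 : HasDerivAt (fun t => S.grade (intExpNeg S.step (adL x) t v)) _ t :=
      (LinearMap.toContinuousLinearMap S.grade).hasFDerivAt.comp_hasDerivAt t h2
    refine (h1.sub h3).congr_deriv ?_
    have h4 := expL_grade_expL_neg_smul (S := S) x v t
    have h5 := congrArg (expL (-(t • x))) h4
    rw [expL_neg_apply, map_sub] at h5
    have h6 := lie_expL_smul x (k t) (-t)
    simp only [neg_smul] at h6
    have h7 : NormedSpace.exp (-(t • adL x)) = expL (-(t • x)) := by simp [expL]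
    rw [h7]
    simp only [neg_apply, mul_apply_eq_comp, adL_apply, h6, map_add, map_zero, add_zero,
      LinearMap.coe_toContinuousLinearMap', h5, ← lie_skew v, map_neg]
    abel
  have h := eq_of_hasDerivAt_zero hd 1 0
  have h0 : k 0 = 0 := by simp [hk]
  have h1 : k 1 = S.orbitDeriv x v := by
    simp [hk, orbitDeriv, sum_apply]
  have h2 : intExpNeg S.step (adL x) 0 = 0 := by simp [intExpNeg]
  rw [h0, h1, h2] at h
  simp only [one_smul, map_zero, zero_apply, sub_zero, sub_eq_zero] at h
  rw [← h, expL_apply_neg]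

variable (S) in
/-- The left-invariant frame `X ↦ (ad x / (1 - e^{-ad x})) X` at `x`. -/
def frame (x : 𝔤) : 𝔤 →L[ℝ] 𝔤 := logSeries S.step (expL x)

/-- The left-invariant field of `X` becomes `e^{ad x} D X` in the coordinates `orbitMap`. An affine
map whose linear part intertwines the `e^{ad x}` therefore preserves these fields. -/
lemma orbitDeriv_frame (x X : 𝔤) : S.orbitDeriv x (S.frame x X) = expL x (S.grade X) := by
  have := intExpNeg_mul_logSeries S.one_le_step (S.adL_pow_eq_zero x le_rfl) 1
  rw [orbitDeriv_apply, frame]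
  simp only [one_smul] at this
  have := DFunLike.congr_fun this X
  simp only [mul_apply_eq_comp, one_apply_eq_self] at this
  rw [expL, this]

lemma frame_sub_self_mem_fil (x : 𝔤) {i : ℕ} {y : 𝔤} (hy : y ∈ S.fil i) :
    S.frame x y - y ∈ S.fil (i + 1) := by
  rw [frame, logSeries, add_apply, one_apply_eq_self, add_sub_cancel_left, sum_apply]
  refine Submodule.sum_mem _ fun n hn => Submodule.smul_mem _ _ ?_
  have : ∀ n, ((expL x - 1) ^ n) y ∈ S.fil (i + n) := by
    intro n
    induction n with
    | zero => exact hy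
    | succ n ih =>
      rw [pow_succ', mul_apply_eq_comp]
      simpa [add_assoc] using expL_sub_self_mem_fil (mem_fil_one (S := S) x) ih
  exact fil_anti (by have := (Finset.mem_Ico.1 hn).1; omega) (this n)

/-- By `orbitDeriv_frame` the derivative differs from `grade` only by unipotent factors, so the
Jacobian of `orbitMap` is constant. -/
lemma det_orbitDeriv (x : 𝔤) : (S.orbitDeriv x).det = LinearMap.det S.grade := by
  have h : (S.orbitDeriv x : 𝔤 →ₗ[ℝ] 𝔤) ∘ₗ (S.frame x : 𝔤 →ₗ[ℝ] 𝔤)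
      = (expL x : 𝔤 →ₗ[ℝ] 𝔤) ∘ₗ S.grade := by
    ext X
    exact orbitDeriv_frame x X
  have h1 : LinearMap.det (S.frame x : 𝔤 →ₗ[ℝ] 𝔤) = 1 :=
    det_eq_one_of_raises fun i y hy => frame_sub_self_mem_fil x hy
  have h2 : LinearMap.det (expL x : 𝔤 →ₗ[ℝ] 𝔤) = 1 :=
    det_eq_one_of_raises (S := S) fun i y hy => expL_sub_self_mem_fil (mem_fil_one x) hy
  have := congrArg LinearMap.det h
  rw [LinearMap.det_comp, LinearMap.det_comp, h1, h2, mul_one, one_mul] at this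
  exact this

lemma hasFDerivAt_orbitInv (y : 𝔤) :
    ∃ L : 𝔤 →L[ℝ] 𝔤, HasFDerivAt S.orbitInv L y ∧ ∀ v, L (S.orbitDeriv (S.orbitInv y) v) = v := by
  have hdet : (S.orbitDeriv (S.orbitInv y)).det ≠ 0 := by
    rw [det_orbitDeriv]; exact det_grade_pos.ne'
  let e := ContinuousLinearMap.toContinuousLinearEquivOfDetNeZero _ hdet
  refine ⟨e.symm, ?_, fun v => e.symm_apply_apply v⟩
  refine HasFDerivAt.of_local_left_inverse continuous_orbitInv.continuousAt ?_
    (.of_forall orbitMap_orbitInv)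
  exact hasFDerivAt_orbitMap _

/-- The only point where the Baker-Campbell-Hausdorff product enters. -/
lemma leftInvariantField_eq (X x : 𝔤) : S.leftInvariantField X x = S.frame x X := by
  have hexp : ∀ z : 𝔤, S.expAd z = (expL z : 𝔤 →ₗ[ℝ] 𝔤) := fun z => by
    ext y; exact expAd_apply z y
  let P : ℝ → 𝔤 := fun t => logSeries S.step (expL x * expL (t • X)) X
  have hP : Continuous P := by
    have : Continuous fun t : ℝ => expL (t • X) :=
      continuous_iff_continuousAt.2 fun t => (hasDerivAt_expL X t).continuousAt
    have h2 : Continuous fun t : ℝ => logSeries S.step (expL x * expL (t • X)) := by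
      unfold logSeries
      fun_prop
    exact h2.clm_apply continuous_const
  have hmul : (fun t : ℝ => S.mul x (t • X)) = fun t => x + ∫ u in (0 : ℝ)..t, P u := by
    ext t
    rw [mul]
    congr 1
    -- Rescaling the integration variable turns `mul x (t • X)` into `x` plus a primitive of `P`,
    -- whose derivative at `0` is `P 0`.
    have h1 : ∀ u : ℝ, S.bchSeries (S.expAd x * S.expAd (u • t • X)) (t • X) = t • P (t * u) := by
      intro u
      rw [map_smul, hexp, hexp]
      congr 1
      have := bchSeries_apply (S := S) (expL x * expL (u • t • X)) X
      rw [smul_smul, mul_comm u t] at this ⊢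
      exact this
    simp only [h1]
    rw [intervalIntegral.integral_smul, intervalIntegral.smul_integral_comp_mul_left]
    simp
  rw [leftInvariantField, hmul]
  have h := intervalIntegral.integral_hasDerivAt_right (hP.intervalIntegrable 0 0)
    (hP.stronglyMeasurableAtFilter _ _) hP.continuousAt
  have := (h.const_add x).deriv
  rw [this]
  simp [P, frame, expL_zero]

/-- Since `ad v` kills `v`, the line `t ↦ t • v` is an integral curve of the left-invariant field of
`v`. -/
lemma frame_layer_one_self {v : 𝔤} (t : ℝ) : S.frame (t • v) v = v := by
  have h : ∀ n : ℕ, 1 ≤ n → ((expL (t • v) - 1) ^ n) v = 0 := by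
    intro n hn
    obtain ⟨m, rfl⟩ : ∃ m, n = m + 1 := ⟨n - 1, by omega⟩
    have h1 : expL (t • v) v = v := by
      have h2 : ∀ s : ℝ, HasDerivAt (fun s : ℝ => expL (s • v) v) 0 s := by
        intro s
        refine ((hasDerivAt_expL v s).clm_apply (hasDerivAt_const s v)).congr_deriv ?_
        simp [lie_expL_smul]
      have := eq_of_hasDerivAt_zero h2 t 0
      simpa [expL_zero] using this
    rw [pow_succ, mul_apply_eq_comp, sub_apply, h1, one_apply_eq_self, sub_self, map_zero]
  rw [frame, logSeries, add_apply, sum_apply, Finset.sum_eq_zero]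
  · simp
  · intro n hn
    rw [smul_apply, h n (Finset.mem_Ico.1 hn).1, smul_zero]

lemma continuous_frame : Continuous S.frame := by
  have : Continuous (expL (𝔤 := 𝔤)) := by
    have h : (expL (𝔤 := 𝔤)) = fun x => ∑ i ∈ Finset.range S.step,
        ((i.factorial : ℝ)⁻¹) • adL x ^ i := by
      ext1 x; exact S.expL_eq_sum x le_rfl
    rw [h]
    have := (adL (𝔤 := 𝔤)).continuous
    fun_prop
  unfold frame logSeries
  fun_prop

/-- Dilations are Lie algebra automorphisms, so they are compatible with any series in `ad x`. -/
lemma dil_frame (l : ℝ) (x X : 𝔤) : S.dil l (S.frame x X) = S.frame (S.dil l x) (S.dil l X) := by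
  have h1 : ∀ y, S.dil l (expL x y) = expL (S.dil l x) (S.dil l y) := by
    intro y
    rw [S.expL_eq_sum x le_rfl, S.expL_eq_sum (S.dil l x) le_rfl]
    have h2 : ∀ n, S.dil l ((adL x ^ n) y) = (adL (S.dil l x) ^ n) (S.dil l y) := by
      intro n
      induction n with
      | zero => rfl
      | succ n ih =>
        rw [pow_succ', pow_succ', mul_apply_eq_comp, mul_apply_eq_comp, adL_apply, adL_apply,
          dil_lie, ih]
    simp only [sum_apply, smul_apply, map_sum, map_smul, h2]
  have h3 : ∀ n : ℕ, S.dil l (((expL x - 1) ^ n) X) = ((expL (S.dil l x) - 1) ^ n) (S.dil l X) := by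
    intro n
    induction n with
    | zero => rfl
    | succ n ih =>
      rw [pow_succ', pow_succ', mul_apply_eq_comp, mul_apply_eq_comp, sub_apply, sub_apply,
        map_sub, h1, ih, one_apply_eq_self, one_apply_eq_self, ih]
  simp only [frame, logSeries, add_apply, sum_apply, smul_apply, map_add, map_sum, map_smul, h3,
    one_apply_eq_self]

end Stratification

end

noncomputable section

namespace Stratification

variable {𝔤 : Type*} [NormedLieRing 𝔤] [InnerLieAlgebra 𝔤] {S : Stratification 𝔤}

/-! ### Horizontal curves -/

variable (S) in
/-- `x` and `y` are joined by a horizontal curve of length `ℓ`, parametrized by `[0, 1]`, with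
velocity zero at both ends. -/
def Joined (x y : 𝔤) (ℓ : ℝ) : Prop :=
  ∃ γ u : ℝ → 𝔤, S.IsHorizontalCurve 0 1 γ u ∧ γ 0 = x ∧ γ 1 = y ∧ u 0 = 0 ∧ u 1 = 0 ∧
    ∫ t in (0 : ℝ)..1, ‖u t‖ = ℓ

lemma Joined.nonneg {x y : 𝔤} {ℓ : ℝ} (h : S.Joined x y ℓ) : 0 ≤ ℓ := by
  obtain ⟨γ, u, -, -, -, -, -, rfl⟩ := h
  exact intervalIntegral.integral_nonneg zero_le_one fun t _ => norm_nonneg _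

lemma hasDerivWithinAt_of_Icc {γ : ℝ → 𝔤} {d : 𝔤} {a b t : ℝ}
    (h : t ∈ Icc a b → HasDerivWithinAt γ d (Icc a b) t) : HasDerivWithinAt γ d (Icc a b) t := by
  by_cases ht : t ∈ Icc a b
  · exact h ht
  · exact HasFDerivWithinAt.of_notMem_closure (by rwa [isClosed_Icc.closure_eq])

variable [FiniteDimensional ℝ 𝔤]

lemma IsHorizontalCurve.comp {a b c d : ℝ} {γ u : ℝ → 𝔤} (h : S.IsHorizontalCurve a b γ u)
    {σ σ' : ℝ → ℝ} (hcd : c ≤ d) (hσ : ∀ t ∈ Icc c d, HasDerivWithinAt σ (σ' t) (Icc c d) t)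
    (hσ' : ContinuousOn σ' (Icc c d)) (hmaps : MapsTo σ (Icc c d) (Icc a b)) :
    S.IsHorizontalCurve c d (γ ∘ σ) fun t => σ' t • u (σ t) where
  le := hcd
  continuousOn := hσ'.smul (h.continuousOn.comp (fun t ht => (hσ t ht).continuousWithinAt) hmaps)
  mem t ht := Submodule.smul_mem _ _ (h.mem _ (hmaps ht))
  hasDeriv t ht := by
    have := (h.hasDeriv _ (hmaps ht)).scomp t (hσ t ht) hmaps
    rw [leftInvariantField_eq] at this ⊢
    rwa [map_smul]

/-- The reparametrization by `3t² - 2t³` is monotone, hence keeps the length, and its derivative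
vanishes at both ends. Zero velocity at the ends is what lets two such curves be concatenated with
continuous velocity. -/
lemma IsHorizontalCurve.joined {a b : ℝ} {γ u : ℝ → 𝔤} (h : S.IsHorizontalCurve a b γ u) :
    S.Joined (γ a) (γ b) (∫ t in a..b, ‖u t‖) := by
  have hab := sub_nonneg.2 h.le
  set σ : ℝ → ℝ := fun t => a + (b - a) * (3 * t ^ 2 - 2 * t ^ 3) with hσ
  set σ' : ℝ → ℝ := fun t => (b - a) * (6 * t - 6 * t ^ 2) with hσ'
  have hd : ∀ t, HasDerivAt σ (σ' t) t := by
    intro t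
    refine (((((hasDerivAt_pow 2 t).const_mul 3).sub
      ((hasDerivAt_pow 3 t).const_mul 2)).const_mul (b - a)).const_add a).congr_deriv ?_
    simp only [hσ']
    push_cast
    ring
  have hσc : Continuous σ' := by fun_prop
  have hmaps : MapsTo σ (Icc 0 1) (Icc a b) := by
    intro t ht
    have h0 := ht.1
    have h1 := sub_nonneg.2 ht.2
    have e1 : 0 ≤ 3 * t ^ 2 - 2 * t ^ 3 := by nlinarith [mul_nonneg (sq_nonneg t) h1, sq_nonneg t]
    have e2 : 0 ≤ 1 - (3 * t ^ 2 - 2 * t ^ 3) := by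
      have : 1 - (3 * t ^ 2 - 2 * t ^ 3) = (1 - t) ^ 2 * (1 + 2 * t) := by ring
      rw [this]; positivity
    constructor
    · simp only [hσ]; nlinarith [mul_nonneg hab e1]
    · simp only [hσ]; nlinarith [mul_nonneg hab e2]
  refine ⟨γ ∘ σ, _, h.comp zero_le_one (fun t _ => (hd t).hasDerivWithinAt) hσc.continuousOn hmaps,
    ?_, ?_, ?_, ?_, ?_⟩
  · simp [hσ]
  · simp only [hσ, Function.comp]; congr 1; ring
  · simp [hσ']
  · simp [hσ']
  · have hnn : ∀ t ∈ Icc (0 : ℝ) 1, 0 ≤ σ' t := by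
      intro t ht
      have := mul_nonneg ht.1 (sub_nonneg.2 ht.2)
      exact mul_nonneg hab (by nlinarith)
    have e1 : ∫ t in (0 : ℝ)..1, ‖σ' t • u (σ t)‖ =
        ∫ t in (0 : ℝ)..1, ((fun s => ‖u s‖) ∘ σ) t * σ' t := by
      refine intervalIntegral.integral_congr fun t ht => ?_
      rw [uIcc_of_le zero_le_one] at ht
      simp only [norm_smul, Real.norm_of_nonneg (hnn t ht), Function.comp]
      ring
    rw [e1, intervalIntegral.integral_comp_mul_deriv'']
    · simp only [hσ]
      congr 1 <;> ring
    · exact fun t _ => (hd t).continuousAt.continuousWithinAt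
    · exact fun t _ => (hd t).hasDerivWithinAt
    · exact hσc.continuousOn
    · rw [uIcc_of_le zero_le_one]
      exact (h.continuousOn.mono hmaps.image_subset).norm

lemma mem_ccBall_iff {x y : 𝔤} {R : ℝ} : y ∈ S.ccBall x R ↔ ∃ ℓ, S.Joined x y ℓ ∧ ℓ < R := by
  simp only [ccBall, ccDist, mem_ofPred_eq, iInf_lt_iff]
  constructor
  · rintro ⟨a, b, γ, u, ⟨h, rfl, rfl⟩, hlt⟩
    exact ⟨_, h.joined, (ENNReal.ofReal_lt_ofReal_iff_of_nonneg h.joined.nonneg).1 hlt⟩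
  · rintro ⟨ℓ, hj, hlt⟩
    have h0 := hj.nonneg
    obtain ⟨γ, u, h, h1, h2, -, -, rfl⟩ := hj
    exact ⟨0, 1, γ, u, ⟨h, h1, h2⟩, (ENNReal.ofReal_lt_ofReal_iff_of_nonneg h0).2 hlt⟩

lemma joined_self (x : 𝔤) : S.Joined x x 0 := by
  have h : S.IsHorizontalCurve 0 0 (fun _ => x) (fun _ => 0) :=
    ⟨le_rfl, continuousOn_const, fun _ _ => Submodule.zero_mem _, fun t _ => by
      rw [leftInvariantField_eq, map_zero]; exact hasDerivWithinAt_const _ _ _⟩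
  simpa using h.joined

lemma Joined.symm {x y : 𝔤} {ℓ : ℝ} (h : S.Joined x y ℓ) : S.Joined y x ℓ := by
  obtain ⟨γ, u, h, rfl, rfl, -, -, rfl⟩ := h
  have h1 := (h.comp (σ := fun t => 1 - t) (σ' := fun _ => -1) zero_le_one
    (fun t _ => ((hasDerivAt_id t).const_sub 1).hasDerivWithinAt) continuousOn_const
    (fun t ht => ⟨by linarith [ht.2], by linarith [ht.1]⟩)).joined
  have h2 : ∫ t in (0 : ℝ)..1, ‖u (1 - t)‖ = ∫ t in (0 : ℝ)..1, ‖u t‖ := by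
    rw [intervalIntegral.integral_comp_sub_left (fun t => ‖u t‖)]
    simp
  simpa [h2] using h1

lemma Joined.trans {x y z : 𝔤} {ℓ ℓ' : ℝ} (h : S.Joined x y ℓ) (h' : S.Joined y z ℓ') :
    S.Joined x z (ℓ + ℓ') := by
  obtain ⟨γ, u, h, rfl, rfl, -, hu, rfl⟩ := h
  obtain ⟨γ', u', h', e, rfl, hu', -, rfl⟩ := h'
  have hs := h'.comp (c := 1) (d := 2) (σ := fun t => t - 1) (σ' := fun _ => 1) one_le_two
    (fun t _ => ((hasDerivAt_id t).sub_const 1).hasDerivWithinAt) continuousOn_const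
    (fun t ht => ⟨by linarith [ht.1], by linarith [ht.2]⟩)
  simp only [one_smul] at hs
  set Γ : ℝ → 𝔤 := fun t => if t ≤ 1 then γ t else γ' (t - 1) with hΓ
  set U : ℝ → 𝔤 := fun t => if t ≤ 1 then u t else u' (t - 1) with hU
  have hΓ1 : EqOn Γ γ (Icc 0 1) := fun t ht => by simp [hΓ, ht.2]
  have hU1 : EqOn U u (Icc 0 1) := fun t ht => by simp [hU, ht.2]
  have hΓ2 : EqOn Γ (γ' ∘ fun t => t - 1) (Icc 1 2) := fun t ht => by
    rcases ht.1.eq_or_lt with rfl | h1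
    · simp [hΓ, e]
    · simp [hΓ, not_le.2 h1]
  have hU2 : EqOn U (fun t => u' (t - 1)) (Icc 1 2) := fun t ht => by
    rcases ht.1.eq_or_lt with rfl | h1
    · simp [hU, hu, hu']
    · simp [hU, not_le.2 h1]
  have hun : Icc (0 : ℝ) 1 ∪ Icc 1 2 = Icc 0 2 := Icc_union_Icc_eq_Icc zero_le_one one_le_two
  have hc1 : ContinuousOn U (Icc 0 1) := h.continuousOn.congr hU1
  have hc2 : ContinuousOn U (Icc 1 2) := hs.continuousOn.congr hU2
  have hcurve : S.IsHorizontalCurve 0 2 Γ U := by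
    refine ⟨zero_le_two, ?_, ?_, ?_⟩
    · rw [← hun]
      exact hc1.union_of_isClosed hc2 isClosed_Icc isClosed_Icc
    · rw [← hun]
      rintro t (ht | ht)
      · rw [hU1 ht]; exact h.mem t ht
      · rw [hU2 ht]; exact hs.mem t ht
    · intro t _
      rw [← hun]
      refine (hasDerivWithinAt_of_Icc fun ht => ?_).union (hasDerivWithinAt_of_Icc fun ht => ?_)
      · rw [hU1 ht, hΓ1 ht]
        exact (h.hasDeriv t ht).congr hΓ1 (hΓ1 ht)
      · rw [hU2 ht, hΓ2 ht]
        exact (hs.hasDeriv t ht).congr hΓ2 (hΓ2 ht)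
  have hj := hcurve.joined
  have e0 : Γ 0 = γ 0 := hΓ1 (by simp)
  have e2 : Γ 2 = γ' 1 := by rw [hΓ2 (by simp)]; simp only [Function.comp]; norm_num
  have hlen : ∫ t in (0 : ℝ)..2, ‖U t‖ =
      (∫ t in (0 : ℝ)..1, ‖u t‖) + ∫ t in (0 : ℝ)..1, ‖u' t‖ := by
    have i1 : ContinuousOn (fun t => ‖U t‖) (uIcc 0 1) := by
      rw [uIcc_of_le zero_le_one]; exact hc1.norm
    have i2 : ContinuousOn (fun t => ‖U t‖) (uIcc 1 2) := by
      rw [uIcc_of_le one_le_two]; exact hc2.norm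
    rw [← intervalIntegral.integral_add_adjacent_intervals i1.intervalIntegrable
      i2.intervalIntegrable]
    congr 1
    · refine intervalIntegral.integral_congr fun t ht => ?_
      rw [uIcc_of_le zero_le_one] at ht
      simp only [hU1 ht]
    · have : ∫ t in (1 : ℝ)..2, ‖U t‖ = ∫ t in (1 : ℝ)..2, ‖u' (t - 1)‖ := by
        refine intervalIntegral.integral_congr fun t ht => ?_
        rw [uIcc_of_le one_le_two] at ht
        simp only [hU2 ht]
      rw [this, intervalIntegral.integral_comp_sub_right (fun t => ‖u' t‖)]
      norm_num
  rwa [e0, e2, hlen] at hj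

lemma Joined.dil {x y : 𝔤} {ℓ : ℝ} (h : S.Joined x y ℓ) {l : ℝ} (hl : 0 ≤ l) :
    S.Joined (S.dil l x) (S.dil l y) (l * ℓ) := by
  obtain ⟨γ, u, h, rfl, rfl, hu, hu', rfl⟩ := h
  refine ⟨fun t => S.dil l (γ t), fun t => l • u t, ⟨h.le, h.continuousOn.const_smul l,
    fun t ht => Submodule.smul_mem _ _ (h.mem t ht), fun t ht => ?_⟩, rfl, rfl, by simp [hu],
    by simp [hu'], ?_⟩
  · have := (LinearMap.toContinuousLinearMap (S.dil l)).hasFDerivAt.comp_hasDerivWithinAt t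
      (h.hasDeriv t ht)
    refine this.congr_deriv ?_
    rw [leftInvariantField_eq, leftInvariantField_eq, LinearMap.coe_toContinuousLinearMap',
      dil_frame, Stratification.dil, diag_apply _ (h.mem t ht), pow_one]
  · simp [norm_smul, abs_of_nonneg hl]

/-- Maps that are affine in the coordinates `orbitMap`, and whose linear part is compatible with
`e^{ad x}`, map horizontal curves to horizontal curves with the same velocity. -/
lemma Joined.map {x y : 𝔤} {ℓ : ℝ} (h : S.Joined x y ℓ) (T : 𝔤 →L[ℝ] 𝔤) (c : 𝔤)
    (hT : ∀ x v, T (expL x v) = expL (S.orbitInv (T (S.orbitMap x) + c)) v) :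
    S.Joined (S.orbitInv (T (S.orbitMap x) + c)) (S.orbitInv (T (S.orbitMap y) + c)) ℓ := by
  obtain ⟨γ, u, h, rfl, rfl, hu, hu', rfl⟩ := h
  refine ⟨fun t => S.orbitInv (T (S.orbitMap (γ t)) + c), u, ⟨h.le, h.continuousOn, h.mem,
    fun t ht => ?_⟩, rfl, rfl, hu, hu', rfl⟩
  have h1 := (hasFDerivAt_orbitMap (S := S) (γ t)).comp_hasDerivWithinAt t (h.hasDeriv t ht)
  have h2 := (T.hasFDerivAt.comp_hasDerivWithinAt t h1).add_const c
  rw [leftInvariantField_eq, orbitDeriv_frame, hT, ← orbitDeriv_frame (S := S)] at h2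
  obtain ⟨L, hL, hL'⟩ := hasFDerivAt_orbitInv (S := S) (T (S.orbitMap (γ t)) + c)
  have h3 := hL.comp_hasDerivWithinAt t h2
  rw [hL'] at h3
  rw [leftInvariantField_eq]
  exact h3

/-! ### Left translations -/

variable (S) in
/-- Left translation by `z`. -/
def leftMul (z x : 𝔤) : 𝔤 := S.orbitInv (expL z (S.orbitMap x) + S.orbitMap z)

variable (S) in
/-- The inverse of the left translation by `z`. -/
def leftDiv (z x : 𝔤) : 𝔤 := S.orbitInv (expL (-z) (S.orbitMap x) + -expL (-z) (S.orbitMap z))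

lemma orbitMap_leftMul (z x : 𝔤) :
    S.orbitMap (S.leftMul z x) = expL z (S.orbitMap x) + S.orbitMap z := orbitMap_orbitInv _

lemma leftMul_leftDiv (z x : 𝔤) : S.leftMul z (S.leftDiv z x) = x := by
  rw [leftMul, leftDiv, orbitMap_orbitInv, map_add, map_neg, expL_apply_neg, expL_apply_neg,
    neg_add_cancel_right, orbitInv_orbitMap]

lemma leftMul_zero (z : 𝔤) : S.leftMul z 0 = z := by
  rw [leftMul, orbitMap_zero, map_zero, zero_add, orbitInv_orbitMap]

lemma leftDiv_self (z : 𝔤) : S.leftDiv z z = 0 := by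
  rw [leftDiv, add_neg_cancel]
  simpa [orbitMap_zero] using orbitInv_orbitMap (S := S) 0

lemma expL_leftMul (z x v : 𝔤) : expL (S.leftMul z x) v = expL z (expL x v) :=
  expL_mul_eq (S := S) (by rw [orbitMap_leftMul, add_comm]) v

lemma Joined.leftMul {x y : 𝔤} {ℓ : ℝ} (h : S.Joined x y ℓ) (z : 𝔤) :
    S.Joined (S.leftMul z x) (S.leftMul z y) ℓ :=
  h.map (expL z) (S.orbitMap z) fun x v => (expL_leftMul z x v).symm

lemma Joined.leftDiv {x y : 𝔤} {ℓ : ℝ} (h : S.Joined x y ℓ) (z : 𝔤) :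
    S.Joined (S.leftDiv z x) (S.leftDiv z y) ℓ := by
  refine h.map (expL (-z)) (-expL (-z) (S.orbitMap z)) fun x v => ?_
  have := expL_leftMul (S := S) z (S.leftDiv z x) v
  rw [leftMul_leftDiv] at this
  rw [this, expL_neg_apply]
  rfl

/-! ### Connectivity -/

variable (S) in
/-- The points that can be reached from the identity, in the coordinates `orbitMap`. -/
def reachable : Set 𝔤 := {y | ∃ ℓ, S.Joined 0 (S.orbitInv y) ℓ}

lemma orbitInv_mem_fil {i : ℕ} {y : 𝔤} (hy : y ∈ S.fil i) : S.orbitInv y ∈ S.fil i := by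
  have key : ∀ j, j ≤ i → S.orbitInv y ∈ S.fil j := by
    intro j
    induction j with
    | zero => intro _; exact fil_anti zero_le_one (mem_fil_one _)
    | succ j ih =>
      intro hj
      have h1 := ih (by omega)
      have h2 := orbitMap_sub_grade_mem_fil (S := S) (x := S.orbitInv y) (x' := 0) (by simpa using h1)
      rw [orbitMap_zero, map_zero, sub_zero, sub_zero, orbitMap_orbitInv] at h2
      have h3 : S.grade (S.orbitInv y) ∈ S.fil (j + 1) := by
        have := Submodule.sub_mem _ (fil_anti hj hy) h2
        simpa using this
      have := diag_mem_fil (fun i => (i : ℝ)⁻¹) h3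
      rwa [gradeInv_grade] at this
  exact key i le_rfl

/-- To leading order `orbitMap` is the grading derivation, which is `i` on `V_i`; hence the factor
`1 / i`. -/
lemma orbitInv_sub_mem_fil {i : ℕ} {y v : 𝔤} (hv : v ∈ S.layer i) (hy : y - v ∈ S.fil (i + 1)) :
    S.orbitInv y - (i : ℝ)⁻¹ • v ∈ S.fil (i + 1) := by
  have hyi : y ∈ S.fil i := by
    simpa using Submodule.add_mem _ (fil_anti i.le_succ hy) (layer_le_fil le_rfl hv)
  have h2 := orbitMap_sub_grade_mem_fil (S := S) (x := S.orbitInv y) (x' := 0)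
    (by simpa using orbitInv_mem_fil hyi)
  rw [orbitMap_zero, map_zero, sub_zero, sub_zero, orbitMap_orbitInv] at h2
  have h3 : S.grade (S.orbitInv y) - v ∈ S.fil (i + 1) := by
    simpa using Submodule.sub_mem _ hy h2
  have := diag_mem_fil (fun i => (i : ℝ)⁻¹) h3
  rwa [map_sub, gradeInv_grade, diag_apply _ hv] at this

/-- In the coordinates `orbitMap` the product of two points is `y + e^{ad} y'`: translate the second
curve so that it starts where the first one ends. -/
lemma mul_mem_reachable {y y' : 𝔤} (h : y ∈ S.reachable) (h' : y' ∈ S.reachable) :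
    y + expL (S.orbitInv y) y' ∈ S.reachable := by
  obtain ⟨ℓ, h⟩ := h
  obtain ⟨ℓ', h'⟩ := h'
  have := h'.leftMul (S.orbitInv y)
  rw [leftMul_zero] at this
  refine ⟨ℓ + ℓ', ?_⟩
  convert h.trans this using 1
  rw [leftMul, orbitMap_orbitInv, orbitMap_orbitInv, add_comm]

lemma div_mem_reachable {y y' : 𝔤} (h : y ∈ S.reachable)
    (h' : y + expL (S.orbitInv y) y' ∈ S.reachable) : y' ∈ S.reachable := by
  obtain ⟨ℓ, h⟩ := h
  obtain ⟨ℓ', h'⟩ := h'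
  have := (h.symm.trans h').leftDiv (S.orbitInv y)
  rw [leftDiv_self] at this
  refine ⟨ℓ + ℓ', ?_⟩
  convert this using 1
  rw [leftDiv, orbitMap_orbitInv, orbitMap_orbitInv, map_add, expL_neg_apply]
  congr 1
  abel

lemma zero_mem_reachable : (0 : 𝔤) ∈ S.reachable := by
  refine ⟨0, ?_⟩
  have : S.orbitInv 0 = 0 := by simpa [orbitMap_zero] using orbitInv_orbitMap (S := S) 0
  rw [this]
  exact joined_self 0

lemma orbitInv_layer_one {v : 𝔤} (hv : v ∈ S.layer 1) : S.orbitInv v = v := by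
  conv_lhs => rw [← orbitMap_layer_one hv, orbitInv_orbitMap]

lemma layer_one_mem_reachable {v : 𝔤} (hv : v ∈ S.layer 1) : v ∈ S.reachable := by
  rw [reachable, mem_ofPred_eq, orbitInv_layer_one hv]
  have h : S.IsHorizontalCurve 0 1 (fun t => t • v) fun _ => v :=
    ⟨zero_le_one, continuousOn_const, fun _ _ => hv, fun t _ => by
      rw [leftInvariantField_eq, frame_layer_one_self]
      simpa using ((hasDerivAt_id t).smul_const v).hasDerivWithinAt⟩
  exact ⟨_, by simpa using h.joined⟩

/-- The commutator of an element of `V₁` with a reachable point. -/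
lemma exists_reachable_bracket {j : ℕ} (hj : 1 ≤ j) {x w h : 𝔤} (hx : x ∈ S.layer 1)
    (hw : w ∈ S.layer j) (hh : h ∈ S.reachable) (hhw : h - w ∈ S.fil (j + 1)) :
    ∃ k ∈ S.reachable, k - ⁅x, w⁆ ∈ S.fil (j + 2) := by
  -- The products `d` and `b` of `a` and `h`, in the two orders, differ to leading order by `[a, w]
  -- - [w / j, a] = (1 + 1/j) [a, w]`. The factor `κ` normalizes this to `[x, w]`.
  set κ : ℝ := (1 + (j : ℝ)⁻¹)⁻¹ with hκ
  have hκ1 : κ * (1 + (j : ℝ)⁻¹) = 1 := inv_mul_cancel₀ (by positivity)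
  set a : 𝔤 := κ • x with ha
  have hal : a ∈ S.layer 1 := Submodule.smul_mem _ _ hx
  have haf : a ∈ S.fil 1 := mem_fil_one a
  have har := layer_one_mem_reachable hal
  have hhf : h ∈ S.fil j := by
    simpa using Submodule.add_mem _ (fil_anti j.le_succ hhw) (layer_le_fil le_rfl hw)
  set b := h + expL (S.orbitInv h) a with hb
  set d := a + expL (S.orbitInv a) h with hd
  have hbr : b ∈ S.reachable := mul_mem_reachable hh har
  have hdr : d ∈ S.reachable := mul_mem_reachable har hh
  have h1 := expL_sub_lie_mem_fil haf hhf
  have h2 := expL_sub_lie_mem_fil (orbitInv_mem_fil hhf) haf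
  have h3 := fil_bracket_mem haf hhw
  have h4 := fil_bracket_mem (orbitInv_sub_mem_fil hw hhw) haf
  have hδ : d - b - ⁅x, w⁆ ∈ S.fil (j + 2) := by
    have e : d - b - ⁅x, w⁆ = (expL a h - h - ⁅a, h⁆) -
        (expL (S.orbitInv h) a - a - ⁅S.orbitInv h, a⁆) + ⁅a, h - w⁆ -
        ⁅S.orbitInv h - (j : ℝ)⁻¹ • w, a⁆ := by
      have : ⁅x, w⁆ = ⁅a, w⁆ - ⁅(j : ℝ)⁻¹ • w, a⁆ := by
        rw [ha, smul_lie, smul_lie, lie_smul, ← lie_skew w x, smul_neg, smul_neg, sub_neg_eq_add,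
          smul_smul, ← add_smul, show κ + (j : ℝ)⁻¹ * κ = 1 by linarith, one_smul]
      rw [this, hd, hb, orbitInv_layer_one hal, lie_sub, sub_lie]
      abel
    rw [e]
    refine Submodule.sub_mem _ (Submodule.add_mem _ (Submodule.sub_mem _ h1
      (fil_anti (by omega) h2)) (fil_anti (by omega) h3)) (fil_anti (by omega) h4)
  have hxw : ⁅x, w⁆ ∈ S.fil (j + 1) :=
    layer_le_fil (by omega) (layer_bracket_mem le_rfl hx hj hw)
  have hδ1 : d - b ∈ S.fil (j + 1) := by
    simpa using Submodule.add_mem _ (fil_anti (by omega) hδ) hxw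
  -- `k` is the quotient of `d` by `b`
  set k := S.orbitMap (S.leftMul (S.orbitInv d) (S.leftDiv (S.orbitInv b) 0)) with hk
  have hinv : S.orbitMap (S.leftDiv (S.orbitInv b) 0) ∈ S.reachable := by
    refine div_mem_reachable hbr ?_
    have : b + expL (S.orbitInv b) (S.orbitMap (S.leftDiv (S.orbitInv b) 0)) = 0 := by
      have := orbitMap_leftMul (S := S) (S.orbitInv b) (S.leftDiv (S.orbitInv b) 0)
      rw [leftMul_leftDiv, orbitMap_zero, orbitMap_orbitInv] at this
      rw [add_comm]; exact this.symm
    rw [this]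
    exact zero_mem_reachable
  have hkr : k ∈ S.reachable := by
    rw [hk, orbitMap_leftMul, orbitMap_orbitInv, add_comm]
    exact mul_mem_reachable hdr hinv
  have hkb : k + expL (S.orbitInv k) b = d := by
    rw [hk, orbitInv_orbitMap, expL_leftMul, orbitMap_leftMul, orbitMap_orbitInv]
    have := expL_leftMul (S := S) (S.orbitInv b) (S.leftDiv (S.orbitInv b) 0) b
    have h0 : expL (S.leftDiv (S.orbitInv b) 0) b = expL (-S.orbitInv b) b := by
      rw [leftMul_leftDiv, expL_zero, one_apply_eq_self] at this
      have h' := congrArg (expL (-S.orbitInv b)) this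
      rw [expL_neg_apply] at h'
      exact h'.symm
    rw [h0, leftDiv, orbitMap_zero, map_zero, zero_add, orbitMap_orbitInv, orbitMap_orbitInv,
      map_neg]
    abel
  have hkδ : k = (d - b) - (expL (S.orbitInv k) b - b) := by rw [← hkb]; abel
  -- By `hkδ`, `k` equals `d - b` up to an error one step deeper in the filtration than `k` itself,
  -- so its depth can be bootstrapped up to that of `d - b`.
  have hkf : ∀ i, i ≤ j + 1 → k ∈ S.fil i := by
    intro i
    induction i with
    | zero => intro _; exact fil_anti zero_le_one (mem_fil_one _)
    | succ i ih =>
      intro hi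
      have h5 := expL_sub_self_mem_fil (orbitInv_mem_fil (ih (by omega))) (mem_fil_one (S := S) b)
      rw [hkδ]
      exact Submodule.sub_mem _ (fil_anti hi hδ1) (by rwa [add_comm] at h5)
  refine ⟨k, hkr, ?_⟩
  have h5 := expL_sub_self_mem_fil (orbitInv_mem_fil (hkf _ le_rfl)) (mem_fil_one (S := S) b)
  have : k - ⁅x, w⁆ = (d - b - ⁅x, w⁆) - (expL (S.orbitInv k) b - b) := by
    nth_rewrite 1 [hkδ]; abel
  rw [this]
  exact Submodule.sub_mem _ hδ (fil_anti (by omega) h5)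

/-- Induction on the layer: brackets are reached by commutators, and sums by products, since leading
terms add under multiplication. -/
lemma exists_reachable_of_mem_layer {i : ℕ} (hi : 1 ≤ i) {v : 𝔤} (hv : v ∈ S.layer i) :
    ∃ h ∈ S.reachable, h - v ∈ S.fil (i + 1) := by
  induction i, hi using Nat.le_induction generalizing v with
  | base => exact ⟨v, layer_one_mem_reachable hv, by simp⟩
  | succ j hj ih =>
    have hspan := hv
    rw [← S.bracket j hj] at hspan
    -- Reachable points do not form a linear space, so the scalar is carried through the span
    -- induction and absorbed into a factor from `V₁`.
    suffices h : ∀ c : ℝ, ∃ h ∈ S.reachable, h - c • v ∈ S.fil (j + 1 + 1) by simpa using h 1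
    clear hv
    induction hspan using Submodule.span_induction with
    | mem z hz =>
      obtain ⟨x, hx, w, hw, rfl⟩ := hz
      intro c
      obtain ⟨h, hh, hhw⟩ := ih hw
      obtain ⟨k, hk, hk'⟩ := exists_reachable_bracket hj (Submodule.smul_mem _ c hx) hw hh hhw
      exact ⟨k, hk, by simpa [smul_lie] using hk'⟩
    | zero => exact fun c => ⟨0, zero_mem_reachable, by simp⟩
    | smul r x _ ih' => exact fun c => by simpa [smul_smul] using ih' (c * r)
    | add x y hx hy ihx ihy =>
      intro c
      obtain ⟨h, hh, hhx⟩ := ihx c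
      obtain ⟨h', hh', hhy⟩ := ihy c
      refine ⟨_, mul_mem_reachable hh hh', ?_⟩
      have hyl : c • y ∈ S.fil (j + 1) := by
        refine layer_le_fil le_rfl (Submodule.smul_mem _ _ ?_)
        rwa [← S.bracket j hj]
      have hh'f : h' ∈ S.fil (j + 1) := by
        simpa using Submodule.add_mem _ (fil_anti (Nat.le_succ _) hhy) hyl
      have := expL_sub_self_mem_fil (mem_fil_one (S := S) (S.orbitInv h)) hh'f
      have e : h + expL (S.orbitInv h) h' - c • (x + y) =
          (h - c • x) + (h' - c • y) + (expL (S.orbitInv h) h' - h') := by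
        rw [smul_add]; abel
      rw [e]
      exact Submodule.add_mem _ (Submodule.add_mem _ hhx hhy) this

/-- Descent along the filtration: reach the `V_i` component, divide it out on the left, and what
remains lies in `fil (i + 1)`. -/
lemma mem_reachable (y : 𝔤) : y ∈ S.reachable := by
  have key : ∀ n i, S.step + 1 ≤ n + i → 1 ≤ i → ∀ y ∈ S.fil i, y ∈ S.reachable := by
    intro n
    induction n with
    | zero =>
      intro i hi _ y hy
      rw [fil_eq_bot (by omega), Submodule.mem_bot] at hy
      rw [hy]
      exact zero_mem_reachable
    | succ n ih =>
      intro i hi hi1 y hy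
      rw [fil_eq_sup] at hy
      obtain ⟨v, hv, z, hz, rfl⟩ := Submodule.mem_sup.1 hy
      obtain ⟨h, hh, hhv⟩ := exists_reachable_of_mem_layer hi1 hv
      have hw : expL (-S.orbitInv h) (v + z - h) ∈ S.fil (i + 1) := by
        refine expL_mem_fil ?_
        have : v + z - h = z - (h - v) := by abel
        rw [this]
        exact Submodule.sub_mem _ hz hhv
      have := mul_mem_reachable hh (ih (i + 1) (by omega) (by omega) _ hw)
      simpa using this
  exact key (S.step) 1 le_rfl le_rfl y (mem_fil_one y)

lemma exists_joined (x : 𝔤) : ∃ ℓ, S.Joined 0 x ℓ := by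
  have : S.orbitMap x ∈ S.reachable := mem_reachable _
  rwa [reachable, mem_ofPred_eq, orbitInv_orbitMap] at this

end Stratification

end

noncomputable section

namespace Stratification

variable {𝔤 : Type*} [NormedLieRing 𝔤] [InnerLieAlgebra 𝔤] [FiniteDimensional ℝ 𝔤]
variable {S : Stratification 𝔤}

/-! ### Carnot-Carathéodory balls -/

lemma mem_ccBall_comm {x y : 𝔤} {R : ℝ} : y ∈ S.ccBall x R ↔ x ∈ S.ccBall y R := by
  simp only [mem_ccBall_iff]
  exact ⟨fun ⟨ℓ, h, hl⟩ => ⟨ℓ, h.symm, hl⟩, fun ⟨ℓ, h, hl⟩ => ⟨ℓ, h.symm, hl⟩⟩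

lemma mem_ccBall_trans {x y z : 𝔤} {R R' : ℝ} (h : y ∈ S.ccBall x R) (h' : z ∈ S.ccBall y R') :
    z ∈ S.ccBall x (R + R') := by
  simp only [mem_ccBall_iff] at *
  obtain ⟨ℓ, h, hl⟩ := h
  obtain ⟨ℓ', h', hl'⟩ := h'
  exact ⟨ℓ + ℓ', h.trans h', add_lt_add hl hl'⟩

lemma ccBall_mono (x : 𝔤) {R R' : ℝ} (h : R ≤ R') : S.ccBall x R ⊆ S.ccBall x R' := by
  intro y hy
  rw [mem_ccBall_iff] at *
  obtain ⟨ℓ, hj, hl⟩ := hy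
  exact ⟨ℓ, hj, hl.trans_le h⟩

lemma self_mem_ccBall (x : 𝔤) {R : ℝ} (hR : 0 < R) : x ∈ S.ccBall x R :=
  mem_ccBall_iff.2 ⟨0, joined_self x, hR⟩

lemma leftMul_image_ccBall (z : 𝔤) (R : ℝ) : S.leftMul z '' S.ccBall 0 R = S.ccBall z R := by
  ext y
  simp only [mem_image, mem_ccBall_iff]
  constructor
  · rintro ⟨w, ⟨ℓ, h, hl⟩, rfl⟩
    exact ⟨ℓ, by simpa [leftMul_zero] using h.leftMul z, hl⟩
  · rintro ⟨ℓ, h, hl⟩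
    exact ⟨S.leftDiv z y, ⟨ℓ, by simpa [leftDiv_self] using h.leftDiv z, hl⟩, leftMul_leftDiv z y⟩

lemma dil_image_ccBall {R : ℝ} (hR : 0 < R) (r : ℝ) :
    S.dil R '' S.ccBall 0 r = S.ccBall 0 (R * r) := by
  ext y
  simp only [mem_image, mem_ccBall_iff]
  constructor
  · rintro ⟨w, ⟨ℓ, h, hl⟩, rfl⟩
    exact ⟨R * ℓ, by simpa using h.dil hR.le, mul_lt_mul_of_pos_left hl hR⟩
  · rintro ⟨ℓ, h, hl⟩
    refine ⟨S.dil R⁻¹ y, ⟨R⁻¹ * ℓ, by simpa using h.dil (inv_nonneg.2 hR.le), ?_⟩,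
      dil_dil (mul_inv_cancel₀ hR.ne') y⟩
    rwa [inv_mul_lt_iff₀ hR]

-- A horizontal curve of speed `‖u‖` moves at Euclidean speed at most `C ‖u‖` while it stays in the
-- unit ball, so a curve from `0` of length below `1 / (2C)` cannot leave that ball.
variable (S) in
lemma exists_norm_le_one_of_mem_ccBall :
    ∃ ε : ℝ, 0 < ε ∧ ∀ y ∈ S.ccBall 0 ε, ‖y‖ ≤ 1 := by
  obtain ⟨C₀, hC₀⟩ := (isCompact_closedBall (0 : 𝔤) 1).exists_bound_of_continuousOn
    (continuous_frame (S := S)).continuousOn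
  set C := max C₀ 1 with hC
  have hC1 : 1 ≤ C := le_max_right _ _
  have hCpos : 0 < C := by positivity
  have hbound : ∀ x : 𝔤, ‖x‖ ≤ 1 → ‖S.frame x‖ ≤ C := fun x hx =>
    (hC₀ x (by simpa using hx)).trans (le_max_left _ _)
  set ε := (2 * C)⁻¹ with hε
  have hεpos : 0 < ε := by positivity
  refine ⟨ε, hεpos, fun y hy => ?_⟩
  rw [mem_ccBall_iff] at hy
  obtain ⟨ℓ, ⟨γ, u, h, h0, rfl, -, -, hlen⟩, hlt⟩ := hy
  set v : ℝ → 𝔤 := IccExtend (zero_le_one (α := ℝ)) fun t => u t with hv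
  have hvc : Continuous v := Continuous.Icc_extend' 
    (continuousOn_iff_continuous_domRestrict.1 h.continuousOn)
  have hvu : ∀ t ∈ Icc (0 : ℝ) 1, v t = u t := fun t ht => IccExtend_of_mem _ _ ht
  -- A barrier for `‖γ‖`. The term `ε * t` makes its slope strictly larger than the speed of the
  -- curve, as the comparison lemma requires.
  set B : ℝ → ℝ := fun t => C * ((∫ s in (0 : ℝ)..t, ‖v s‖) + ε * t) with hB
  have hBd : ∀ t, HasDerivAt B (C * (‖v t‖ + ε * 1)) t := fun t =>
    ((hvc.norm.integral_hasStrictDerivAt 0 t).hasDerivAt.add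
      ((hasDerivAt_id t).const_mul ε)).const_mul C
  have hB1 : ∀ t ∈ Icc (0 : ℝ) 1, B t ≤ 1 := by
    intro t ht
    have h1 : ∫ s in (0 : ℝ)..t, ‖v s‖ ≤ ∫ s in (0 : ℝ)..1, ‖v s‖ :=
      intervalIntegral.integral_mono_interval le_rfl ht.1 ht.2
        (.of_forall fun _ => norm_nonneg _) (hvc.norm.intervalIntegrable _ _)
    have h2 : ∫ s in (0 : ℝ)..1, ‖v s‖ = ℓ := by
      rw [← hlen]
      refine intervalIntegral.integral_congr fun s hs => ?_
      rw [uIcc_of_le zero_le_one] at hs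
      simp only [hvu s hs]
    have h3 : C * (2 * ε) = 1 := by rw [hε]; field_simp
    have h4 : ε * t ≤ ε := mul_le_of_le_one_right hεpos.le ht.2
    calc B t ≤ C * (2 * ε) := by
          refine mul_le_mul_of_nonneg_left ?_ hCpos.le
          linarith
      _ = 1 := h3
  have key := image_norm_le_of_norm_deriv_right_lt_deriv_boundary' (f := γ) (a := 0) (b := 1)
    (f' := fun t => S.frame (γ t) (u t)) (B := B) (B' := fun t => C * (‖v t‖ + ε * 1))
    (fun t ht => (h.hasDeriv t ht).continuousWithinAt)
    (fun t ht => by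
      have := h.hasDeriv t (Ico_subset_Icc_self ht)
      rw [leftInvariantField_eq] at this
      exact this.mono_of_mem_nhdsWithin (Icc_mem_nhdsGE_of_mem ht))
    (by simp [h0, hB])
    (fun t _ => (hBd t).continuousAt.continuousWithinAt)
    (fun t _ => (hBd t).hasDerivWithinAt)
    (fun t ht hnorm => by
      have ht' := Ico_subset_Icc_self ht
      have h1 : ‖γ t‖ ≤ 1 := hnorm.trans_le (hB1 t ht')
      calc ‖S.frame (γ t) (u t)‖ ≤ ‖S.frame (γ t)‖ * ‖u t‖ := ContinuousLinearMap.le_opNorm _ _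
        _ ≤ C * ‖u t‖ := mul_le_mul_of_nonneg_right (hbound _ h1) (norm_nonneg _)
        _ < C * (‖v t‖ + ε * 1) := by
          rw [hvu t ht']
          exact mul_lt_mul_of_pos_left (by linarith) hCpos)
  exact (key (right_mem_Icc.2 zero_le_one)).trans (hB1 1 (right_mem_Icc.2 zero_le_one))

variable (S) in
lemma homDim_pos : 0 < S.homDim := by
  refine Finset.sum_pos' (fun _ _ => Nat.zero_le _) ⟨S.step, ?_, ?_⟩
  · exact Finset.mem_Icc.2 ⟨S.one_le_step, le_rfl⟩
  · have := S.one_le_step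
    have h := S.layer_step
    have : 0 < Module.finrank ℝ (S.layer S.step) := by
      rw [Module.finrank_pos_iff]
      exact Submodule.nontrivial_iff_ne_bot.2 h
    positivity

/-! ### Invariance of Lebesgue measure and volume of the balls -/

variable [MeasurableSpace 𝔤] [BorelSpace 𝔤]

lemma volume_orbitMap_image (s : Set 𝔤) :
    volume (S.orbitMap '' s) = ENNReal.ofReal (LinearMap.det S.grade) * volume s := by
  let e : 𝔤 ≃ᵐ 𝔤 := S.orbitHomeo.toMeasurableEquiv
  have he : ∀ t : Set 𝔤, e.symm ⁻¹' t = S.orbitMap '' t := fun t => by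
    rw [← MeasurableEquiv.image_eq_preimage_symm]; rfl
  have h : Measure.map e.symm volume = ENNReal.ofReal (LinearMap.det S.grade) • volume := by
    refine Measure.ext fun t ht => ?_
    rw [MeasurableEquiv.map_apply, he, Measure.smul_apply, smul_eq_mul,
      ← lintegral_abs_det_fderiv_eq_addHaar_image volume ht
        (fun x _ => (hasFDerivAt_orbitMap x).hasFDerivWithinAt)
        (S.orbitHomeo.injective.injOn)]
    simp [det_orbitDeriv, abs_of_pos det_grade_pos]
  have := congrArg (fun m : Measure 𝔤 => m s) h
  simpa [MeasurableEquiv.map_apply, he] using this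

/-- In the coordinates `orbitMap` the translation is affine with determinant one, and the constant
Jacobian of `orbitMap` cancels. -/
lemma volume_leftMul_image (z : 𝔤) (s : Set 𝔤) : volume (S.leftMul z '' s) = volume s := by
  have h := volume_orbitMap_image (S := S) (S.leftMul z '' s)
  have h1 : S.orbitMap '' (S.leftMul z '' s) =
      (fun y => S.orbitMap z + y) '' (expL z '' (S.orbitMap '' s)) := by
    simp only [image_image, orbitMap_leftMul, add_comm]
  have hdet : LinearMap.det (expL z : 𝔤 →ₗ[ℝ] 𝔤) = 1 :=
    det_eq_one_of_raises (S := S) fun i y hy => expL_sub_self_mem_fil (mem_fil_one z) hy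
  rw [h1, image_add_left, measure_preimage_add, Measure.addHaar_image_continuousLinearMap, hdet,
    abs_one, ENNReal.ofReal_one, one_mul, volume_orbitMap_image] at h
  have hne : ENNReal.ofReal (LinearMap.det S.grade) ≠ 0 := by
    simpa using (det_grade_pos (S := S))
  exact ((ENNReal.mul_right_inj hne ENNReal.ofReal_ne_top).1 h).symm

lemma volume_ccBall_zero {R : ℝ} (hR : 0 < R) (r : ℝ) :
    volume (S.ccBall 0 (R * r)) = ENNReal.ofReal (R ^ S.homDim) * volume (S.ccBall 0 r) := by
  rw [← dil_image_ccBall hR, Measure.addHaar_image_linearMap, det_dil, abs_of_pos (pow_pos hR _)]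

variable (S) in
/-- The measure of the Carnot-Carathéodory balls. -/
theorem exists_volume_ccBall : ∃ v : ℝ≥0∞, v ≠ 0 ∧ v ≠ ⊤ ∧ ∀ (x : 𝔤) (R : ℝ), 0 < R →
    volume (S.ccBall x R) = ENNReal.ofReal (R ^ S.homDim) * v := by
  refine ⟨volume (S.ccBall 0 1), ?_, ?_, ?_⟩
  -- If the unit ball were null, so would be all its dilates, which exhaust the group by
  -- connectivity.
  · intro h0
    have hn : ∀ n : ℕ, volume (S.ccBall 0 (n + 1 : ℝ)) = 0 := fun n => by
      have := volume_ccBall_zero (S := S) (R := n + 1) (by positivity) 1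
      rwa [mul_one, h0, mul_zero] at this
    have hu : (univ : Set 𝔤) = ⋃ n : ℕ, S.ccBall 0 (n + 1 : ℝ) := by
      refine (eq_univ_of_forall fun x => ?_).symm
      obtain ⟨ℓ, hℓ⟩ := exists_joined (S := S) x
      obtain ⟨n, hn⟩ := exists_nat_gt ℓ
      exact mem_iUnion.2 ⟨n, mem_ccBall_iff.2 ⟨ℓ, hℓ, by linarith⟩⟩
    have : volume (univ : Set 𝔤) = 0 := by
      rw [hu]; exact measure_iUnion_null hn
    exact (isOpen_univ.measure_pos volume univ_nonempty).ne' this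
  · obtain ⟨ε, hε, hb⟩ := S.exists_norm_le_one_of_mem_ccBall
    have h1 : volume (S.ccBall 0 ε) < ⊤ := by
      refine (measure_mono (t := Metric.closedBall (0 : 𝔤) 1) fun y hy => ?_).trans_lt
        measure_closedBall_lt_top
      simpa using hb y hy
    have h2 := volume_ccBall_zero (S := S) (R := ε⁻¹) (inv_pos.2 hε) ε
    rw [inv_mul_cancel₀ hε.ne'] at h2
    rw [h2]
    exact ENNReal.mul_ne_top ENNReal.ofReal_ne_top h1.ne
  · intro x R hR
    rw [← leftMul_image_ccBall, volume_leftMul_image, ← volume_ccBall_zero hR, mul_one]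

end Stratification

end

noncomputable section

/-! ### Inequalities for sequences of functions with geometrically decaying averages -/

section AdaptedSequences

lemma add_pow_le_pow_add_mul (a b : ℝ≥0∞) (n : ℕ) :
    (a + b) ^ (n + 1) ≤ a ^ (n + 1) + (n + 1) * (b * (a + b) ^ n) := by
  induction n with
  | zero => simp
  | succ n ih =>
    calc (a + b) ^ (n + 1 + 1) = (a + b) ^ (n + 1) * a + b * (a + b) ^ (n + 1) := by ring
      _ ≤ (a ^ (n + 1) + (n + 1) * (b * (a + b) ^ n)) * a + b * (a + b) ^ (n + 1) := by gcongr
      _ = a ^ (n + 1 + 1) + (n + 1) * (b * ((a + b) ^ n * a)) + b * (a + b) ^ (n + 1) := by ring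
      _ ≤ a ^ (n + 1 + 1) + (n + 1) * (b * ((a + b) ^ n * (a + b))) + b * (a + b) ^ (n + 1) := by
        gcongr; exact le_self_add
      _ = _ := by push_cast; ring

lemma sum_pow_succ_le (b : ℕ → ℝ≥0∞) (n N : ℕ) :
    (∑ i ∈ Finset.range N, b i) ^ (n + 1) ≤
      (n + 1) * ∑ i ∈ Finset.range N, b i * (∑ l ∈ Finset.range (i + 1), b l) ^ n := by
  induction N with
  | zero => simp
  | succ N ih =>
    rw [Finset.sum_range_succ (fun i => b i * _), Finset.sum_range_succ b N, mul_add]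
    exact (add_pow_le_pow_add_mul _ _ n).trans (by gcongr)

/-- A form of Young's inequality: if `s ≥ 2Ab`, one factor `b` is traded for `s` at the price `1/2`;
otherwise `s` is replaced by `2Ab`. The factor `1/2` permits absorption. -/
lemma mul_sq_mul_pow_le (A b s : ℝ≥0∞) (n : ℕ) :
    A * (b * s ^ n * b) ≤ 2⁻¹ * (b * s ^ (n + 1)) + A * (2 * A) ^ n * b ^ (n + 2) := by
  rcases le_total (2 * A * b) s with h | h
  · refine le_add_right ?_
    calc A * (b * s ^ n * b) = 2⁻¹ * (b * (s ^ n * (2 * A * b))) := by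
          have : (2 : ℝ≥0∞)⁻¹ * 2 = 1 := ENNReal.inv_mul_cancel (by simp) (by simp)
          calc A * (b * s ^ n * b) = (2⁻¹ * 2) * (A * (b * s ^ n * b)) := by rw [this, one_mul]
            _ = _ := by ring
      _ ≤ 2⁻¹ * (b * (s ^ n * s)) := by gcongr
      _ = _ := by ring
  · refine le_add_left ?_
    calc A * (b * s ^ n * b) ≤ A * (b * (2 * A * b) ^ n * b) := by gcongr
      _ = _ := by ring

variable {X : Type*} [MeasurableSpace X] {ν : Measure X} {b : ℕ → X → ℝ≥0∞} {J : ℕ → X → ℕ}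
  {N : ℕ} {C : ℝ≥0∞}

lemma sum_range_mul_sum_comm (u w : ℕ → ℝ≥0∞) (N : ℕ) :
    ∑ j ∈ Finset.range N, u j * ∑ i ∈ Finset.range (j + 1), w i =
      ∑ i ∈ Finset.range N, w i * ∑ j ∈ Finset.Ico i N, u j := by
  simp only [Finset.mul_sum]
  rw [Finset.sum_sigma', Finset.sum_sigma']
  refine Finset.sum_bij' (fun p _ => ⟨p.2, p.1⟩) (fun p _ => ⟨p.2, p.1⟩) ?_ ?_ ?_ ?_ ?_
  · rintro ⟨i, j⟩ h
    simp only [Finset.mem_sigma, Finset.mem_range, Finset.mem_Ico] at h ⊢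
    omega
  · rintro ⟨i, j⟩ h
    simp only [Finset.mem_sigma, Finset.mem_range, Finset.mem_Ico] at h ⊢
    omega
  · simp
  · simp
  · rintro ⟨i, j⟩ _
    exact mul_comm _ _

/-- If the averages of the later terms are controlled by `b i`, the `L^n` norm of the sum of the
`b i` is controlled by the sum of their `L^n` norms. -/
theorem lintegral_sum_pow_le (hC : C ≠ ⊤) (hC1 : 1 ≤ C)
    (hJ : ∀ i j, i ≤ j → j < N → ∀ x y, J j x = J j y → J i x = J i y)
    (hb : ∀ i, i < N → Measurable (b i)) (hbJ : ∀ i, i < N → (b i).FactorsThrough (J i))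
    (hH : ∀ i, i < N → ∀ f : X → ℝ≥0∞, Measurable f → f.FactorsThrough (J i) →
      ∫⁻ x, f x * ∑ j ∈ Finset.Ico i N, b j x ∂ν ≤ C * ∫⁻ x, f x * b i x ∂ν) (n : ℕ) :
    ∫⁻ x, (∑ i ∈ Finset.range N, b i x) ^ (n + 2) ∂ν ≤
      (n + 2) * (2 * ((n + 1) * C * (2 * ((n + 1) * C)) ^ n)) *
        ∑ i ∈ Finset.range N, ∫⁻ x, b i x ^ (n + 2) ∂ν := by
  set A : ℝ≥0∞ := (n + 1) * C with hA
  have hAtop : A ≠ ⊤ := ENNReal.mul_ne_top (by finiteness) hC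
  set s : ℕ → X → ℝ≥0∞ := fun i x => ∑ l ∈ Finset.range (i + 1), b l x with hs
  have hsm : ∀ i, i < N → Measurable (s i) := fun i hi =>
    Finset.measurable_fun_sum _ fun l hl => hb l (by have := Finset.mem_range.1 hl; omega)
  have hsJ : ∀ i, i < N → (s i).FactorsThrough (J i) := fun i hi x y hxy =>
    Finset.sum_congr rfl fun l hl => by
      have := Finset.mem_range.1 hl
      exact hbJ l (by omega) (hJ l i (by omega) hi x y hxy)
  set Y := ∑ i ∈ Finset.range N, ∫⁻ x, b i x ^ (n + 2) ∂ν with hY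
  set Z := ∑ i ∈ Finset.range N, ∫⁻ x, b i x * s i x ^ (n + 1) ∂ν with hZ
  have hlt : ∀ {i}, i ∈ Finset.range N → i < N := fun h => Finset.mem_range.1 h
  have h1 : ∫⁻ x, (∑ i ∈ Finset.range N, b i x) ^ (n + 2) ∂ν ≤ (n + 2) * Z := by
    calc ∫⁻ x, (∑ i ∈ Finset.range N, b i x) ^ (n + 2) ∂ν
        ≤ ∫⁻ x, (n + 2) * ∑ i ∈ Finset.range N, b i x * s i x ^ (n + 1) ∂ν := by
          refine lintegral_mono fun x => ?_
          have := sum_pow_succ_le (fun i => b i x) (n + 1) N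
          push_cast at this
          rwa [show (n : ℝ≥0∞) + 1 + 1 = n + 2 by ring] at this
      _ = (n + 2) * Z := by
          rw [lintegral_const_mul', lintegral_finsetSum']
          · exact fun i hi => ((hb i (hlt hi)).mul ((hsm i (hlt hi)).pow_const _)).aemeasurable
          · finiteness
  -- Write one more power of `s` as a sum and exchange the summations, so that `hH` applies with `f
  -- = b i * s i ^ n`; `mul_sq_mul_pow_le` then brings `Z` back with a factor `1/2`.
  have h2 : Z ≤ 2⁻¹ * Z + A * (2 * A) ^ n * Y := by
    calc Z = ∫⁻ x, ∑ i ∈ Finset.range N, b i x * s i x ^ (n + 1) ∂ν := by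
          rw [lintegral_finsetSum']
          exact fun i hi => ((hb i (hlt hi)).mul ((hsm i (hlt hi)).pow_const _)).aemeasurable
      _ ≤ ∫⁻ x, (n + 1) * ∑ i ∈ Finset.range N,
            (b i x * s i x ^ n) * ∑ j ∈ Finset.Ico i N, b j x ∂ν := by
          refine lintegral_mono fun x => ?_
          dsimp only
          rw [← sum_range_mul_sum_comm (fun i => b i x) (fun i => b i x * s i x ^ n), Finset.mul_sum]
          refine Finset.sum_le_sum fun j _ => ?_
          rw [mul_left_comm]
          gcongr
          exact sum_pow_succ_le (fun i => b i x) n (j + 1)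
      _ = (n + 1) * ∑ i ∈ Finset.range N,
            ∫⁻ x, (b i x * s i x ^ n) * ∑ j ∈ Finset.Ico i N, b j x ∂ν := by
          rw [lintegral_const_mul' _ _ (by finiteness), lintegral_finsetSum']
          intro i hi
          exact (((hb i (hlt hi)).mul ((hsm i (hlt hi)).pow_const _)).mul
            (Finset.measurable_fun_sum _ fun l hl => hb l (Finset.mem_Ico.1 hl).2)).aemeasurable
      _ ≤ (n + 1) * ∑ i ∈ Finset.range N, C * ∫⁻ x, (b i x * s i x ^ n) * b i x ∂ν := by
          gcongr with i hi
          exact hH i (hlt hi) _ ((hb i (hlt hi)).mul ((hsm i (hlt hi)).pow_const _))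
            fun x y hxy => by rw [hbJ i (hlt hi) hxy, hsJ i (hlt hi) hxy]
      _ = ∑ i ∈ Finset.range N, ∫⁻ x, A * (b i x * s i x ^ n * b i x) ∂ν := by
          rw [Finset.mul_sum]
          refine Finset.sum_congr rfl fun i _ => ?_
          rw [lintegral_const_mul' _ _ hAtop, hA, mul_assoc]
      _ ≤ ∑ i ∈ Finset.range N,
            ∫⁻ x, 2⁻¹ * (b i x * s i x ^ (n + 1)) + A * (2 * A) ^ n * b i x ^ (n + 2) ∂ν :=
          Finset.sum_le_sum fun i _ => lintegral_mono fun x => mul_sq_mul_pow_le _ _ _ _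
      _ = 2⁻¹ * Z + A * (2 * A) ^ n * Y := by
          rw [hZ, hY, Finset.mul_sum, Finset.mul_sum, ← Finset.sum_add_distrib]
          refine Finset.sum_congr rfl fun i hi => ?_
          rw [lintegral_add_left, lintegral_const_mul' _ _ (by finiteness),
            lintegral_const_mul' _ _ (by finiteness)]
          exact ((hb i (hlt hi)).mul ((hsm i (hlt hi)).pow_const _)).const_mul _
  have h3 : Z ≤ 2 * (A * (2 * A) ^ n) * Y := by
    by_cases hYtop : Y = ⊤
    · have h0 : A ≠ 0 := mul_ne_zero (by positivity) (zero_lt_one.trans_le hC1).ne'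
      have h0' : 2 * (A * (2 * A) ^ n) ≠ 0 :=
        mul_ne_zero two_ne_zero (mul_ne_zero h0 (pow_ne_zero _ (mul_ne_zero two_ne_zero h0)))
      rw [hYtop, ENNReal.mul_top h0']
      exact le_top
    -- Half of `Z` can be subtracted only when `Z` is finite. A crude bound depending on `N` is
    -- enough.
    · have hZtop : Z ≠ ⊤ := by
        have h5 : ∀ x, ∀ i ∈ Finset.range N, b i x * s i x ^ (n + 1) ≤
            (N : ℝ≥0∞) ^ (n + 1) * ∑ l ∈ Finset.range N, b l x ^ (n + 2) := by
          intro x i hi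
          have hi' := hlt hi
          have e1 : b i x ≤ ∑ l ∈ Finset.range N, b l x :=
            Finset.single_le_sum (f := fun l => b l x) (fun _ _ => zero_le) hi
          have e2 : s i x ≤ ∑ l ∈ Finset.range N, b l x :=
            Finset.sum_le_sum_of_subset (Finset.range_mono (by omega))
          have e3 := ENNReal.rpow_sum_le_const_mul_sum_rpow (Finset.range N) (fun l => b l x)
            (p := (n + 2 : ℕ)) (by push_cast; linarith [n.cast_nonneg (α := ℝ)])
          rw [show (((n + 2 : ℕ) : ℝ) - 1) = ((n + 1 : ℕ) : ℝ) by push_cast; ring] at e3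
          simp only [ENNReal.rpow_natCast, Finset.card_range] at e3
          refine le_trans ?_ e3
          rw [pow_succ' _ (n + 1)]
          gcongr
        have h6 : Z ≤ N * ((N : ℝ≥0∞) ^ (n + 1) * Y) := by
          calc Z ≤ ∑ _i ∈ Finset.range N, (N : ℝ≥0∞) ^ (n + 1) * Y := by
                refine Finset.sum_le_sum fun i hi => ?_
                rw [hY, ← lintegral_finsetSum', ← lintegral_const_mul' _ _ (by finiteness)]
                · exact lintegral_mono fun x => h5 x i hi
                · exact fun i hi => ((hb i (hlt hi)).pow_const _).aemeasurable
            _ = _ := by simp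
        exact ne_top_of_le_ne_top (by finiteness) h6
      have h4 : Z = 2⁻¹ * Z + 2⁻¹ * Z := by rw [← add_mul, ENNReal.inv_two_add_inv_two, one_mul]
      have h5 : 2⁻¹ * Z ≤ A * (2 * A) ^ n * Y := by
        refine (ENNReal.add_le_add_iff_left (a := 2⁻¹ * Z) (by finiteness)).1 ?_
        rwa [← h4]
      calc Z = 2 * (2⁻¹ * Z) := by
            rw [← mul_assoc, ENNReal.mul_inv_cancel (by simp) (by simp), one_mul]
        _ ≤ 2 * (A * (2 * A) ^ n * Y) := by gcongr
        _ = _ := by ring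
  calc _ ≤ (n + 2) * Z := h1
    _ ≤ (n + 2) * (2 * (A * (2 * A) ^ n) * Y) := by gcongr
    _ = _ := by ring

/-- If the averages of the later terms are controlled by `c i`, the sum of the `L^β` norms of the
`c i` is controlled by the `L^β` norm of their supremum. -/
theorem sum_lintegral_rpow_le {c : ℕ → X → ℝ≥0∞}
    (hJ : ∀ i j, i ≤ j → j < N → ∀ x y, J j x = J j y → J i x = J i y)
    (hc : ∀ i, i < N → Measurable (c i)) (hcJ : ∀ i, i < N → (c i).FactorsThrough (J i))
    (hH : ∀ i, i < N → ∀ f : X → ℝ≥0∞, Measurable f → f.FactorsThrough (J i) →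
      ∫⁻ x, f x * ∑ j ∈ Finset.Ico i N, c j x ∂ν ≤ C * ∫⁻ x, f x * c i x ∂ν) {β : ℝ} (hβ : 1 < β) :
    ∑ i ∈ Finset.range N, ∫⁻ x, c i x ^ β ∂ν ≤
      C * ∫⁻ x, ((Finset.range N).sup fun i => c i x) ^ β ∂ν := by
  -- The running maximum over the indices below `i`; thus `m (i + 1)` already includes `c i` and
  -- still depends only on `J i`.
  set m : ℕ → X → ℝ≥0∞ := fun i x => (Finset.range i).sup fun l => c l x with hm
  set G : ℕ → X → ℝ≥0∞ := fun i x => m i x ^ (β - 1) with hG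
  set Δ : ℕ → X → ℝ≥0∞ := fun i x => G (i + 1) x - G i x with hΔ
  have hβ0 : 0 < β - 1 := by linarith
  have hlt : ∀ {i}, i ∈ Finset.range N → i < N := fun h => Finset.mem_range.1 h
  have hmsucc : ∀ i x, m (i + 1) x = c i x ⊔ m i x := fun i x => by
    simp only [hm, Finset.range_add_one, Finset.sup_insert]
  have hmm : ∀ i, i ≤ N → Measurable (m i) := by
    intro i
    induction i with
    | zero => intro _; simp only [hm, Finset.range_zero, Finset.sup_empty]; exact measurable_const
    | succ i ih =>
      intro hi
      have : m (i + 1) = fun x => c i x ⊔ m i x := funext (hmsucc i)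
      rw [this]
      exact (hc i (by omega)).sup (ih (by omega))
  have hmJ : ∀ i j, i ≤ j + 1 → j < N → (m i).FactorsThrough (J j) := fun i j hij hj x y hxy =>
    Finset.sup_congr rfl fun l hl => by
      have := Finset.mem_range.1 hl
      exact hcJ l (by omega) (hJ l j (by omega) hj x y hxy)
  have hΔm : ∀ i, i < N → Measurable (Δ i) := fun i hi =>
    ((hmm (i + 1) hi).pow_const _).sub ((hmm i hi.le).pow_const _)
  have hΔJ : ∀ i, i < N → (Δ i).FactorsThrough (J i) := fun i hi x y hxy => by
    simp only [hΔ, hG, hmJ (i + 1) i le_rfl hi hxy, hmJ i i (by omega) hi hxy]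
  have hGsum : ∀ j x, G j x ≤ ∑ i ∈ Finset.range j, Δ i x := by
    intro j x
    induction j with
    | zero => simp [hG, hm, hβ0]
    | succ j ih =>
      rw [Finset.sum_range_succ]
      calc G (j + 1) x ≤ G j x + Δ j x := le_add_tsub
        _ ≤ _ := by gcongr
  have hpow : ∀ z : ℝ≥0∞, z ^ β = z * z ^ (β - 1) := fun z => by
    conv_lhs => rw [show β = 1 + (β - 1) by ring]
    rw [ENNReal.rpow_add_of_nonneg _ _ zero_le_one hβ0.le, ENNReal.rpow_one]
  -- The increment `Δ j` can be nonzero only where `c j` is a new maximum; there `Δ j * c j` is at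
  -- most the increment of the `β`-th power of the maximum.
  have hΔc : ∀ j x, ∑ i ∈ Finset.range j, Δ i x * c i x ≤ m j x ^ β := by
    intro j x
    induction j with
    | zero => simp
    | succ j ih =>
      rw [Finset.sum_range_succ]
      rcases le_total (c j x) (m j x) with h | h
      · have h1 : m (j + 1) x = m j x := by rw [hmsucc, sup_eq_right.2 h]
        simp only [hΔ, hG, h1, tsub_self, zero_mul, add_zero]
        exact ih
      · have h1 : m (j + 1) x = c j x := by rw [hmsucc, sup_eq_left.2 h]
        rw [h1]
        rcases eq_or_ne (c j x) ⊤ with htop | htop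
        · rw [htop, ENNReal.top_rpow_of_pos (by linarith)]; exact le_top
        · calc _ ≤ m j x ^ β + Δ j x * c j x := by gcongr
            _ ≤ c j x * m j x ^ (β - 1) + Δ j x * c j x := by
              rw [hpow]; gcongr
            _ = c j x * (m j x ^ (β - 1) + (c j x ^ (β - 1) - m j x ^ (β - 1))) := by
              simp only [hΔ, hG, h1]; ring
            _ = c j x ^ β := by
              rw [add_tsub_cancel_of_le (ENNReal.rpow_le_rpow h hβ0.le), hpow]
  calc ∑ i ∈ Finset.range N, ∫⁻ x, c i x ^ β ∂ν
      = ∫⁻ x, ∑ i ∈ Finset.range N, c i x ^ β ∂ν := by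
        rw [lintegral_finsetSum']
        exact fun i hi => ((hc i (hlt hi)).pow_const _).aemeasurable
    _ ≤ ∫⁻ x, ∑ i ∈ Finset.range N, Δ i x * ∑ j ∈ Finset.Ico i N, c j x ∂ν := by
        refine lintegral_mono fun x => ?_
        dsimp only
        rw [← sum_range_mul_sum_comm (fun i => c i x) (fun i => Δ i x)]
        refine Finset.sum_le_sum fun j _ => ?_
        rw [hpow]
        gcongr
        refine le_trans ?_ (hGsum (j + 1) x)
        exact ENNReal.rpow_le_rpow (by rw [hmsucc]; exact le_sup_left) hβ0.le
    _ = ∑ i ∈ Finset.range N, ∫⁻ x, Δ i x * ∑ j ∈ Finset.Ico i N, c j x ∂ν := by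
        rw [lintegral_finsetSum']
        exact fun i hi => ((hΔm i (hlt hi)).mul
          (Finset.measurable_fun_sum _ fun l hl => hc l (Finset.mem_Ico.1 hl).2)).aemeasurable
    _ ≤ ∑ i ∈ Finset.range N, C * ∫⁻ x, Δ i x * c i x ∂ν :=
        Finset.sum_le_sum fun i hi => hH i (hlt hi) _ (hΔm i (hlt hi)) (hΔJ i (hlt hi))
    _ = C * ∫⁻ x, ∑ i ∈ Finset.range N, Δ i x * c i x ∂ν := by
        rw [← Finset.mul_sum, lintegral_finsetSum']
        exact fun i hi => ((hΔm i (hlt hi)).mul (hc i (hlt hi))).aemeasurable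
    _ ≤ C * ∫⁻ x, m N x ^ β ∂ν := by
        gcongr with x
        exact hΔc N x

end AdaptedSequences

end

noncomputable section

/-! ### Powers of `8` -/

/-- `8 ^ x` as an extended nonnegative real. -/
def eightPow (x : ℝ) : ℝ≥0∞ := 8 ^ x

lemma eightPow_ne_zero (x : ℝ) : eightPow x ≠ 0 := by simp [eightPow]

lemma eightPow_ne_top (x : ℝ) : eightPow x ≠ ⊤ := by simp [eightPow]

lemma eightPow_add (x y : ℝ) : eightPow (x + y) = eightPow x * eightPow y :=
  ENNReal.rpow_add _ _ (by norm_num) (by finiteness)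

lemma eightPow_neg (x : ℝ) : eightPow (-x) = (eightPow x)⁻¹ := ENNReal.rpow_neg _ _

lemma eightPow_rpow (x y : ℝ) : eightPow x ^ y = eightPow (x * y) := (ENNReal.rpow_mul _ _ _).symm

lemma eightPow_le {x y : ℝ} (h : x ≤ y) : eightPow x ≤ eightPow y :=
  ENNReal.rpow_le_rpow_of_exponent_le (by norm_num) h

lemma eightPow_lt_one {x : ℝ} (h : x < 0) : eightPow x < 1 :=
  ENNReal.rpow_lt_one_of_one_lt_of_neg (by norm_num) h

lemma ofReal_rpow_eight (x : ℝ) : ENNReal.ofReal ((8 : ℝ) ^ x) = eightPow x := by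
  rw [← ENNReal.ofReal_rpow_of_pos (by norm_num), eightPow]
  norm_num

lemma zpow_pos_eight (k : ℤ) : (0 : ℝ) < 8 ^ k := by positivity

namespace Stratification

variable {𝔤 : Type*} [NormedLieRing 𝔤] [InnerLieAlgebra 𝔤] [FiniteDimensional ℝ 𝔤]
  [MeasurableSpace 𝔤] [BorelSpace 𝔤] {S : Stratification 𝔤}

variable (S) in
/-- The measure of the unit ball. -/
def ballVol : ℝ≥0∞ := volume (S.ccBall 0 1)

lemma ballVol_ne_zero : S.ballVol ≠ 0 := by
  obtain ⟨v, h0, -, h⟩ := S.exists_volume_ccBall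
  simpa [ballVol, h 0 1 one_pos] using h0

lemma ballVol_ne_top : S.ballVol ≠ ⊤ := by
  obtain ⟨v, -, h1, h⟩ := S.exists_volume_ccBall
  simpa [ballVol, h 0 1 one_pos] using h1

lemma volume_ccBall (x : 𝔤) {n : ℕ} (hn : 0 < n) (k : ℤ) :
    volume (S.ccBall x (n * 8 ^ k)) =
      (n : ℝ≥0∞) ^ S.homDim * (eightPow (k * S.homDim) * S.ballVol) := by
  obtain ⟨v, -, -, h⟩ := S.exists_volume_ccBall
  have hv : S.ballVol = v := by simp [ballVol, h 0 1 one_pos]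
  have hn' : (0 : ℝ) < n := by exact_mod_cast hn
  rw [h x _ (mul_pos hn' (zpow_pos_eight k)), hv, ← mul_assoc, mul_pow,
    ENNReal.ofReal_mul (by positivity), ENNReal.ofReal_pow hn'.le, ENNReal.ofReal_natCast,
    ← ofReal_rpow_eight, Real.rpow_mul (by norm_num), Real.rpow_intCast, Real.rpow_natCast]

/-! ### Volume and counting of the cubes -/

namespace DyadicFamily

variable {m : ℤ} (D : S.DyadicFamily m) {k : ℤ}

lemma cube_subset_ccBall (hk : m ≤ k) (j : ℕ) : D.cube k j ⊆ S.ccBall (D.center k j) (8 * 8 ^ k) := by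
  have := D.subset_ball k hk j
  rwa [zpow_add_one₀ (by norm_num), mul_comm] at this

lemma center_mem_cube (hk : m ≤ k) (j : ℕ) : D.center k j ∈ D.cube k j :=
  D.ball_subset k hk j (self_mem_ccBall _ (zpow_pos_eight k))

lemma le_volume_cube (hk : m ≤ k) (j : ℕ) :
    eightPow (k * S.homDim) * S.ballVol ≤ volume (D.cube k j) := by
  have := volume_ccBall (S := S) (D.center k j) one_pos k
  rw [Nat.cast_one, Nat.cast_one, one_mul, one_pow, one_mul] at this
  rw [← this]
  exact measure_mono (D.ball_subset k hk j)

lemma volume_cube_le (hk : m ≤ k) (j : ℕ) :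
    volume (D.cube k j) ≤ 8 ^ S.homDim * (eightPow (k * S.homDim) * S.ballVol) := by
  have := volume_ccBall (S := S) (D.center k j) (n := 8) (by norm_num) k
  push_cast at this
  rw [← this]
  exact measure_mono (D.cube_subset_ccBall hk j)

lemma volume_cube_ne_zero (hk : m ≤ k) (j : ℕ) : volume (D.cube k j) ≠ 0 :=
  ne_bot_of_le_ne_bot (mul_ne_zero (eightPow_ne_zero _) ballVol_ne_zero) (D.le_volume_cube hk j)

lemma volume_cube_ne_top (hk : m ≤ k) (j : ℕ) : volume (D.cube k j) ≠ ⊤ :=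
  ne_top_of_le_ne_top (ENNReal.mul_ne_top (by finiteness)
    (ENNReal.mul_ne_top (eightPow_ne_top _) ballVol_ne_top)) (D.volume_cube_le hk j)

/-- A ball of radius comparable to `8 ^ k` contains boundedly many cubes of side length `8 ^ k`. -/
lemma card_le (hk : m ≤ k) {n : ℕ} (hn : 0 < n) {z : 𝔤} {t : Finset ℕ}
    (ht : ∀ i ∈ t, D.cube k i ⊆ S.ccBall z (n * 8 ^ k)) : t.card ≤ n ^ S.homDim := by
  have h1 : (t.card : ℝ≥0∞) * (eightPow (k * S.homDim) * S.ballVol) ≤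
      ((n ^ S.homDim : ℕ) : ℝ≥0∞) * (eightPow (k * S.homDim) * S.ballVol) := by
    calc (t.card : ℝ≥0∞) * (eightPow (k * S.homDim) * S.ballVol)
        = ∑ _i ∈ t, eightPow (k * S.homDim) * S.ballVol := by simp
      _ ≤ ∑ i ∈ t, volume (D.cube k i) := Finset.sum_le_sum fun i _ => D.le_volume_cube hk i
      _ = volume (⋃ i ∈ t, D.cube k i) := by
          rw [measure_biUnion_finset (fun i _ j _ hij => D.disjoint k hk i j hij)
            fun i _ => D.measurableSet k hk i]
      _ ≤ volume (S.ccBall z (n * 8 ^ k)) := measure_mono (iUnion₂_subset ht)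
      _ = _ := by rw [volume_ccBall z hn]; push_cast; rfl
  have h2 := (ENNReal.mul_le_mul_iff_left (mul_ne_zero (eightPow_ne_zero _) ballVol_ne_zero)
    (ENNReal.mul_ne_top (eightPow_ne_top _) ballVol_ne_top)).1 h1
  exact_mod_cast h2

end DyadicFamily

end Stratification

/-! ### Sums over relations of bounded multiplicity -/

lemma exists_finset_of_card_le {p : ℕ → Prop} {n : ℕ}
    (h : ∀ t : Finset ℕ, (∀ i ∈ t, p i) → t.card ≤ n) :
    ∃ s : Finset ℕ, (∀ i, i ∈ s ↔ p i) ∧ s.card ≤ n := by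
  have hfin : {i | p i}.Finite := by
    by_contra hinf
    obtain ⟨t, ht, hcard⟩ := Set.Infinite.exists_subset_card_eq hinf (n + 1)
    have := h t fun i hi => ht hi
    omega
  exact ⟨hfin.toFinset, fun i => by simp, h _ fun i hi => by simpa using hi⟩

lemma tsum_ite_le_card_mul {p : ℕ → Prop} [DecidablePred p] {n : ℕ}
    (h : ∀ t : Finset ℕ, (∀ i ∈ t, p i) → t.card ≤ n) (y : ℝ≥0∞) :
    ∑' i, (if p i then y else 0) ≤ n * y := by
  obtain ⟨s, hs, hcard⟩ := exists_finset_of_card_le h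
  rw [tsum_eq_sum (s := s) fun i hi => if_neg fun hp => hi ((hs i).2 hp)]
  calc ∑ i ∈ s, (if p i then y else 0) ≤ ∑ _i ∈ s, y :=
        Finset.sum_le_sum fun i _ => by split_ifs <;> simp
    _ = s.card * y := by simp
    _ ≤ n * y := by gcongr

-- Hölder's inequality inside each sum of at most `n` terms costs `n ^ (β - 1)`, and after
-- exchanging the sums each `x i` is counted at most `n` times.
open Classical in
lemma tsum_tsum_ite_rpow_le {R : ℕ → ℕ → Prop} {n : ℕ}
    (h1 : ∀ j, ∀ t : Finset ℕ, (∀ i ∈ t, R j i) → t.card ≤ n)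
    (h2 : ∀ i, ∀ t : Finset ℕ, (∀ j ∈ t, R j i) → t.card ≤ n) (x : ℕ → ℝ≥0∞) {β : ℝ}
    (hβ : 1 ≤ β) :
    ∑' j, (∑' i, if R j i then x i else 0) ^ β ≤ (n : ℝ≥0∞) ^ β * ∑' i, x i ^ β := by
  have hβ0 : 0 < β := by linarith
  have key : ∀ j, (∑' i, if R j i then x i else 0) ^ β ≤
      (n : ℝ≥0∞) ^ (β - 1) * ∑' i, if R j i then x i ^ β else 0 := by
    intro j
    obtain ⟨s, hs, hcard⟩ := exists_finset_of_card_le (h1 j)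
    rw [tsum_eq_sum (s := s) fun i hi => if_neg fun hp => hi ((hs i).2 hp),
      tsum_eq_sum (s := s) fun i hi => if_neg fun hp => hi ((hs i).2 hp)]
    refine (ENNReal.rpow_sum_le_const_mul_sum_rpow s _ hβ).trans ?_
    gcongr with i hi
    rw [if_pos ((hs i).1 hi), if_pos ((hs i).1 hi)]
  calc ∑' j, (∑' i, if R j i then x i else 0) ^ β
      ≤ ∑' j, (n : ℝ≥0∞) ^ (β - 1) * ∑' i, if R j i then x i ^ β else 0 := ENNReal.tsum_le_tsum key
    _ = (n : ℝ≥0∞) ^ (β - 1) * ∑' i, ∑' j, if R j i then x i ^ β else 0 := by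
        rw [ENNReal.tsum_mul_left, ENNReal.tsum_comm]
    _ ≤ (n : ℝ≥0∞) ^ (β - 1) * ∑' i, n * x i ^ β := by
        gcongr with i
        exact tsum_ite_le_card_mul (h2 i) _
    _ = (n : ℝ≥0∞) ^ β * ∑' i, x i ^ β := by
        rw [ENNReal.tsum_mul_left, ← mul_assoc]
        congr 1
        conv_rhs => rw [show β = (β - 1) + 1 by ring]
        rw [ENNReal.rpow_add_of_nonneg _ _ (by linarith) zero_le_one, ENNReal.rpow_one]

namespace Stratification

variable {𝔤 : Type*} [NormedLieRing 𝔤] [InnerLieAlgebra 𝔤] [FiniteDimensional ℝ 𝔤]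
  [MeasurableSpace 𝔤] [BorelSpace 𝔤] {S : Stratification 𝔤}

namespace DyadicFamily

variable {m : ℤ} (D : S.DyadicFamily m) {k l : ℤ}

/-! ### Neighbouring cubes -/

/-- The cube `E^k_i` meets a large ball around the center of `E^k_j`. -/
def Near (k : ℤ) (j i : ℕ) : Prop := (D.cube k i ∩ S.ccBall (D.center k j) (16 * 8 ^ k)).Nonempty

open Classical in
/-- The measure of the union of the cubes near `E^k_j`. -/
def star (μ : Measure 𝔤) (k : ℤ) (j : ℕ) : ℝ≥0∞ :=
  ∑' i, if D.Near k j i then μ (D.cube k i) else 0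

variable {D}

lemma subset_of_near (hk : m ≤ k) {j i : ℕ} (h : D.Near k j i) :
    D.cube k i ⊆ S.ccBall (D.center k j) (32 * 8 ^ k) := by
  obtain ⟨p, hp, hp'⟩ := h
  have h1 := mem_ccBall_trans hp' (mem_ccBall_comm.1 (D.cube_subset_ccBall hk i hp))
  exact fun y hy => ccBall_mono _ (by linarith)
    (mem_ccBall_trans h1 (D.cube_subset_ccBall hk i hy))

lemma subset_of_near' (hk : m ≤ k) {j i : ℕ} (h : D.Near k j i) :
    D.cube k j ⊆ S.ccBall (D.center k i) (32 * 8 ^ k) := by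
  obtain ⟨p, hp, hp'⟩ := h
  have h1 := mem_ccBall_trans (D.cube_subset_ccBall hk i hp) (mem_ccBall_comm.1 hp')
  exact fun y hy => ccBall_mono _ (by linarith)
    (mem_ccBall_trans h1 (D.cube_subset_ccBall hk j hy))

lemma card_near_le (hk : m ≤ k) (j : ℕ) (t : Finset ℕ) (ht : ∀ i ∈ t, D.Near k j i) :
    t.card ≤ 32 ^ S.homDim :=
  D.card_le hk (n := 32) (by norm_num) fun i hi => by simpa using subset_of_near hk (ht i hi)

lemma card_near_le' (hk : m ≤ k) (i : ℕ) (t : Finset ℕ) (ht : ∀ j ∈ t, D.Near k j i) :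
    t.card ≤ 32 ^ S.homDim :=
  D.card_le hk (n := 32) (by norm_num) fun j hj => by simpa using subset_of_near' hk (ht j hj)

lemma tsum_star_rpow_le (hk : m ≤ k) (μ : Measure 𝔤) {β : ℝ} (hβ : 1 ≤ β) :
    ∑' j, D.star μ k j ^ β ≤ ((32 ^ S.homDim : ℕ) : ℝ≥0∞) ^ β * ∑' j, μ (D.cube k j) ^ β :=
  tsum_tsum_ite_rpow_le (card_near_le hk) (card_near_le' hk) _ hβ

lemma exists_mem_cube (hk : m ≤ k) (x : 𝔤) : ∃ j, x ∈ D.cube k j := by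
  have : x ∈ ⋃ j, D.cube k j := by rw [D.iUnion_eq k hk]; trivial
  simpa using this

lemma measure_ccBall_le_star (hk : m ≤ k) (μ : Measure 𝔤) (j : ℕ) :
    μ (S.ccBall (D.center k j) (16 * 8 ^ k)) ≤ D.star μ k j := by
  classical
  calc μ (S.ccBall (D.center k j) (16 * 8 ^ k))
      ≤ μ (⋃ i, if D.Near k j i then D.cube k i else ∅) := by
        refine measure_mono fun y hy => ?_
        obtain ⟨i, hi⟩ := D.exists_mem_cube hk y
        refine mem_iUnion.2 ⟨i, ?_⟩
        rwa [if_pos ⟨y, hi, hy⟩]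
    _ ≤ ∑' i, μ (if D.Near k j i then D.cube k i else ∅) := measure_iUnion_le _
    _ = D.star μ k j := by
        refine tsum_congr fun i => ?_
        split_ifs <;> simp

open Classical in
/-- Sums of the measures of some of the cubes of one generation. -/
lemma tsum_ite_measure_cube (hk : m ≤ k) (μ : Measure 𝔤) (p : ℕ → Prop) :
    ∑' i, (if p i then μ (D.cube k i) else 0) = μ (⋃ i, if p i then D.cube k i else ∅) := by
  rw [measure_iUnion]
  · refine tsum_congr fun i => ?_
    split_ifs <;> simp
  · intro i j hij
    have := D.disjoint k hk i j hij
    simp only [Function.onFun]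
    split_ifs <;> simp [this]
  · intro i
    split_ifs
    · exact D.measurableSet k hk i
    · exact MeasurableSet.empty

lemma star_le_measure_ccBall (hk : m ≤ k) (μ : Measure 𝔤) (j : ℕ) :
    D.star μ k j ≤ μ (S.ccBall (D.center k j) (32 * 8 ^ k)) := by
  classical
  rw [star, tsum_ite_measure_cube hk]
  refine measure_mono (iUnion_subset fun i => ?_)
  split_ifs with h
  · exact subset_of_near hk h
  · exact empty_subset _

lemma near_self (hk : m ≤ k) (j : ℕ) : D.Near k j j :=
  ⟨D.center k j, D.center_mem_cube hk j,
    self_mem_ccBall _ (mul_pos (by norm_num) (zpow_pos_eight k))⟩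

lemma measure_cube_le_star (hk : m ≤ k) (μ : Measure 𝔤) (j : ℕ) :
    μ (D.cube k j) ≤ D.star μ k j := by
  classical
  have := ENNReal.le_tsum (f := fun i => if D.Near k j i then μ (D.cube k i) else 0) j
  rwa [if_pos (near_self hk j)] at this

lemma eq_of_mem_cube (hk : m ≤ k) {i j : ℕ} {x : 𝔤} (hi : x ∈ D.cube k i) (hj : x ∈ D.cube k j) :
    i = j := by
  by_contra h
  exact (Set.disjoint_left.1 (D.disjoint k hk i j h)) hi hj

/-- The neighbours of the subcubes of `E^l_j` are contained in neighbours of `E^l_j`. -/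
lemma cube_subset_of_near (hk : m ≤ k) (hkl : k ≤ l) {i i' j : ℕ}
    (hi : (D.cube k i ∩ D.cube l j).Nonempty) (h : D.Near k i i') {y : 𝔤} (hy : y ∈ D.cube k i') :
    ∃ t, y ∈ D.cube l t ∧ D.Near l j t := by
  rcases hkl.eq_or_lt with rfl | hkl
  · obtain ⟨p, hp, hp'⟩ := hi
    obtain rfl := eq_of_mem_cube hk hp hp'
    exact ⟨i', hy, h⟩
  · obtain ⟨p, hp, hp'⟩ := hi
    obtain ⟨t, ht⟩ := D.exists_mem_cube (hk.trans hkl.le) y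
    refine ⟨t, ht, y, ht, ?_⟩
    have h1 := D.cube_subset_ccBall (hk.trans hkl.le) j hp'
    have h2 := mem_ccBall_trans h1 (mem_ccBall_comm.1 (D.cube_subset_ccBall hk i hp))
    have h3 := mem_ccBall_trans h2 (subset_of_near hk h hy)
    -- The distance from the center of `E^l_j` is below `8 * 8 ^ l + (8 + 32) * 8 ^ k`, at most `13
    -- * 8 ^ l` because `8 * 8 ^ k ≤ 8 ^ l`; the radius `16` in `Near` leaves room for this.
    refine ccBall_mono _ ?_ h3
    have h4 : (8 : ℝ) * 8 ^ k ≤ 8 ^ l := by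
      rw [mul_comm, ← zpow_add_one₀ (by norm_num)]
      exact zpow_le_zpow_right₀ (by norm_num) hkl
    have := zpow_pos_eight k
    linarith

-- Each neighbouring cube of generation `k` is counted boundedly often, and together they stay
-- inside the neighbourhood of `E^l_j`.
open Classical in
lemma tsum_star_le (hk : m ≤ k) (hkl : k ≤ l) (μ : Measure 𝔤) (j : ℕ) :
    ∑' i, (if (D.cube k i ∩ D.cube l j).Nonempty then D.star μ k i else 0) ≤
      ((32 ^ S.homDim : ℕ) : ℝ≥0∞) * D.star μ l j := by
  set n : ℕ := 32 ^ S.homDim with hn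
  calc ∑' i, (if (D.cube k i ∩ D.cube l j).Nonempty then D.star μ k i else 0)
      = ∑' i', ∑' i, (if (D.cube k i ∩ D.cube l j).Nonempty ∧ D.Near k i i' then
          μ (D.cube k i') else 0) := by
        rw [ENNReal.tsum_comm]
        refine tsum_congr fun i => ?_
        by_cases h : (D.cube k i ∩ D.cube l j).Nonempty
        · simp [h, star]
        · simp [h]
    _ ≤ ∑' i', n * (if ∃ i, (D.cube k i ∩ D.cube l j).Nonempty ∧ D.Near k i i' then
          μ (D.cube k i') else 0) := by
        refine ENNReal.tsum_le_tsum fun i' => ?_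
        split_ifs with h
        · exact tsum_ite_le_card_mul
            (p := fun i => (D.cube k i ∩ D.cube l j).Nonempty ∧ D.Near k i i')
            (fun t ht => card_near_le' hk i' t fun i hi => (ht i hi).2) _
        · rw [not_exists] at h
          simp [h]
    _ = n * ∑' i', (if ∃ i, (D.cube k i ∩ D.cube l j).Nonempty ∧ D.Near k i i' then
          μ (D.cube k i') else 0) := ENNReal.tsum_mul_left
    _ ≤ n * D.star μ l j := by
        gcongr
        rw [tsum_ite_measure_cube hk, star, tsum_ite_measure_cube (hk.trans hkl)]
        refine measure_mono fun y hy => ?_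
        obtain ⟨i', hi'⟩ := mem_iUnion.1 hy
        split_ifs at hi' with h
        · obtain ⟨i, hi, hnear⟩ := h
          obtain ⟨t, ht, htn⟩ := cube_subset_of_near hk hkl hi hnear hi'
          refine mem_iUnion.2 ⟨t, ?_⟩
          rwa [if_pos htn]
        · exact absurd hi' (notMem_empty y)

variable (D)

/-! ### The density of the measure at a given scale -/

open Classical in
/-- The index of the cube of generation `k` that contains `x`. -/
def idx (k : ℤ) (x : 𝔤) : ℕ := if h : ∃ j, x ∈ D.cube k j then h.choose else 0

variable {D}

lemma mem_cube_idx (hk : m ≤ k) (x : 𝔤) : x ∈ D.cube k (D.idx k x) := by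
  have h := D.exists_mem_cube hk x
  rw [idx, dif_pos h]
  exact h.choose_spec

lemma idx_eq (hk : m ≤ k) {x : 𝔤} {j : ℕ} (h : x ∈ D.cube k j) : D.idx k x = j :=
  eq_of_mem_cube hk (mem_cube_idx hk x) h

lemma measurable_idx (hk : m ≤ k) : Measurable (D.idx k) := by
  refine measurable_to_countable' fun j => ?_
  have : D.idx k ⁻¹' {j} = D.cube k j := by
    ext x
    simp only [mem_preimage, mem_singleton_iff]
    exact ⟨fun h => h ▸ mem_cube_idx hk x, fun h => idx_eq hk h⟩
  rw [this]
  exact D.measurableSet k hk j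

/-- Nestedness makes the generations a filtration: the small cube containing a point determines the
large one. -/
lemma idx_eq_idx (hk : m ≤ k) (hkl : k ≤ l) {x y : 𝔤} (h : D.idx k x = D.idx k y) :
    D.idx l x = D.idx l y := by
  rcases hkl.eq_or_lt with rfl | hkl
  · exact h
  have hx := mem_cube_idx (D := D) hk x
  have hxl := mem_cube_idx (D := D) (hk.trans hkl.le) x
  rcases D.nested k l hk hkl (D.idx l x) (D.idx k x) with hd | hs
  · exact absurd hxl (Set.disjoint_left.1 hd hx)
  · refine (idx_eq (hk.trans hkl.le) (hs ?_)).symm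
    rw [h]
    exact mem_cube_idx hk y

lemma lintegral_eq_tsum (hk : m ≤ k) (f : 𝔤 → ℝ≥0∞) :
    ∫⁻ x, f x = ∑' j, ∫⁻ x in D.cube k j, f x := by
  rw [← lintegral_iUnion (D.measurableSet k hk) (fun i j hij => D.disjoint k hk i j hij),
    D.iUnion_eq k hk, Measure.restrict_univ]

variable (D) in
/-- The measure of the neighbourhood of the cube `E^k_j` that contains `x`, over `8 ^ (k a)`. -/
def density (a : ℝ) (μ : Measure 𝔤) (k : ℤ) (x : 𝔤) : ℝ≥0∞ :=
  D.star μ k (D.idx k x) * eightPow (-(k * a))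

lemma measurable_density (hk : m ≤ k) (a : ℝ) (μ : Measure 𝔤) : Measurable (D.density a μ k) :=
  ((measurable_of_countable fun j => D.star μ k j).comp (measurable_idx hk)).mul_const _

lemma density_eq (hk : m ≤ k) (a : ℝ) (μ : Measure 𝔤) {x : 𝔤} {j : ℕ} (h : x ∈ D.cube k j) :
    D.density a μ k x = D.star μ k j * eightPow (-(k * a)) := by
  rw [density, idx_eq hk h]

/-- The subcubes of `E^l_j` carry total mass at most a constant times `star μ l j`, each has volume
comparable to `8 ^ (k M)`, and `8 ^ (k (M - a)) = 8 ^ (k ap)` produces the decay. -/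
lemma setLIntegral_density_le (hk : m ≤ k) (hkl : k ≤ l) {a ap : ℝ} (ha : a + ap = S.homDim)
    (μ : Measure 𝔤) (j : ℕ) :
    ∫⁻ x in D.cube l j, D.density a μ k x ≤
      8 ^ S.homDim * ((32 ^ S.homDim : ℕ) : ℝ≥0∞) * eightPow (-((l - k) * ap)) *
        (D.star μ l j * eightPow (-(l * a)) * volume (D.cube l j)) := by
  classical
  have hl := hk.trans hkl
  have h1 : ∫⁻ x in D.cube l j, D.density a μ k x =
      ∑' i, ∫⁻ x in D.cube l j ∩ D.cube k i, D.density a μ k x := by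
    rw [← lintegral_iUnion (fun i => (D.measurableSet l hl j).inter (D.measurableSet k hk i))
      (fun i i' h => (D.disjoint k hk i i' h).mono inter_subset_right inter_subset_right),
      ← inter_iUnion, D.iUnion_eq k hk, inter_univ]
  have h2 : ∀ i, ∫⁻ x in D.cube l j ∩ D.cube k i, D.density a μ k x ≤
      (8 ^ S.homDim * (eightPow (k * S.homDim) * S.ballVol) * eightPow (-(k * a))) *
        (if (D.cube k i ∩ D.cube l j).Nonempty then D.star μ k i else 0) := by
    intro i
    split_ifs with h
    · calc ∫⁻ x in D.cube l j ∩ D.cube k i, D.density a μ k x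
          = ∫⁻ _x in D.cube l j ∩ D.cube k i, D.star μ k i * eightPow (-(k * a)) :=
            setLIntegral_congr_fun ((D.measurableSet l hl j).inter (D.measurableSet k hk i))
              fun x hx => density_eq hk a μ hx.2
        _ = D.star μ k i * eightPow (-(k * a)) * volume (D.cube l j ∩ D.cube k i) :=
            setLIntegral_const _ _
        _ ≤ D.star μ k i * eightPow (-(k * a)) *
              (8 ^ S.homDim * (eightPow (k * S.homDim) * S.ballVol)) := by
            gcongr
            exact (measure_mono inter_subset_right).trans (D.volume_cube_le hk i)
        _ = _ := by ring
    · rw [inter_comm, not_nonempty_iff_eq_empty.1 h]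
      simp
  calc ∫⁻ x in D.cube l j, D.density a μ k x
      ≤ ∑' i, (8 ^ S.homDim * (eightPow (k * S.homDim) * S.ballVol) * eightPow (-(k * a))) *
        (if (D.cube k i ∩ D.cube l j).Nonempty then D.star μ k i else 0) :=
        h1.trans_le (ENNReal.tsum_le_tsum h2)
    _ ≤ (8 ^ S.homDim * (eightPow (k * S.homDim) * S.ballVol) * eightPow (-(k * a))) *
        (((32 ^ S.homDim : ℕ) : ℝ≥0∞) * D.star μ l j) := by
        rw [ENNReal.tsum_mul_left]
        gcongr
        exact tsum_star_le hk hkl μ j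
    _ = 8 ^ S.homDim * ((32 ^ S.homDim : ℕ) : ℝ≥0∞) * eightPow (-((l - k) * ap)) *
        (D.star μ l j * eightPow (-(l * a)) * (eightPow (l * S.homDim) * S.ballVol)) := by
        have : eightPow (k * S.homDim) * eightPow (-(k * a)) =
            eightPow (-((l - k) * ap)) * (eightPow (-(l * a)) * eightPow (l * S.homDim)) := by
          rw [← eightPow_add, ← eightPow_add, ← eightPow_add, ← ha]
          congr 1
          ring
        calc _ = 8 ^ S.homDim * ((32 ^ S.homDim : ℕ) : ℝ≥0∞) * S.ballVol * D.star μ l j *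
              (eightPow (k * S.homDim) * eightPow (-(k * a))) := by ring
          _ = _ := by rw [this]; ring
    _ ≤ _ := by
        gcongr
        exact D.le_volume_cube hl j

/-- The averages of powers of the density decay geometrically. -/
lemma setLIntegral_density_rpow_le (hk : m ≤ k) (hkl : k ≤ l) {a ap : ℝ} (ha : a + ap = S.homDim)
    (μ : Measure 𝔤) (j : ℕ) {τ : ℝ} (hτ : 0 < τ) (hτ1 : τ ≤ 1) :
    ∫⁻ x in D.cube l j, D.density a μ k x ^ τ ≤
      (8 ^ S.homDim * ((32 ^ S.homDim : ℕ) : ℝ≥0∞)) ^ τ * eightPow (-((l - k) * (ap * τ))) *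
        ((D.star μ l j * eightPow (-(l * a))) ^ τ * volume (D.cube l j)) := by
  have hl := hk.trans hkl
  -- Hölder's inequality against the constant `1`: for `τ ≤ 1` the average of a `τ`-th power is at
  -- most the `τ`-th power of the average.
  have h := ENNReal.lintegral_mul_norm_pow_le (μ := volume.restrict (D.cube l j))
    (f := D.density a μ k) (g := fun _ => 1) (measurable_density hk a μ).aemeasurable
    aemeasurable_const hτ.le (sub_nonneg.2 hτ1) (by ring)
  simp only [ENNReal.one_rpow, mul_one, lintegral_const, one_mul, Measure.restrict_apply_univ] at h
  refine h.trans ?_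
  calc _ ≤ (8 ^ S.homDim * ((32 ^ S.homDim : ℕ) : ℝ≥0∞) * eightPow (-((l - k) * ap)) *
        (D.star μ l j * eightPow (-(l * a)) * volume (D.cube l j))) ^ τ *
        volume (D.cube l j) ^ (1 - τ) := by
        gcongr
        exact setLIntegral_density_le hk hkl ha μ j
    _ = _ := by
        rw [ENNReal.mul_rpow_of_nonneg _ _ hτ.le, ENNReal.mul_rpow_of_nonneg _ _ hτ.le,
          ENNReal.mul_rpow_of_nonneg _ (volume (D.cube l j)) hτ.le, eightPow_rpow]
        have h1 : volume (D.cube l j) ^ τ * volume (D.cube l j) ^ (1 - τ) = volume (D.cube l j) := by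
          rw [← ENNReal.rpow_add _ _ (D.volume_cube_ne_zero hl j) (D.volume_cube_ne_top hl j)]
          simp
        conv_rhs => rw [← h1]
        rw [show -((l - k) * ap) * τ = -((l - k : ℝ) * (ap * τ)) by ring]
        ring

lemma lintegral_mul_density_rpow_le (hk : m ≤ k) (hkl : k ≤ l) {a ap : ℝ} (ha : a + ap = S.homDim)
    (μ : Measure 𝔤) {τ : ℝ} (hτ : 0 < τ) (hτ1 : τ ≤ 1) {f : 𝔤 → ℝ≥0∞}
    (hf : f.FactorsThrough (D.idx l)) :
    ∫⁻ x, f x * D.density a μ k x ^ τ ≤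
      (8 ^ S.homDim * ((32 ^ S.homDim : ℕ) : ℝ≥0∞)) ^ τ * eightPow (-((l - k) * (ap * τ))) *
        ∫⁻ x, f x * D.density a μ l x ^ τ := by
  have hl := hk.trans hkl
  have hfc : ∀ j, ∀ x ∈ D.cube l j, f x = f (D.center l j) := fun j x hx =>
    hf ((idx_eq hl hx).trans (idx_eq hl (D.center_mem_cube hl j)).symm)
  rw [lintegral_eq_tsum (D := D) hl, lintegral_eq_tsum (D := D) hl, ← ENNReal.tsum_mul_left]
  refine ENNReal.tsum_le_tsum fun j => ?_
  calc ∫⁻ x in D.cube l j, f x * D.density a μ k x ^ τ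
      = ∫⁻ x in D.cube l j, f (D.center l j) * D.density a μ k x ^ τ :=
        setLIntegral_congr_fun (D.measurableSet l hl j) fun x hx => by
          simp only [hfc j x hx]
    _ = f (D.center l j) * ∫⁻ x in D.cube l j, D.density a μ k x ^ τ :=
        lintegral_const_mul _ ((measurable_density hk a μ).pow_const _)
    _ ≤ f (D.center l j) *
        ((8 ^ S.homDim * ((32 ^ S.homDim : ℕ) : ℝ≥0∞)) ^ τ * eightPow (-((l - k) * (ap * τ))) *
          ((D.star μ l j * eightPow (-(l * a))) ^ τ * volume (D.cube l j))) := by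
        gcongr
        exact setLIntegral_density_rpow_le hk hkl ha μ j hτ hτ1
    _ = (8 ^ S.homDim * ((32 ^ S.homDim : ℕ) : ℝ≥0∞)) ^ τ * eightPow (-((l - k) * (ap * τ))) *
        ∫⁻ _x in D.cube l j, f (D.center l j) * (D.star μ l j * eightPow (-(l * a))) ^ τ := by
        rw [setLIntegral_const]; ring
    _ = _ := by
        congr 1
        refine setLIntegral_congr_fun (D.measurableSet l hl j) fun x hx => ?_
        simp only [hfc j x hx, density_eq hl a μ hx]

lemma factorsThrough_density (a : ℝ) (μ : Measure 𝔤) :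
    (D.density a μ k).FactorsThrough (D.idx k) := fun x y h => by
  simp only [density, h]

variable (S) in
/-- The constant in the inequality between a density and the densities at smaller scales. -/
def decayConst (ap τ : ℝ) : ℝ≥0∞ :=
  (8 ^ S.homDim * ((32 ^ S.homDim : ℕ) : ℝ≥0∞)) ^ τ * (1 - eightPow (-(ap * τ)))⁻¹

lemma decayConst_ne_top {ap τ : ℝ} (hap : 0 < ap) (hτ : 0 < τ) : decayConst S ap τ ≠ ⊤ := by
  refine ENNReal.mul_ne_top (ENNReal.rpow_ne_top_of_nonneg hτ.le (by finiteness)) ?_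
  rw [ENNReal.inv_ne_top]
  exact (tsub_pos_of_lt (eightPow_lt_one (neg_neg_of_pos (mul_pos hap hτ)))).ne'

lemma one_le_decayConst {ap τ : ℝ} (hτ : 0 < τ) : 1 ≤ decayConst S ap τ := by
  have h1 : (1 : ℝ≥0∞) ≤ 8 ^ S.homDim * ((32 ^ S.homDim : ℕ) : ℝ≥0∞) := by
    have : (1 : ℕ) ≤ 8 ^ S.homDim * 32 ^ S.homDim :=
      one_le_mul (Nat.one_le_pow _ _ (by norm_num)) (Nat.one_le_pow _ _ (by norm_num))
    exact_mod_cast this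
  exact one_le_mul (ENNReal.one_le_rpow h1 hτ) (ENNReal.one_le_inv.2 tsub_le_self)

/-- The geometric decay summed over all finer generations. This is the hypothesis `hH` of both
inequalities on adapted sequences; index `i` stands for generation `K - i`, so larger indices are
finer. -/
lemma lintegral_mul_sum_density_rpow_le {K : ℤ} {N : ℕ} (hN : ∀ i : ℕ, i < N → m ≤ K - i)
    {a ap : ℝ} (ha : a + ap = S.homDim) (μ : Measure 𝔤) {τ : ℝ} (hτ : 0 < τ)
    (hτ1 : τ ≤ 1) {i : ℕ} {f : 𝔤 → ℝ≥0∞} (hfm : Measurable f)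
    (hf : f.FactorsThrough (D.idx (K - i))) :
    ∫⁻ x, f x * ∑ j ∈ Finset.Ico i N, D.density a μ (K - j) x ^ τ ≤
      decayConst S ap τ * ∫⁻ x, f x * D.density a μ (K - i) x ^ τ := by
  have hIco : ∀ {j}, j ∈ Finset.Ico i N → i ≤ j ∧ j < N := fun h => Finset.mem_Ico.1 h
  simp only [Finset.mul_sum]
  rw [lintegral_finsetSum']
  swap
  · exact fun j hj => (hfm.mul ((measurable_density (hN j (hIco hj).2) a μ).pow_const _)).aemeasurable
  calc ∑ j ∈ Finset.Ico i N, ∫⁻ x, f x * D.density a μ (K - j) x ^ τ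
      ≤ ∑ j ∈ Finset.Ico i N, (8 ^ S.homDim * ((32 ^ S.homDim : ℕ) : ℝ≥0∞)) ^ τ *
          eightPow (-(ap * τ)) ^ (j - i) * ∫⁻ x, f x * D.density a μ (K - i) x ^ τ := by
        refine Finset.sum_le_sum fun j hj => ?_
        have hij := (hIco hj).1
        have := lintegral_mul_density_rpow_le (hN j (hIco hj).2)
          (show K - (j : ℤ) ≤ K - i by omega) ha μ hτ hτ1 hf
        refine this.trans_eq ?_
        congr 2
        rw [← ENNReal.rpow_natCast, eightPow_rpow]
        congr 1
        push_cast [Nat.cast_sub hij]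
        ring
    _ = (8 ^ S.homDim * ((32 ^ S.homDim : ℕ) : ℝ≥0∞)) ^ τ *
          (∑ j ∈ Finset.Ico i N, eightPow (-(ap * τ)) ^ (j - i)) *
          ∫⁻ x, f x * D.density a μ (K - i) x ^ τ := by
        rw [Finset.mul_sum, Finset.sum_mul]
    _ ≤ decayConst S ap τ * ∫⁻ x, f x * D.density a μ (K - i) x ^ τ := by
        rw [decayConst]
        gcongr
        rw [Finset.sum_Ico_eq_sum_range, ← ENNReal.tsum_geometric]
        simp only [add_tsub_cancel_left]
        exact ENNReal.sum_le_tsum _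

end DyadicFamily

end Stratification

end

noncomputable section

/-! ### Auxiliary inequalities for extended nonnegative reals -/

lemma ENNReal.inv_le_mul_inv {x y b : ℝ≥0∞} (hb0 : b ≠ 0) (hb : b ≠ ⊤) (h : x ≤ b * y) :
    y⁻¹ ≤ b * x⁻¹ := by
  have h1 : b⁻¹ * x ≤ y := by
    rw [mul_comm, ← div_eq_mul_inv]
    exact ENNReal.div_le_of_le_mul (by rwa [mul_comm])
  calc y⁻¹ ≤ (b⁻¹ * x)⁻¹ := ENNReal.inv_le_inv.2 h1
    _ = b * x⁻¹ := by
      rw [ENNReal.mul_inv (Or.inl (ENNReal.inv_ne_zero.2 hb)) (Or.inl (ENNReal.inv_ne_top.2 hb0)),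
        inv_inv]

/-- Powers of comparable numbers are comparable, whatever the sign of the exponent. -/
lemma ENNReal.rpow_le_mul_rpow_of_comparable {x y b : ℝ≥0∞} (hb1 : 1 ≤ b) (hb : b ≠ ⊤) (h1 : x ≤ y)
    (h2 : y ≤ b * x) (e : ℝ) : y ^ e ≤ b ^ |e| * x ^ e ∧ x ^ e ≤ b ^ |e| * y ^ e := by
  have hb0 : b ≠ 0 := (zero_lt_one.trans_le hb1).ne'
  have h3 : x ≤ b * y := h1.trans (le_mul_of_one_le_left' hb1)
  rcases le_or_gt 0 e with he | he
  · rw [abs_of_nonneg he, ← ENNReal.mul_rpow_of_nonneg _ _ he, ← ENNReal.mul_rpow_of_nonneg _ _ he]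
    exact ⟨ENNReal.rpow_le_rpow h2 he, ENNReal.rpow_le_rpow h3 he⟩
  · obtain ⟨f, rfl⟩ : ∃ f, e = -f := ⟨-e, by ring⟩
    have hf : 0 < f := by linarith
    have key : ∀ {u v : ℝ≥0∞}, u ≤ b * v → v ^ (-f) ≤ b ^ f * u ^ (-f) := fun {u v} h => by
      rw [ENNReal.rpow_neg, ENNReal.rpow_neg]
      refine ENNReal.inv_le_mul_inv (by simp [hb0, hb]) (ENNReal.rpow_ne_top_of_nonneg hf.le hb) ?_
      rw [← ENNReal.mul_rpow_of_nonneg _ _ hf.le]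
      exact ENNReal.rpow_le_rpow h hf.le
    rw [abs_neg, abs_of_pos hf]
    exact ⟨key h3, key h2⟩

lemma ENNReal.rpow_finsetSum_le_sum_rpow {ι : Type*} (s : Finset ι) (f : ι → ℝ≥0∞) {θ : ℝ}
    (h0 : 0 < θ) (h1 : θ ≤ 1) : (∑ i ∈ s, f i) ^ θ ≤ ∑ i ∈ s, f i ^ θ := by
  classical
  induction s using Finset.induction_on with
  | empty => simp [h0]
  | insert i s hi ih =>
    rw [Finset.sum_insert hi, Finset.sum_insert hi]
    exact (ENNReal.rpow_add_le_add_rpow _ _ h0.le h1).trans (by gcongr)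

lemma rpow_ofReal_comparable {k : ℤ} {t : ℝ} (h1 : (8 : ℝ) ^ k ≤ t) (h2 : t ≤ 8 ^ (k + 1)) (e : ℝ) :
    ENNReal.ofReal (t ^ e) ≤ eightPow (k * e + |e|) ∧
      eightPow (k * e - |e|) ≤ ENNReal.ofReal (t ^ e) := by
  have hk := zpow_pos_eight k
  have ht : 0 < t := hk.trans_le h1
  set u := Real.logb 8 t with hu
  have hut : t = 8 ^ u := (Real.rpow_logb (by norm_num) (by norm_num) ht).symm
  have hu1 : (k : ℝ) ≤ u := by
    rw [hut, ← Real.rpow_intCast] at h1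
    exact (Real.rpow_le_rpow_left_iff (by norm_num)).1 h1
  have hu2 : u ≤ k + 1 := by
    rw [hut, ← Real.rpow_intCast] at h2
    exact_mod_cast (Real.rpow_le_rpow_left_iff (by norm_num)).1 h2
  rw [hut, ← Real.rpow_mul (by norm_num), ofReal_rpow_eight]
  have h3 : |(u - k) * e| ≤ |e| := by
    rw [abs_mul]
    exact mul_le_of_le_one_left (abs_nonneg _) (by rw [abs_le]; constructor <;> linarith)
  have h4 := abs_le.1 h3
  constructor <;> apply eightPow_le <;> linarith

namespace Stratification

variable {𝔤 : Type*} [NormedLieRing 𝔤] [InnerLieAlgebra 𝔤] [FiniteDimensional ℝ 𝔤]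
  [MeasurableSpace 𝔤] [BorelSpace 𝔤] {S : Stratification 𝔤}

namespace DyadicFamily

variable {m : ℤ} (D : S.DyadicFamily m) {k l : ℤ}

/-! ### The contribution of one generation -/

/-- The contribution of the cubes of generation `k` to the dyadic sum, up to constants. -/
def levelSum (a β : ℝ) (μ : Measure 𝔤) (k : ℤ) : ℝ≥0∞ :=
  eightPow (k * (S.homDim - a * β)) * ∑' j, μ (D.cube k j) ^ β

variable {D}

lemma lintegral_density_rpow (hk : m ≤ k) (a : ℝ) {β : ℝ} (hβ : 0 ≤ β) (μ : Measure 𝔤) :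
    ∫⁻ x, D.density a μ k x ^ β =
      ∑' j, D.star μ k j ^ β * eightPow (-(k * a * β)) * volume (D.cube k j) := by
  rw [lintegral_eq_tsum (D := D) hk]
  refine tsum_congr fun j => ?_
  rw [setLIntegral_congr_fun (g := fun _ => (D.star μ k j * eightPow (-(k * a))) ^ β)
    (D.measurableSet k hk j) fun x hx => by simp only [density_eq hk a μ hx], setLIntegral_const,
    ENNReal.mul_rpow_of_nonneg _ _ hβ, eightPow_rpow]
  congr 3
  ring

lemma eightPow_mul_eightPow_homDim (S : Stratification 𝔤) (k a β : ℝ) :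
    eightPow (-(k * a * β)) * eightPow (k * S.homDim) = eightPow (k * (S.homDim - a * β)) := by
  rw [← eightPow_add]
  congr 1
  ring

lemma levelSum_le_lintegral (hk : m ≤ k) (a : ℝ) {β : ℝ} (hβ : 0 ≤ β) (μ : Measure 𝔤) :
    S.ballVol * D.levelSum a β μ k ≤ ∫⁻ x, D.density a μ k x ^ β := by
  rw [lintegral_density_rpow hk a hβ, levelSum, ← mul_assoc, ← ENNReal.tsum_mul_left]
  refine ENNReal.tsum_le_tsum fun j => ?_
  rw [← eightPow_mul_eightPow_homDim]
  calc _ = μ (D.cube k j) ^ β * eightPow (-(k * a * β)) *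
        (eightPow (k * S.homDim) * S.ballVol) := by ring
    _ ≤ _ := by
      gcongr
      · exact measure_cube_le_star hk μ j
      · exact D.le_volume_cube hk j

/-- Passing from neighbourhoods back to single cubes costs only bounded overlap, because `β ≥ 1`. -/
lemma lintegral_le_levelSum (hk : m ≤ k) (a : ℝ) {β : ℝ} (hβ : 1 ≤ β) (μ : Measure 𝔤) :
    ∫⁻ x, D.density a μ k x ^ β ≤
      8 ^ S.homDim * S.ballVol * ((32 ^ S.homDim : ℕ) : ℝ≥0∞) ^ β * D.levelSum a β μ k := by
  rw [lintegral_density_rpow hk a (by linarith), levelSum]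
  calc ∑' j, D.star μ k j ^ β * eightPow (-(k * a * β)) * volume (D.cube k j)
      ≤ ∑' j, (8 ^ S.homDim * S.ballVol * eightPow (k * (S.homDim - a * β))) *
          D.star μ k j ^ β := by
        refine ENNReal.tsum_le_tsum fun j => ?_
        rw [← eightPow_mul_eightPow_homDim]
        calc _ ≤ D.star μ k j ^ β * eightPow (-(k * a * β)) *
              (8 ^ S.homDim * (eightPow (k * S.homDim) * S.ballVol)) := by
              gcongr
              exact D.volume_cube_le hk j
          _ = _ := by ring
    _ ≤ (8 ^ S.homDim * S.ballVol * eightPow (k * (S.homDim - a * β))) *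
          (((32 ^ S.homDim : ℕ) : ℝ≥0∞) ^ β * ∑' j, μ (D.cube k j) ^ β) := by
        rw [ENNReal.tsum_mul_left]
        gcongr
        exact tsum_star_rpow_le hk μ hβ
    _ = _ := by ring

/-- Generations of comparable side lengths contribute comparable amounts, even for different
families. -/
lemma levelSum_le_levelSum {m' k' : ℤ} {D' : S.DyadicFamily m'} (hk : m ≤ k) (hk' : m' ≤ k')
    (h1 : k' ≤ k) (h2 : k ≤ k' + 3) (a : ℝ) {β : ℝ} (hβ : 1 ≤ β) (μ : Measure 𝔤) :
    D.levelSum a β μ k ≤ eightPow (3 * |S.homDim - a * β|) *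
      ((12288 ^ S.homDim : ℕ) : ℝ≥0∞) ^ β * D'.levelSum a β μ k' := by
  classical
  set R : ℕ → ℕ → Prop := fun j i => (D'.cube k' i ∩ D.cube k j).Nonempty with hR
  have hkk : (8 : ℝ) ^ k' ≤ 8 ^ k := zpow_le_zpow_right₀ (by norm_num) h1
  have hkk' : (8 : ℝ) ^ k ≤ 512 * 8 ^ k' := by
    calc (8 : ℝ) ^ k ≤ 8 ^ (k' + 3) := zpow_le_zpow_right₀ (by norm_num) h2
      _ = _ := by rw [zpow_add₀ (by norm_num)]; norm_num; ring
  have hpos := zpow_pos_eight k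
  have hpos' := zpow_pos_eight k'
  -- Two cubes of generation `k'` or `k` and one of the other stay within `24 * 8 ^ k ≤ 24 * 512 * 8
  -- ^ k'`, and `24 * 512 = 12288`.
  have hR1 : ∀ j, ∀ t : Finset ℕ, (∀ i ∈ t, R j i) → t.card ≤ 12288 ^ S.homDim := by
    intro j t ht
    refine D'.card_le hk' (n := 12288) (by norm_num) (z := D.center k j) fun i hi y hy => ?_
    obtain ⟨p, hp, hp'⟩ := ht i hi
    refine ccBall_mono _ ?_ (mem_ccBall_trans (mem_ccBall_trans (D.cube_subset_ccBall hk j hp')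
      (mem_ccBall_comm.1 (D'.cube_subset_ccBall hk' i hp))) (D'.cube_subset_ccBall hk' i hy))
    push_cast
    linarith
  have hR2 : ∀ i, ∀ t : Finset ℕ, (∀ j ∈ t, R j i) → t.card ≤ 12288 ^ S.homDim := by
    intro i t ht
    refine D.card_le hk (n := 12288) (by norm_num) (z := D'.center k' i) fun j hj y hy => ?_
    obtain ⟨p, hp, hp'⟩ := ht j hj
    refine ccBall_mono _ ?_ (mem_ccBall_trans (mem_ccBall_trans (D'.cube_subset_ccBall hk' i hp)
      (mem_ccBall_comm.1 (D.cube_subset_ccBall hk j hp'))) (D.cube_subset_ccBall hk j hy))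
    push_cast
    linarith
  have hcover : ∀ j, μ (D.cube k j) ≤ ∑' i, if R j i then μ (D'.cube k' i) else 0 := by
    intro j
    rw [tsum_ite_measure_cube hk']
    refine measure_mono fun y hy => ?_
    obtain ⟨i, hi⟩ := D'.exists_mem_cube hk' y
    refine mem_iUnion.2 ⟨i, ?_⟩
    rwa [if_pos ⟨y, hi, hy⟩]
  have hsum : ∑' j, μ (D.cube k j) ^ β ≤
      ((12288 ^ S.homDim : ℕ) : ℝ≥0∞) ^ β * ∑' i, μ (D'.cube k' i) ^ β :=
    (ENNReal.tsum_le_tsum fun j => ENNReal.rpow_le_rpow (hcover j) (by linarith)).trans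
      (tsum_tsum_ite_rpow_le hR1 hR2 _ hβ)
  have hweight : eightPow (k * (S.homDim - a * β)) ≤
      eightPow (3 * |S.homDim - a * β|) * eightPow (k' * (S.homDim - a * β)) := by
    rw [← eightPow_add]
    apply eightPow_le
    have h3 : ((k : ℝ) - k') * (S.homDim - a * β) ≤ 3 * |S.homDim - a * β| := by
      have e1 : (k' : ℝ) ≤ k := by exact_mod_cast h1
      have e2 : (k : ℝ) ≤ k' + 3 := by exact_mod_cast h2
      calc _ ≤ ((k : ℝ) - k') * |S.homDim - a * β| :=
            mul_le_mul_of_nonneg_left (le_abs_self _) (by linarith)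
        _ ≤ _ := mul_le_mul_of_nonneg_right (by linarith) (abs_nonneg _)
    linarith
  calc D.levelSum a β μ k ≤ (eightPow (3 * |S.homDim - a * β|) *
        eightPow (k' * (S.homDim - a * β))) *
        (((12288 ^ S.homDim : ℕ) : ℝ≥0∞) ^ β * ∑' i, μ (D'.cube k' i) ^ β) :=
      mul_le_mul' hweight hsum
    _ = _ := by rw [levelSum]; ring

end DyadicFamily

end Stratification

end

noncomputable section

namespace Stratification

variable {𝔤 : Type*} [NormedLieRing 𝔤] [InnerLieAlgebra 𝔤] [FiniteDimensional ℝ 𝔤]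
  [MeasurableSpace 𝔤] [BorelSpace 𝔤] {S : Stratification 𝔤}

namespace DyadicFamily

variable {m : ℤ} {D : S.DyadicFamily m} {k : ℤ}

/-! ### The dyadic sum as a sum over generations -/

/-- One term of the dyadic sum. -/
lemma dyadicTerm_comparable (hk : m ≤ k) (a : ℝ) {β : ℝ} (hβ : 0 ≤ β) (μ : Measure 𝔤) (j : ℕ) :
    (μ (D.cube k j) / volume (D.cube k j) ^ (a / S.homDim)) ^ β * volume (D.cube k j) ≤
        (8 ^ S.homDim) ^ |1 - a / S.homDim * β| * S.ballVol ^ (1 - a / S.homDim * β) *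
          (eightPow (k * (S.homDim - a * β)) * μ (D.cube k j) ^ β) ∧
      S.ballVol ^ (1 - a / S.homDim * β) *
          (eightPow (k * (S.homDim - a * β)) * μ (D.cube k j) ^ β) ≤
        (8 ^ S.homDim) ^ |1 - a / S.homDim * β| *
          ((μ (D.cube k j) / volume (D.cube k j) ^ (a / S.homDim)) ^ β * volume (D.cube k j)) := by
  have hM : (S.homDim : ℝ) ≠ 0 := by exact_mod_cast S.homDim_pos.ne'
  have hV0 := D.volume_cube_ne_zero hk j
  have hV := D.volume_cube_ne_top hk j
  -- The total exponent of `|Q|`. Its sign is arbitrary, so both bounds on the volume of a cube are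
  -- needed.
  set e : ℝ := 1 - a / S.homDim * β with he
  have h1 : (μ (D.cube k j) / volume (D.cube k j) ^ (a / S.homDim)) ^ β * volume (D.cube k j) =
      volume (D.cube k j) ^ e * μ (D.cube k j) ^ β := by
    rw [div_eq_mul_inv, ENNReal.mul_rpow_of_nonneg _ _ hβ, ← ENNReal.rpow_neg, ← ENNReal.rpow_mul,
      mul_assoc, mul_comm, he, sub_eq_add_neg, add_comm, ENNReal.rpow_add _ _ hV0 hV,
      ENNReal.rpow_one, neg_mul]
  have h2 : (eightPow (k * S.homDim) * S.ballVol) ^ e =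
      S.ballVol ^ e * eightPow (k * (S.homDim - a * β)) := by
    rw [ENNReal.mul_rpow_of_ne_top (eightPow_ne_top _) ballVol_ne_top, eightPow_rpow, mul_comm]
    congr 2
    rw [he]
    field_simp
  obtain ⟨h3, h4⟩ := ENNReal.rpow_le_mul_rpow_of_comparable
    (one_le_pow₀ (by norm_num) : (1 : ℝ≥0∞) ≤ 8 ^ S.homDim) (by finiteness)
    (D.le_volume_cube hk j) (D.volume_cube_le hk j) e
  rw [h1]
  rw [h2] at h3 h4
  constructor
  · calc _ ≤ _ := mul_le_mul_left h3 _
      _ = _ := by ring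
  · calc _ = S.ballVol ^ e * eightPow (k * (S.homDim - a * β)) * μ (D.cube k j) ^ β := by ring
      _ ≤ _ := mul_le_mul_left h4 _
      _ = _ := by ring

/-- Generations are counted downwards from the largest `k` with `8 ^ k ≤ r`; there are none if `m`
exceeds it. -/
lemma tsum_generation_eq {r : ℝ} (hr : 0 < r) (F : ℤ → ℝ≥0∞) :
    ∑' k : {k : ℤ // m ≤ k ∧ (8 : ℝ) ^ k ≤ r}, F k =
      ∑ i ∈ Finset.range (Int.log 8 r - m + 1).toNat, F (Int.log 8 r - i) := by
  have h8 : ∀ k : ℤ, (8 : ℝ) ^ k ≤ r ↔ k ≤ Int.log 8 r := fun k => by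
    have := Int.zpow_le_iff_le_log (b := 8) (x := k) (by norm_num) hr
    exact_mod_cast this
  rw [← Finset.sum_image (f := F) (g := fun i : ℕ => Int.log 8 r - i)
    fun i _ j _ h => by simpa using h, ← Finset.tsum_subtype]
  refine tsum_congr_set_coe F ?_
  ext k
  simp only [Finset.coe_image, mem_image, Finset.mem_coe, Finset.mem_range]
  change m ≤ k ∧ (8 : ℝ) ^ k ≤ r ↔ _
  rw [h8]
  constructor
  · rintro ⟨h1, h2⟩
    exact ⟨(Int.log 8 r - k).toNat, by omega, by omega⟩
  · rintro ⟨i, hi, rfl⟩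
    omega

/-- The generations of side length at most `r`. -/
def numGen (m : ℤ) (r : ℝ) : ℕ := (Int.log 8 r - m + 1).toNat

lemma le_of_lt_numGen {r : ℝ} {i : ℕ} (hi : i < numGen m r) : m ≤ Int.log 8 r - i := by
  rw [numGen] at hi
  omega

variable (S) in
/-- The constant in the comparison of the dyadic sum with the sum of the level sums. -/
def dyadicConst (a β : ℝ) : ℝ≥0∞ := (8 ^ S.homDim) ^ |1 - a / S.homDim * β|

lemma dyadicSum_eq (α p q : ℝ) {r : ℝ} (hr : 0 < r) (μ : Measure 𝔤) :
    S.dyadicSum D α p q r μ = ∑ i ∈ Finset.range (numGen m r),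
      ∑' j, (μ (D.cube (Int.log 8 r - i) j) / volume (D.cube (Int.log 8 r - i) j) ^
        ((S.homDim - α * p) / S.homDim)) ^ (q / (p - 1)) * volume (D.cube (Int.log 8 r - i) j) := by
  have hM : (S.homDim : ℝ) ≠ 0 := by exact_mod_cast S.homDim_pos.ne'
  rw [numGen, ← tsum_generation_eq hr fun k => ∑' j, (μ (D.cube k j) / volume (D.cube k j) ^
    ((S.homDim - α * p) / S.homDim)) ^ (q / (p - 1)) * volume (D.cube k j), dyadicSum, sub_div,
    div_self hM]

lemma dyadicSum_le {α p q : ℝ} (hβ : 0 ≤ q / (p - 1)) {r : ℝ} (hr : 0 < r) (μ : Measure 𝔤) :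
    S.dyadicSum D α p q r μ ≤ dyadicConst S (S.homDim - α * p) (q / (p - 1)) *
      S.ballVol ^ (1 - (S.homDim - α * p) / S.homDim * (q / (p - 1))) *
      ∑ i ∈ Finset.range (numGen m r),
        D.levelSum (S.homDim - α * p) (q / (p - 1)) μ (Int.log 8 r - i) := by
  rw [dyadicSum_eq α p q hr, Finset.mul_sum]
  refine Finset.sum_le_sum fun i hi => ?_
  rw [levelSum, ← ENNReal.tsum_mul_left, ← ENNReal.tsum_mul_left]
  exact ENNReal.tsum_le_tsum fun j =>
    (dyadicTerm_comparable (le_of_lt_numGen (Finset.mem_range.1 hi)) _ hβ μ j).1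

lemma sum_levelSum_le {α p q : ℝ} (hβ : 0 ≤ q / (p - 1)) {r : ℝ} (hr : 0 < r) (μ : Measure 𝔤) :
    S.ballVol ^ (1 - (S.homDim - α * p) / S.homDim * (q / (p - 1))) *
      ∑ i ∈ Finset.range (numGen m r),
        D.levelSum (S.homDim - α * p) (q / (p - 1)) μ (Int.log 8 r - i) ≤
      dyadicConst S (S.homDim - α * p) (q / (p - 1)) * S.dyadicSum D α p q r μ := by
  rw [dyadicSum_eq α p q hr, Finset.mul_sum, Finset.mul_sum]
  refine Finset.sum_le_sum fun i hi => ?_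
  rw [levelSum, ← ENNReal.tsum_mul_left, ← ENNReal.tsum_mul_left, ← ENNReal.tsum_mul_left]
  exact ENNReal.tsum_le_tsum fun j =>
    (dyadicTerm_comparable (le_of_lt_numGen (Finset.mem_range.1 hi)) _ hβ μ j).2

/-! ### The potential and the densities -/

/-- The integrand of the Wolff potential. -/
def wolffIntegrand (S : Stratification 𝔤) (a s : ℝ) (μ : Measure 𝔤) (x : 𝔤) (t : ℝ) : ℝ≥0∞ :=
  (μ (S.ccBall x t) / ENNReal.ofReal (t ^ a)) ^ s * ENNReal.ofReal t⁻¹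

/-- The ball `B_t(x)` lies within `(8 + 8) * 8 ^ k` of the center of the cube containing `x`, hence
inside the neighbourhood measured by `star`. -/
lemma wolffIntegrand_le (hk : m ≤ k) (a : ℝ) {s : ℝ} (hs : 0 < s) (μ : Measure 𝔤) (x : 𝔤) {t : ℝ}
    (ht : t ∈ Ico ((8 : ℝ) ^ k) (8 ^ (k + 1))) :
    wolffIntegrand S a s μ x t ≤
      eightPow (|a| * s) * D.density a μ k x ^ s * ENNReal.ofReal ((8 : ℝ) ^ k)⁻¹ := by
  have hpos := zpow_pos_eight k
  have hball : μ (S.ccBall x t) ≤ D.star μ k (D.idx k x) := by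
    refine (measure_mono fun y hy => ?_).trans (measure_ccBall_le_star hk μ _)
    have h8 : t < 8 * 8 ^ k := by
      have := ht.2
      rwa [zpow_add_one₀ (by norm_num), mul_comm] at this
    exact ccBall_mono _ (by linarith)
      (mem_ccBall_trans (D.cube_subset_ccBall hk _ (mem_cube_idx hk x)) hy)
  have hpow := (rpow_ofReal_comparable ht.1 ht.2.le a).2
  rw [wolffIntegrand, density, ← eightPow_rpow, ← ENNReal.mul_rpow_of_nonneg _ _ hs.le]
  gcongr
  · calc μ (S.ccBall x t) / ENNReal.ofReal (t ^ a)
        ≤ D.star μ k (D.idx k x) / eightPow (k * a - |a|) := ENNReal.div_le_div hball hpow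
      _ = _ := by
        rw [div_eq_mul_inv, ← eightPow_neg, show -((k : ℝ) * a - |a|) = |a| + -(k * a) by ring,
          eightPow_add]
        ring
  · exact ht.1

/-- Here `t > 64 * 8 ^ k`, more than the `(8 + 32) * 8 ^ k` needed for `B_t(x)` to contain the whole
neighbourhood of the cube. -/
lemma le_wolffIntegrand (hk : m ≤ k) (a : ℝ) {s : ℝ} (hs : 0 < s) (μ : Measure 𝔤) (x : 𝔤) {t : ℝ}
    (ht : t ∈ Ioo ((8 : ℝ) ^ (k + 2)) (8 ^ (k + 3))) :
    D.density a μ k x ^ s * ENNReal.ofReal ((8 : ℝ) ^ (k + 3))⁻¹ ≤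
      eightPow ((2 * a + |a|) * s) * wolffIntegrand S a s μ x t := by
  have hpos := zpow_pos_eight k
  have hball : D.star μ k (D.idx k x) ≤ μ (S.ccBall x t) := by
    refine (star_le_measure_ccBall hk μ _).trans (measure_mono fun y hy => ?_)
    have h8 : 64 * 8 ^ k < t := by
      have := ht.1
      rw [zpow_add₀ (by norm_num)] at this
      norm_num at this
      linarith
    exact ccBall_mono _ (by linarith)
      (mem_ccBall_trans (mem_ccBall_comm.1 (D.cube_subset_ccBall hk _ (mem_cube_idx hk x))) hy)
  have ht0 : 0 < t := (zpow_pos_eight _).trans ht.1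
  have hpow := (rpow_ofReal_comparable (k := k + 2) ht.1.le
    (by rw [show k + 2 + 1 = k + 3 by ring]; exact ht.2.le) a).1
  rw [wolffIntegrand, density, ← eightPow_rpow, ← mul_assoc,
    ← ENNReal.mul_rpow_of_nonneg _ _ hs.le]
  gcongr ?_ ^ _ * ENNReal.ofReal ?_⁻¹
  · calc D.star μ k (D.idx k x) * eightPow (-(k * a))
        = eightPow (2 * a + |a|) * (D.star μ k (D.idx k x) /
            eightPow ((k + 2 : ℤ) * a + |a|)) := by
          rw [div_eq_mul_inv, ← eightPow_neg, mul_left_comm, ← eightPow_add]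
          congr 2
          push_cast
          ring
      _ ≤ _ := by gcongr
  · exact ht.2.le

lemma setLIntegral_wolffIntegrand_le (hk : m ≤ k) (a : ℝ) {s : ℝ} (hs : 0 < s) (μ : Measure 𝔤)
    (x : 𝔤) :
    ∫⁻ t in Ico ((8 : ℝ) ^ k) (8 ^ (k + 1)), wolffIntegrand S a s μ x t ≤
      7 * eightPow (|a| * s) * D.density a μ k x ^ s := by
  have hpos := zpow_pos_eight k
  refine (setLIntegral_mono' measurableSet_Ico fun t ht =>
    wolffIntegrand_le (D := D) hk a hs μ x ht).trans ?_
  rw [setLIntegral_const, Real.volume_Ico, zpow_add_one₀ (by norm_num), mul_assoc,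
    ← ENNReal.ofReal_mul (by positivity),
    show ((8 : ℝ) ^ k)⁻¹ * (8 ^ k * 8 - 8 ^ k) = 7 by field_simp; norm_num]
  norm_num
  rw [mul_comm, mul_assoc]

/-- Only the scales between `8 ^ (k + 2)` and `8 ^ (k + 3)` of the potential are kept, whence the
condition on `r`; they have weight at least `7 / 8`, which the factor `2` absorbs. -/
lemma density_rpow_le_wolffPotential (hk : m ≤ k) {α p r : ℝ} (hp : 1 < p) (μ : Measure 𝔤) (x : 𝔤)
    (hr : (8 : ℝ) ^ (k + 3) ≤ r) :
    D.density (S.homDim - α * p) μ k x ^ (1 / (p - 1)) ≤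
      2 * eightPow ((2 * (S.homDim - α * p) + |S.homDim - α * p|) * (1 / (p - 1))) *
        S.wolffPotential α p r μ x := by
  have hs : 0 < 1 / (p - 1) := one_div_pos.2 (by linarith)
  have hpos := zpow_pos_eight k
  have h1 := setLIntegral_mono' (μ := volume) measurableSet_Ioo fun t ht =>
    le_wolffIntegrand (D := D) hk (S.homDim - α * p) hs μ x ht
  rw [setLIntegral_const, Real.volume_Ioo, mul_assoc, ← ENNReal.ofReal_mul (by positivity),
    zpow_add₀ (by norm_num), zpow_add₀ (by norm_num),
    show ((8 : ℝ) ^ k * 8 ^ (3 : ℤ))⁻¹ * (8 ^ k * 8 ^ (3 : ℤ) - 8 ^ k * 8 ^ (2 : ℤ)) = 7 / 8 by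
      field_simp; norm_num, lintegral_const_mul' _ _ (eightPow_ne_top _)] at h1
  have h2 : (1 : ℝ≥0∞) ≤ 2 * ENNReal.ofReal (7 / 8) := by
    rw [← ENNReal.ofReal_ofNat 2, ← ENNReal.ofReal_mul (by norm_num), ENNReal.one_le_ofReal]
    norm_num
  calc D.density (S.homDim - α * p) μ k x ^ (1 / (p - 1))
      ≤ D.density (S.homDim - α * p) μ k x ^ (1 / (p - 1)) * (2 * ENNReal.ofReal (7 / 8)) :=
        le_mul_of_one_le_right' h2
    _ = 2 * (D.density (S.homDim - α * p) μ k x ^ (1 / (p - 1)) * ENNReal.ofReal (7 / 8)) := by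
        ring
    _ ≤ 2 * _ := by gcongr 2 * ?_
    _ ≤ _ := by
        rw [mul_assoc]
        gcongr
        refine lintegral_mono_set fun t ht => ⟨(mul_pos hpos (by norm_num)).trans ht.1, ?_⟩
        rw [zpow_add₀ (by norm_num)] at hr
        exact ht.2.trans_le hr

end DyadicFamily

end Stratification

end

noncomputable section

namespace Stratification

variable {𝔤 : Type*} [NormedLieRing 𝔤] [InnerLieAlgebra 𝔤] [FiniteDimensional ℝ 𝔤]
  [MeasurableSpace 𝔤] [BorelSpace 𝔤] {S : Stratification 𝔤}

namespace DyadicFamily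

variable {m : ℤ} {D : S.DyadicFamily m} {K : ℤ} {N : ℕ} {α p q : ℝ}

lemma idx_sub_eq (hN : ∀ i : ℕ, i < N → m ≤ K - i) (i j : ℕ) (hij : i ≤ j) (hj : j < N)
    (x y : 𝔤) (h : D.idx (K - j) x = D.idx (K - j) y) : D.idx (K - i) x = D.idx (K - i) y :=
  idx_eq_idx (hN j hj) (by omega) h

/-! ### Lower bound -/

variable (S) in
/-- The constant in the lower bound for the norm of the potential. -/
def lowerConst (α p q : ℝ) : ℝ≥0∞ :=
  decayConst S (α * p) 1 *
    (2 * eightPow ((2 * (S.homDim - α * p) + |S.homDim - α * p|) * (1 / (p - 1)))) ^ q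

lemma lowerConst_ne_top (hα : 0 < α) (hp : 1 < p) (hq : p - 1 < q) : lowerConst S α p q ≠ ⊤ :=
  ENNReal.mul_ne_top (decayConst_ne_top (mul_pos hα (by linarith)) one_pos)
    (ENNReal.rpow_ne_top_of_nonneg (by linarith)
      (ENNReal.mul_ne_top (by norm_num) (eightPow_ne_top _)))

/-- The core of the lower bound: level sums are integrals of densities, their sum is controlled by
the supremum of the densities since `β > 1`, and the supremum is pointwise below the potential. -/
lemma sum_levelSum_le_lintegral (hp : 1 < p) (hq : p - 1 < q) {r : ℝ}
    (hN : ∀ i : ℕ, i < N → m ≤ K - i) (hr : (8 : ℝ) ^ (K + 3) ≤ r) (μ : Measure 𝔤) :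
    S.ballVol * ∑ i ∈ Finset.range N, D.levelSum (S.homDim - α * p) (q / (p - 1)) μ (K - i) ≤
      lowerConst S α p q * ∫⁻ x, S.wolffPotential α p r μ x ^ q := by
  have hp0 : 0 < p - 1 := by linarith
  have hβ : 1 < q / (p - 1) := (one_lt_div hp0).2 hq
  have hq0 : 0 < q := by linarith
  set A : ℝ≥0∞ :=
    2 * eightPow ((2 * (S.homDim - α * p) + |S.homDim - α * p|) * (1 / (p - 1))) with hA
  have hAtop : A ≠ ⊤ := ENNReal.mul_ne_top (by norm_num) (eightPow_ne_top _)
  have hsup : ∀ x, ((Finset.range N).sup fun i : ℕ =>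
      D.density (S.homDim - α * p) μ (K - i) x) ^ (q / (p - 1)) ≤
        A ^ q * S.wolffPotential α p r μ x ^ q := by
    intro x
    have h1 : ((Finset.range N).sup fun i : ℕ => D.density (S.homDim - α * p) μ (K - i) x) ≤
        (A * S.wolffPotential α p r μ x) ^ (p - 1) := by
      refine Finset.sup_le fun i hi => ?_
      have h2 := density_rpow_le_wolffPotential (D := D) (hN i (Finset.mem_range.1 hi)) (α := α) hp
        μ x ((zpow_le_zpow_right₀ (by norm_num) (by omega)).trans hr)
      have h3 := ENNReal.rpow_le_rpow h2 hp0.le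
      rwa [← ENNReal.rpow_mul, one_div_mul_cancel hp0.ne', ENNReal.rpow_one] at h3
    calc _ ≤ ((A * S.wolffPotential α p r μ x) ^ (p - 1)) ^ (q / (p - 1)) :=
          ENNReal.rpow_le_rpow h1 (by linarith)
      _ = _ := by
          rw [← ENNReal.rpow_mul, mul_div_cancel₀ _ hp0.ne', ENNReal.mul_rpow_of_nonneg _ _ hq0.le]
  calc S.ballVol * ∑ i ∈ Finset.range N, D.levelSum (S.homDim - α * p) (q / (p - 1)) μ (K - i)
      ≤ ∑ i ∈ Finset.range N,
          ∫⁻ x, D.density (S.homDim - α * p) μ (K - i) x ^ (q / (p - 1)) := by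
        rw [Finset.mul_sum]
        exact Finset.sum_le_sum fun i hi =>
          levelSum_le_lintegral (hN i (Finset.mem_range.1 hi)) _ (by linarith) μ
    _ ≤ decayConst S (α * p) 1 * ∫⁻ x, ((Finset.range N).sup fun i : ℕ =>
          D.density (S.homDim - α * p) μ (K - i) x) ^ (q / (p - 1)) := by
        refine sum_lintegral_rpow_le (J := fun i => D.idx (K - i)) (idx_sub_eq hN)
          (fun i hi => measurable_density (hN i hi) _ μ) (fun i _ => factorsThrough_density _ μ)
          (fun i _ f hfm hf => ?_) hβ
        have := lintegral_mul_sum_density_rpow_le (ap := α * p) hN (sub_add_cancel _ _) μ one_pos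
          le_rfl hfm hf
        simpa only [ENNReal.rpow_one] using this
    _ ≤ decayConst S (α * p) 1 * ∫⁻ x, A ^ q * S.wolffPotential α p r μ x ^ q := by
        gcongr with x
        exact hsup x
    _ = _ := by
        rw [lintegral_const_mul' _ _ (ENNReal.rpow_ne_top_of_nonneg hq0.le hAtop), ← mul_assoc,
          lowerConst]

variable (S) in
/-- The constant comparing the contributions of the last generations. -/
def shiftConst (a β : ℝ) : ℝ≥0∞ :=
  eightPow (3 * |S.homDim - a * β|) * ((12288 ^ S.homDim : ℕ) : ℝ≥0∞) ^ β

lemma shiftConst_ne_top {a β : ℝ} (hβ : 0 ≤ β) : shiftConst S a β ≠ ⊤ :=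
  ENNReal.mul_ne_top (eightPow_ne_top _) (ENNReal.rpow_ne_top_of_nonneg hβ (by finiteness))

/-- The three largest generations are too close to `r` for the pointwise bound, so they are compared
with generation `Int.log 8 r - 3`. When `m` is large, `D` has no such generation, hence the
auxiliary family `D'`. -/
theorem dyadicSum_le_lintegral (hp : 1 < p) (hq : p - 1 < q) {r : ℝ} (hr : 0 < r)
    (D' : S.DyadicFamily (Int.log 8 r - 3)) (μ : Measure 𝔤) :
    S.ballVol * ∑ i ∈ Finset.range (numGen m r),
      D.levelSum (S.homDim - α * p) (q / (p - 1)) μ (Int.log 8 r - i) ≤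
      (3 * shiftConst S (S.homDim - α * p) (q / (p - 1)) + 1) *
        (lowerConst S α p q * ∫⁻ x, S.wolffPotential α p r μ x ^ q) := by
  have hp0 : 0 < p - 1 := by linarith
  have hβ : 1 < q / (p - 1) := (one_lt_div hp0).2 hq
  set K := Int.log 8 r with hK
  set n := numGen m r with hn
  set I := lowerConst S α p q * ∫⁻ x, S.wolffPotential α p r μ x ^ q with hI
  set F : ℕ → ℝ≥0∞ := fun i => D.levelSum (S.homDim - α * p) (q / (p - 1)) μ (K - i) with hF
  have hmn : ∀ i : ℕ, i < n → m ≤ K - i := fun i hi => le_of_lt_numGen hi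
  have hr3 : (8 : ℝ) ^ (K - 3 + 3) ≤ r := by
    rw [sub_add_cancel]
    exact_mod_cast Int.zpow_log_le_self (b := 8) (by norm_num) hr
  have h1 : ∀ i ∈ Finset.range (min n 3), S.ballVol * F i ≤
      shiftConst S (S.homDim - α * p) (q / (p - 1)) * I := by
    intro i hi
    have hi' := Finset.mem_range.1 hi
    have h2 := levelSum_le_levelSum (D := D) (D' := D') (k := K - i) (k' := K - 3)
      (hmn i (by omega)) le_rfl (by omega) (by omega) (S.homDim - α * p) hβ.le μ
    have h3 := sum_levelSum_le_lintegral (D := D') (K := K - 3) (N := 1) (α := α) hp hq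
      (fun i hi => by omega) hr3 μ
    simp only [Finset.sum_range_one, Nat.cast_zero, sub_zero] at h3
    calc S.ballVol * F i ≤ S.ballVol * (shiftConst S (S.homDim - α * p) (q / (p - 1)) *
          D'.levelSum (S.homDim - α * p) (q / (p - 1)) μ (K - 3)) := by gcongr; exact h2
      _ = shiftConst S (S.homDim - α * p) (q / (p - 1)) * (S.ballVol *
          D'.levelSum (S.homDim - α * p) (q / (p - 1)) μ (K - 3)) := by ring
      _ ≤ _ := by gcongr
  have h4 : S.ballVol * ∑ i ∈ Finset.range (n - 3), F (min n 3 + i) ≤ I := by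
    refine le_trans (le_of_eq ?_) (sum_levelSum_le_lintegral (D := D) (K := K - 3) (N := n - 3)
      (α := α) hp hq (fun i hi => ?_) hr3 μ)
    · congr 1
      refine Finset.sum_congr rfl fun i hi => ?_
      have := Finset.mem_range.1 hi
      simp only [hF]
      rw [show K - ((min n 3 + i : ℕ) : ℤ) = K - 3 - i by omega]
    · have := hmn (i + 3) (by omega)
      push_cast at this
      omega
  calc S.ballVol * ∑ i ∈ Finset.range n, F i
      = S.ballVol * ∑ i ∈ Finset.range (min n 3), F i +
          S.ballVol * ∑ i ∈ Finset.range (n - 3), F (min n 3 + i) := by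
        rw [← mul_add, ← Finset.sum_range_add, show min n 3 + (n - 3) = n by omega]
    _ ≤ 3 * (shiftConst S (S.homDim - α * p) (q / (p - 1)) * I) + I := by
        refine add_le_add ?_ h4
        rw [Finset.mul_sum]
        refine (Finset.sum_le_card_nsmul _ _ _ h1).trans ?_
        rw [nsmul_eq_mul, Finset.card_range]
        gcongr
        exact_mod_cast min_le_right n 3
    _ = _ := by ring

/-! ### Upper bound -/

variable (D) in
/-- The sum of the densities over the generations of side length at most `r`. -/
def densitySum (a s : ℝ) (μ : Measure 𝔤) (r : ℝ) (x : 𝔤) : ℝ≥0∞ :=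
  ∑ i ∈ Finset.range (numGen m r), D.density a μ (Int.log 8 r - i) x ^ s

lemma measurable_densitySum (a s : ℝ) (μ : Measure 𝔤) (r : ℝ) :
    Measurable (D.densitySum a s μ r) :=
  Finset.measurable_fun_sum _ fun _ hi =>
    (measurable_density (le_of_lt_numGen (Finset.mem_range.1 hi)) a μ).pow_const s

lemma setLIntegral_wolffIntegrand_le_densitySum (a : ℝ) {s : ℝ} (hs : 0 < s) (μ : Measure 𝔤)
    {r : ℝ} (x : 𝔤) :
    ∫⁻ t in Ioo ((8 : ℝ) ^ m) r, wolffIntegrand S a s μ x t ≤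
      7 * eightPow (|a| * s) * D.densitySum a s μ r x := by
  set K := Int.log 8 r with hK
  set n := numGen m r with hn
  have hsub : Ioo ((8 : ℝ) ^ m) r ⊆
      ⋃ i : Fin n, Ico ((8 : ℝ) ^ (K - (i : ℕ))) (8 ^ (K - (i : ℕ) + 1)) := by
    intro t ht
    have ht0 : 0 < t := (zpow_pos_eight m).trans ht.1
    have h1 : m ≤ Int.log 8 t :=
      (Int.zpow_le_iff_le_log (b := 8) (by norm_num) ht0).1 (by exact_mod_cast ht.1.le)
    have h2 : Int.log 8 t ≤ K := Int.log_mono_right ht0 ht.2.le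
    have h3 : (8 : ℝ) ^ Int.log 8 t ≤ t := by
      exact_mod_cast Int.zpow_log_le_self (b := 8) (by norm_num) ht0
    have h4 : t < (8 : ℝ) ^ (Int.log 8 t + 1) := by
      exact_mod_cast Int.lt_zpow_succ_log_self (b := 8) (by norm_num) t
    refine mem_iUnion.2 ⟨⟨(K - Int.log 8 t).toNat, by rw [hn, numGen]; omega⟩, ?_⟩
    rw [show K - (((K - Int.log 8 t).toNat : ℕ) : ℤ) = Int.log 8 t by omega]
    exact ⟨h3, h4⟩
  calc ∫⁻ t in Ioo ((8 : ℝ) ^ m) r, wolffIntegrand S a s μ x t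
      ≤ ∑' i : Fin n, ∫⁻ t in Ico ((8 : ℝ) ^ (K - (i : ℕ))) (8 ^ (K - (i : ℕ) + 1)),
          wolffIntegrand S a s μ x t :=
        (lintegral_mono_set hsub).trans (lintegral_iUnion_le _ _)
    _ ≤ ∑' i : Fin n, 7 * eightPow (|a| * s) * D.density a μ (K - (i : ℕ)) x ^ s :=
        ENNReal.tsum_le_tsum fun i =>
          setLIntegral_wolffIntegrand_le (le_of_lt_numGen i.2) a hs μ x
    _ = _ := by
        rw [ENNReal.tsum_mul_left, tsum_fintype,
          Fin.sum_univ_eq_sum_range (fun i : ℕ => D.density a μ (K - i) x ^ s), densitySum]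

variable (S) in
/-- The constant in the bound for the norm of the sum of the densities. -/
def sumConst (ap β : ℝ) (n : ℕ) : ℝ≥0∞ :=
  (n + 2) * (2 * ((n + 1) * decayConst S ap (β / (n + 2)) *
    (2 * ((n + 1) * decayConst S ap (β / (n + 2)))) ^ n)) *
      (8 ^ S.homDim * S.ballVol * ((32 ^ S.homDim : ℕ) : ℝ≥0∞) ^ β)

lemma sumConst_ne_top {ap β : ℝ} (hap : 0 < ap) (hβ : 0 < β) (n : ℕ) : sumConst S ap β n ≠ ⊤ := by
  have h1 : decayConst S ap (β / (n + 2)) ≠ ⊤ := decayConst_ne_top hap (by positivity)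
  have h2 : ((32 ^ S.homDim : ℕ) : ℝ≥0∞) ^ β ≠ ⊤ :=
    ENNReal.rpow_ne_top_of_nonneg hβ.le (by finiteness)
  have h3 : S.ballVol ≠ ⊤ := ballVol_ne_top
  rw [sumConst]
  finiteness

/-- The integer exponent `n + 2` replaces `q`: as `q / (n + 2) ≤ 1`, that power of the sum is at
most the sum of the powers, which are the densities to the power `τ`. As `τ ≤ 1`, their averages
decay. -/
lemma lintegral_densitySum_rpow_le (hα : 0 < α) (hp : 1 < p) (hq : p - 1 < q) {n : ℕ}
    (hn1 : q ≤ n + 2) (hn2 : q / (p - 1) ≤ n + 2) (r : ℝ) (μ : Measure 𝔤) :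
    ∫⁻ x, D.densitySum (S.homDim - α * p) (1 / (p - 1)) μ r x ^ q ≤
      sumConst S (α * p) (q / (p - 1)) n * ∑ i ∈ Finset.range (numGen m r),
        D.levelSum (S.homDim - α * p) (q / (p - 1)) μ (Int.log 8 r - i) := by
  have hp0 : 0 < p - 1 := by linarith
  have hq0 : 0 < q := by linarith
  have hβ : 1 < q / (p - 1) := (one_lt_div hp0).2 hq
  have hn0 : (0 : ℝ) < n + 2 := by positivity
  have hap : 0 < α * p := mul_pos hα (by linarith)
  set τ : ℝ := q / (p - 1) / (n + 2) with hτ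
  have hτ0 : 0 < τ := by positivity
  have hτ1 : τ ≤ 1 := (div_le_one hn0).2 hn2
  set b : ℕ → 𝔤 → ℝ≥0∞ := fun i x =>
    D.density (S.homDim - α * p) μ (Int.log 8 r - i) x ^ τ with hb
  have hN : ∀ i : ℕ, i < numGen m r → m ≤ Int.log 8 r - i := fun i hi => le_of_lt_numGen hi
  have hpt : ∀ x, D.densitySum (S.homDim - α * p) (1 / (p - 1)) μ r x ^ q ≤
      (∑ i ∈ Finset.range (numGen m r), b i x) ^ (n + 2) := by
    intro x
    calc D.densitySum (S.homDim - α * p) (1 / (p - 1)) μ r x ^ q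
        = (D.densitySum (S.homDim - α * p) (1 / (p - 1)) μ r x ^ (q / (n + 2))) ^ (n + 2) := by
          rw [← ENNReal.rpow_natCast, ← ENNReal.rpow_mul]
          congr 1
          push_cast
          field_simp
      _ ≤ _ := by
          gcongr
          refine (ENNReal.rpow_finsetSum_le_sum_rpow _ _ (div_pos hq0 hn0)
            ((div_le_one hn0).2 hn1)).trans_eq (Finset.sum_congr rfl fun i _ => ?_)
          simp only [hb]
          rw [← ENNReal.rpow_mul, hτ]
          congr 1
          field_simp
  have hlast : ∑ i ∈ Finset.range (numGen m r), ∫⁻ x, b i x ^ (n + 2) ≤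
      8 ^ S.homDim * S.ballVol * ((32 ^ S.homDim : ℕ) : ℝ≥0∞) ^ (q / (p - 1)) *
        ∑ i ∈ Finset.range (numGen m r),
          D.levelSum (S.homDim - α * p) (q / (p - 1)) μ (Int.log 8 r - i) := by
    rw [Finset.mul_sum]
    refine Finset.sum_le_sum fun i hi => ?_
    refine le_trans (le_of_eq (lintegral_congr fun x => ?_))
      (lintegral_le_levelSum (hN i (Finset.mem_range.1 hi)) _ hβ.le μ)
    simp only [hb]
    rw [← ENNReal.rpow_natCast, ← ENNReal.rpow_mul, hτ]
    congr 1
    push_cast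
    field_simp
  calc ∫⁻ x, D.densitySum (S.homDim - α * p) (1 / (p - 1)) μ r x ^ q
      ≤ ∫⁻ x, (∑ i ∈ Finset.range (numGen m r), b i x) ^ (n + 2) := lintegral_mono hpt
    _ ≤ _ := lintegral_sum_pow_le (J := fun i => D.idx (Int.log 8 r - i))
        (decayConst_ne_top hap hτ0) (one_le_decayConst hτ0) (idx_sub_eq hN)
        (fun i hi => (measurable_density (hN i hi) _ μ).pow_const _)
        (fun i _ x y h => by simp only [factorsThrough_density _ μ h])
        (fun i _ f hfm hf => lintegral_mul_sum_density_rpow_le hN (sub_add_cancel _ _) μ hτ0 hτ1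
          hfm hf) n
    _ ≤ _ := by
        refine (mul_le_mul_right hlast _).trans_eq ?_
        rw [sumConst]
        exact (mul_assoc _ _ _).symm

end DyadicFamily

lemma wolffPotential_eq_iSup (α p : ℝ) (r : ℝ) (μ : Measure 𝔤) (x : 𝔤) :
    S.wolffPotential α p r μ x = ⨆ n : ℕ, ∫⁻ t in Ioo ((8 : ℝ) ^ (-(n : ℤ))) r,
      DyadicFamily.wolffIntegrand S (S.homDim - α * p) (1 / (p - 1)) μ x t := by
  have hmono : Monotone fun n : ℕ => Ioo ((8 : ℝ) ^ (-(n : ℤ))) r := fun n n' h =>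
    Ioo_subset_Ioo_left (zpow_le_zpow_right₀ (by norm_num) (by omega))
  rw [← setLIntegral_iUnion_of_directed _ hmono.directed_le]
  have : Ioo (0 : ℝ) r = ⋃ n : ℕ, Ioo ((8 : ℝ) ^ (-(n : ℤ))) r := by
    ext t
    simp only [mem_iUnion, mem_Ioo]
    constructor
    · rintro ⟨h0, h1⟩
      obtain ⟨n, hn⟩ := exists_pow_lt_of_lt_one h0 (by norm_num : (8 : ℝ)⁻¹ < 1)
      exact ⟨n, by simpa using hn, h1⟩
    · rintro ⟨n, h0, h1⟩
      exact ⟨(zpow_pos_eight _).trans h0, h1⟩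
  rw [← this]
  rfl

/-- A bound for the norms of the sums of densities bounds the norm of the potential. -/
lemma lintegral_wolffPotential_rpow_le {α p q : ℝ} (hp : 1 < p) (hq : 0 < q) {r : ℝ}
    (μ : Measure 𝔤) (D : (m : ℤ) → S.DyadicFamily m) {B : ℝ≥0∞}
    (hB : ∀ m, ∫⁻ x, (D m).densitySum (S.homDim - α * p) (1 / (p - 1)) μ r x ^ q ≤ B) :
    ∫⁻ x, S.wolffPotential α p r μ x ^ q ≤
      (7 * eightPow (|S.homDim - α * p| * (1 / (p - 1)))) ^ q * B := by
  have hs : 0 < 1 / (p - 1) := one_div_pos.2 (by linarith)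
  set A : ℝ≥0∞ := 7 * eightPow (|S.homDim - α * p| * (1 / (p - 1))) with hA
  set H : ℕ → 𝔤 → ℝ≥0∞ := fun n x =>
    (D (-(n : ℤ))).densitySum (S.homDim - α * p) (1 / (p - 1)) μ r x with hH
  -- Truncations at `8 ^ (-n)` increase to the potential, but the density sums come from unrelated
  -- families and need not be monotone in `n`; hence a lower limit and Fatou's lemma.
  have hpt : ∀ x, S.wolffPotential α p r μ x ^ q ≤
      Filter.liminf (fun n => A ^ q * H n x ^ q) Filter.atTop := by
    intro x
    have hmono : Monotone fun n : ℕ => ∫⁻ t in Ioo ((8 : ℝ) ^ (-(n : ℤ))) r,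
        DyadicFamily.wolffIntegrand S (S.homDim - α * p) (1 / (p - 1)) μ x t := fun n n' h =>
      lintegral_mono_set (Ioo_subset_Ioo_left (zpow_le_zpow_right₀ (by norm_num) (by omega)))
    have h1 := ((ENNReal.continuous_rpow_const (y := q)).tendsto _).comp (tendsto_atTop_iSup hmono)
    rw [wolffPotential_eq_iSup, ← h1.liminf_eq]
    refine Filter.liminf_le_liminf (Filter.Eventually.of_forall fun n => ?_)
    rw [← ENNReal.mul_rpow_of_nonneg _ _ hq.le]
    exact ENNReal.rpow_le_rpow
      (DyadicFamily.setLIntegral_wolffIntegrand_le_densitySum _ hs μ x) hq.le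
  have hmeas : ∀ n, Measurable fun x => A ^ q * H n x ^ q := fun n =>
    ((DyadicFamily.measurable_densitySum _ _ μ r).pow_const q).const_mul _
  calc ∫⁻ x, S.wolffPotential α p r μ x ^ q
      ≤ ∫⁻ x, Filter.liminf (fun n => A ^ q * H n x ^ q) Filter.atTop := lintegral_mono hpt
    _ ≤ Filter.liminf (fun n => ∫⁻ x, A ^ q * H n x ^ q) Filter.atTop := lintegral_liminf_le hmeas
    _ ≤ Filter.liminf (fun _ : ℕ => A ^ q * B) Filter.atTop := by
        refine Filter.liminf_le_liminf (Filter.Eventually.of_forall fun n => ?_)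
        rw [lintegral_const_mul _ ((DyadicFamily.measurable_densitySum _ _ μ r).pow_const q)]
        gcongr
        exact hB _
    _ = _ := Filter.liminf_const _

end Stratification

end

/-! ### The two-sided estimate -/

theorem mainTheorem8 {𝔤 : Type*} [NormedLieRing 𝔤] [InnerLieAlgebra 𝔤] [FiniteDimensional ℝ 𝔤]
    [MeasurableSpace 𝔤] [BorelSpace 𝔤] (S : Stratification 𝔤)
    (α p q : ℝ) (hα : 0 < α) (hp : 1 < p) (hq : p - 1 < q) :
    ∃ c C : ℝ, 0 < c ∧ 0 < C ∧
      ∀ D : (m : ℤ) → S.DyadicFamily m, ∀ r : ℝ, 0 < r → ∀ μ : Measure 𝔤,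
        ENNReal.ofReal c * (⨆ m : ℤ, S.dyadicSum (D m) α p q r μ)
            ≤ ∫⁻ x, (S.wolffPotential α p r μ x) ^ q ∧
        ∫⁻ x, (S.wolffPotential α p r μ x) ^ q
            ≤ ENNReal.ofReal C * (⨆ m : ℤ, S.dyadicSum (D m) α p q r μ) := by
  have hp0 : 0 < p - 1 := by linarith
  have hq0 : 0 < q := by linarith
  have hβ : 1 < q / (p - 1) := (one_lt_div hp0).2 hq
  have hβ0 : 0 ≤ q / (p - 1) := by linarith
  obtain ⟨n, hn⟩ := exists_nat_ge (max q (q / (p - 1)))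
  have hn1 : q ≤ n + 2 := by linarith [le_max_left q (q / (p - 1))]
  have hn2 : q / (p - 1) ≤ n + 2 := by linarith [le_max_right q (q / (p - 1))]
  set a : ℝ := S.homDim - α * p with ha
  set v : ℝ≥0∞ := S.ballVol ^ (1 - a / S.homDim * (q / (p - 1))) with hv
  have hv0 : v ≠ 0 := by
    simp [hv, Stratification.ballVol_ne_zero, Stratification.ballVol_ne_top]
  have hvt : v ≠ ⊤ := by
    simp [hv, Stratification.ballVol_ne_zero, Stratification.ballVol_ne_top]
  have hdt : Stratification.DyadicFamily.dyadicConst S a (q / (p - 1)) ≠ ⊤ :=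
    ENNReal.rpow_ne_top_of_nonneg (abs_nonneg _) (by finiteness)
  set A : ℝ≥0∞ := Stratification.DyadicFamily.dyadicConst S a (q / (p - 1)) * v *
    (S.ballVol⁻¹ * ((3 * Stratification.DyadicFamily.shiftConst S a (q / (p - 1)) + 1) *
      Stratification.DyadicFamily.lowerConst S α p q)) with hA
  set B : ℝ≥0∞ := (7 * eightPow (|a| * (1 / (p - 1)))) ^ q *
    (Stratification.DyadicFamily.sumConst S (α * p) (q / (p - 1)) n *
      (v⁻¹ * Stratification.DyadicFamily.dyadicConst S a (q / (p - 1)))) with hB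
  have hAt : A ≠ ⊤ := by
    have h1 : Stratification.DyadicFamily.shiftConst S a (q / (p - 1)) ≠ ⊤ :=
      Stratification.DyadicFamily.shiftConst_ne_top hβ0
    have h2 := Stratification.DyadicFamily.lowerConst_ne_top (S := S) hα hp hq
    have h3 : S.ballVol⁻¹ ≠ ⊤ := ENNReal.inv_ne_top.2 Stratification.ballVol_ne_zero
    finiteness
  have hBt : B ≠ ⊤ := by
    have h1 := Stratification.DyadicFamily.sumConst_ne_top (S := S) (mul_pos hα (by linarith))
      (by linarith : 0 < q / (p - 1)) n (ap := α * p)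
    have h2 : v⁻¹ ≠ ⊤ := ENNReal.inv_ne_top.2 hv0
    have h3 : (7 * eightPow (|a| * (1 / (p - 1)))) ^ q ≠ ⊤ :=
      ENNReal.rpow_ne_top_of_nonneg hq0.le (ENNReal.mul_ne_top (by norm_num) (eightPow_ne_top _))
    finiteness
  -- Both constants are finite; adding `1` makes the real constants positive without examining
  -- whether `A` or `B` vanishes.
  refine ⟨(A.toReal + 1)⁻¹, B.toReal + 1, by positivity, by positivity, fun D r hr μ => ⟨?_, ?_⟩⟩
  · rw [ENNReal.mul_iSup]
    refine iSup_le fun m => ?_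
    have h1 := Stratification.DyadicFamily.dyadicSum_le (D := D m) (α := α) hβ0 hr μ
    have h2 := Stratification.DyadicFamily.dyadicSum_le_lintegral (D := D m) (α := α) hp hq hr
      (D (Int.log 8 r - 3)) μ
    rw [ENNReal.mul_le_iff_le_inv Stratification.ballVol_ne_zero
      Stratification.ballVol_ne_top] at h2
    have h3 : S.dyadicSum (D m) α p q r μ ≤ A * ∫⁻ x, S.wolffPotential α p r μ x ^ q := by
      refine (h1.trans (mul_le_mul_right h2 _)).trans_eq ?_
      rw [hA]
      ring
    have hpos : 0 < A.toReal + 1 := by positivity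
    rw [ENNReal.ofReal_inv_of_pos hpos, mul_comm, ← div_eq_mul_inv]
    refine ENNReal.div_le_of_le_mul (h3.trans ?_)
    rw [mul_comm]
    gcongr
    rw [← ENNReal.ofReal_toReal hAt]
    exact ENNReal.ofReal_le_ofReal (by simp)
  · have h1 : ∀ m, ∫⁻ x, (D m).densitySum (S.homDim - α * p) (1 / (p - 1)) μ r x ^ q ≤
        Stratification.DyadicFamily.sumConst S (α * p) (q / (p - 1)) n *
          (v⁻¹ * (Stratification.DyadicFamily.dyadicConst S a (q / (p - 1)) *
            ⨆ m : ℤ, S.dyadicSum (D m) α p q r μ)) := by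
      intro m
      refine (Stratification.DyadicFamily.lintegral_densitySum_rpow_le hα hp hq hn1 hn2 r μ).trans ?_
      gcongr
      rw [← ENNReal.mul_le_iff_le_inv hv0 hvt]
      refine (Stratification.DyadicFamily.sum_levelSum_le (D := D m) (α := α) hβ0 hr μ).trans ?_
      gcongr
      exact le_iSup (fun m => S.dyadicSum (D m) α p q r μ) m
    calc ∫⁻ x, S.wolffPotential α p r μ x ^ q
        ≤ B * ⨆ m : ℤ, S.dyadicSum (D m) α p q r μ := by
          refine (Stratification.lintegral_wolffPotential_rpow_le hp hq0 μ D h1).trans_eq ?_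
          rw [hB]
          ring
      _ ≤ _ := by
          gcongr
          rw [← ENNReal.ofReal_toReal hBt]
          exact ENNReal.ofReal_le_ofReal (by simp)
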